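/- Let $n\ge 1$. For $\mathsf a=(a_1,\dots,a_{n-1})\in\mathbb Z_{\ge 0}^{n-1}$ let $\pi_{\mathsf a}$ be the irreducible unitary representation of $SU(n)$ with highest weight $\sum_k a_k\omega_k$, where $\omega_k$ is the highest weight of $\Lambda^k\mathbb C^n$; concretely, $\pi_{\mathsf a}$ is the subrepresentation of $\bigotimes_{k=1}^{n-1}(\Lambda^k\mathbb C^n)^{\otimes a_k}$ generated by $\bigotimes_k (e_1\wedge\dots\wedge e_k)^{\otimes a_k}$. Let $\pi_k$ be $\pi_{\mathsf a}$ for $\mathsf a$ the $k$-th unit vector. Every irreducible unitary representation $\pi$ of $SU(n)$ extends uniquely to a holomorphic representation $\pi_{\mathbb C}$ of $SL(n,\mathbb C)$; for $\pi_{\mathsf a}$ the extension is given by the same formula. (1) For every $D=\mathrm{diag}(x_1,\dots,x_n)\in SL(n,\mathbb C)$ and every $\mathsf a$, in operator norm, $$\|(\pi_{\mathsf a})_{\mathbb C}(D)\|=\prod_{k=1}^{n-1}\|(\pi_k)_{\mathbb C}(D)\|^{a_k}.$$ If moreover $|x_1|\ge|x_2|\ge\dots\ge|x_n|$, then $$\|(\pi_{\mathsf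 a})_{\mathbb C}(D)\|=\prod_{k=1}^{n-1}|x_1\cdots x_k|^{a_k}.$$ (2) Let $S=\{\pi_1,\dots,\pi_{n-1}\}$; for $\pi$ in the unitary dual $\widehat{SU(n)}$ let $\tau_S(\pi)$ be the smallest $k\ge 0$ such that $\pi$ is contained in a tensor product of $k$ elements of $S$ (the empty product being the trivial representation). For $\beta\ge 1$ put $w^S_\beta(\pi)=\beta^{\tau_S(\pi)}$ and $$A(SU(n),w^S_\beta)=\Big\{f\in C(SU(n)):\ \|f\|:=\sum_{\pi\in\widehat{SU(n)}}d_\pi\,w^S_\beta(\pi)\,\|\widehat f(\pi)\|_1<\infty\Big\},\qquad \widehat f(\pi)=\int_{SU(n)}f(g)\pi(g)\,dg,$$ where $d_\pi=\dim\pi$, $\|\cdot\|_1$ is the trace norm and $dg$ is normalized Haar measure. Then $A(SU(n),w^S_\beta)$ is closed under pointwise multiplication, and its Gelfand spectrum (the non-zero bounded multiplicative linear functionals, with the topology of pointwise convergence) is homeomorphic to the subspace $$\Big\{UDV:\ U,V\in SU(n),\ D=\mathrm{diag}(x_1,\dots,x_n)\in SL(n,\mathbb C),\ |x_1|\ge\dots\ge|x_n|,\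 |x_1\cdots x_k|\le\beta\ (1\le k\le n-1)\Big\}$$ of $SL(n,\mathbb C)$, through a homeomorphism $A\mapsto\varphi_A$ such that for every irreducible unitary representation $\pi$ of $SU(n)$ and all vectors $v,w$ the coefficient function $g\mapsto\langle\pi(g)v,w\rangle$ belongs to $A(SU(n),w^S_\beta)$ and $\varphi_A$ maps it to $\langle\pi_{\mathbb C}(A)v,w\rangle$. -/

import Mathlib

noncomputable section

open MeasureTheory Matrix
open scoped TensorProduct

namespace BeurlingFourier

/-! ### The trace norm on operators of a finite-dimensional Hilbert space -/

section TraceNorm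

variable {V : Type*} [NormedAddCommGroup V] [InnerProductSpace ℂ V] [FiniteDimensional ℂ V]

/-- The trace norm `‖T‖₁ = Tr |T|`, i.e. the sum of the singular values of `T`. -/
def traceNorm (T : V →ₗ[ℂ] V) : ℝ :=
  ∑ i ∈ Finset.range (Module.finrank ℂ V), T.singularValues i

theorem traceNorm_nonneg (T : V →ₗ[ℂ] V) : 0 ≤ traceNorm T :=
  Finset.sum_nonneg fun i _ => T.singularValues_nonneg i

/-- A right singular basis of `T`. -/
theorem exists_singularBasis (T : V →ₗ[ℂ] V) :
    ∃ u : OrthonormalBasis (Fin (Module.finrank ℂ V)) ℂ V,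
      (∀ i j, i ≠ j → inner ℂ (T (u i)) (T (u j)) = 0) ∧ traceNorm T = ∑ i, ‖T (u i)‖ := by
  set u := T.isSymmetric_adjoint_comp_self.eigenvectorBasis rfl with hu
  have key : ∀ i j, inner ℂ (T (u i)) (T (u j))
      = (T.isSymmetric_adjoint_comp_self.eigenvalues rfl j : ℂ) * inner ℂ (u i) (u j) := by
    intro i j
    rw [← LinearMap.adjoint_inner_right, ← LinearMap.comp_apply, hu,
      LinearMap.IsSymmetric.apply_eigenvectorBasis, inner_smul_right]
    rfl
  refine ⟨u, fun i j hij => ?_, ?_⟩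
  · rw [key, u.orthonormal.2 hij, mul_zero]
  · rw [traceNorm, Finset.sum_range]
    refine Finset.sum_congr rfl fun i _ => ?_
    rw [T.singularValues_fin rfl i]
    have h := key i i
    rw [inner_self_eq_norm_sq_to_K, inner_self_eq_norm_sq_to_K, u.orthonormal.1 i] at h
    have h2 : ‖T (u i)‖ ^ 2 = T.isSymmetric_adjoint_comp_self.eigenvalues rfl i := by
      have h3 := congrArg Complex.re h
      simpa [← Complex.ofReal_pow] using h3
    rw [← h2, Real.sqrt_sq (norm_nonneg _)]

theorem norm_sum_inner_le_traceNorm (T : V →ₗ[ℂ] V) {ι : Type*} [Fintype ι] {e f : ι → V}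
    (he : Orthonormal ℂ e) (hf : Orthonormal ℂ f) :
    ‖∑ i, inner ℂ (f i) (T (e i))‖ ≤ traceNorm T := by
  obtain ⟨u, -, hu⟩ := exists_singularBasis T
  have h1 : ∀ i, inner ℂ (f i) (T (e i))
      = ∑ j, inner ℂ (u j) (e i) * inner ℂ (f i) (T (u j)) := by
    intro i
    conv_lhs => rw [← u.sum_repr' (e i)]
    rw [map_sum, inner_sum]
    simp [inner_smul_right]
  simp_rw [h1]
  rw [Finset.sum_comm, hu]
  refine (norm_sum_le _ _).trans (Finset.sum_le_sum fun j _ => ?_)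
  calc ‖∑ i, inner ℂ (u j) (e i) * inner ℂ (f i) (T (u j))‖
      ≤ ∑ i, ‖inner ℂ (e i) (u j)‖ * ‖inner ℂ (f i) (T (u j))‖ := by
        refine (norm_sum_le _ _).trans (le_of_eq (Finset.sum_congr rfl fun i _ => ?_))
        rw [norm_mul, norm_inner_symm]
    _ ≤ √(∑ i, ‖inner ℂ (e i) (u j)‖ ^ 2) * √(∑ i, ‖inner ℂ (f i) (T (u j))‖ ^ 2) :=
        Real.sum_mul_le_sqrt_mul_sqrt _ _ _
    _ ≤ √(‖u j‖ ^ 2) * √(‖T (u j)‖ ^ 2) := by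
        gcongr
        · exact he.sum_inner_products_le (u j)
        · exact hf.sum_inner_products_le (T (u j))
    _ = ‖T (u j)‖ := by
        rw [Real.sqrt_sq (norm_nonneg _), Real.sqrt_sq (norm_nonneg _), u.orthonormal.1 j, one_mul]

theorem exists_traceNorm_eq (T : V →ₗ[ℂ] V) :
    ∃ (I : Finset (Fin (Module.finrank ℂ V))) (e f : I → V), Orthonormal ℂ e ∧ Orthonormal ℂ f ∧
      (traceNorm T : ℂ) = ∑ i, inner ℂ (f i) (T (e i)) := by
  classical
  obtain ⟨u, horth, hu⟩ := exists_singularBasis T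
  refine ⟨Finset.univ.filter fun i => T (u i) ≠ 0, fun i => u i,
    fun i => ((‖T (u i)‖ : ℂ)⁻¹) • T (u i), ?_, ?_, ?_⟩
  · exact u.orthonormal.comp _ Subtype.val_injective
  · refine ⟨fun i => ?_, fun i j hij => ?_⟩
    · have : T (u i) ≠ 0 := (Finset.mem_filter.mp i.2).2
      rw [norm_smul, norm_inv, Complex.norm_real, norm_norm,
        inv_mul_cancel₀ (norm_ne_zero_iff.mpr this)]
    · simp [inner_smul_left, inner_smul_right, horth _ _ (fun h => hij (Subtype.ext h))]
  · have h : ∀ i : (Finset.univ.filter fun i => T (u i) ≠ 0),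
        inner ℂ (((‖T (u i)‖ : ℂ)⁻¹) • T (u i)) (T (u i)) = (‖T (u i)‖ : ℂ) := by
      intro i
      have : T (u i) ≠ 0 := (Finset.mem_filter.mp i.2).2
      have h0 : (‖T (u i)‖ : ℂ) ≠ 0 := by exact_mod_cast norm_ne_zero_iff.mpr this
      rw [inner_smul_left, inner_self_eq_norm_sq_to_K, map_inv₀, Complex.conj_ofReal]
      simp only [Complex.coe_algebraMap]
      field_simp
    rw [Finset.sum_congr rfl fun i _ => h i, hu, Complex.ofReal_sum,
      Finset.sum_coe_sort (Finset.univ.filter fun i => T (u i) ≠ 0)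
        (fun i => (‖T (u i)‖ : ℂ)), Finset.sum_filter]
    refine Finset.sum_congr rfl fun i _ => ?_
    split_ifs with hi
    · rfl
    · simp [not_not.mp hi]

theorem traceNorm_add_le (S T : V →ₗ[ℂ] V) : traceNorm (S + T) ≤ traceNorm S + traceNorm T := by
  obtain ⟨I, e, f, he, hf, h⟩ := exists_traceNorm_eq (S + T)
  have h2 : ‖(traceNorm (S + T) : ℂ)‖ ≤ traceNorm S + traceNorm T := by
    rw [h]
    simp only [LinearMap.add_apply, inner_add_right, Finset.sum_add_distrib]
    exact (norm_add_le _ _).trans (add_le_add (norm_sum_inner_le_traceNorm S he hf)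
      (norm_sum_inner_le_traceNorm T he hf))
  rwa [Complex.norm_real, Real.norm_of_nonneg (traceNorm_nonneg _)] at h2

theorem traceNorm_smul_le (c : ℂ) (T : V →ₗ[ℂ] V) : traceNorm (c • T) ≤ ‖c‖ * traceNorm T := by
  obtain ⟨I, e, f, he, hf, h⟩ := exists_traceNorm_eq (c • T)
  have h2 : ‖(traceNorm (c • T) : ℂ)‖ ≤ ‖c‖ * traceNorm T := by
    rw [h]
    simp only [LinearMap.smul_apply, inner_smul_right, ← Finset.mul_sum, norm_mul]
    exact mul_le_mul_of_nonneg_left (norm_sum_inner_le_traceNorm T he hf) (norm_nonneg _)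
  rwa [Complex.norm_real, Real.norm_of_nonneg (traceNorm_nonneg _)] at h2

theorem traceNorm_zero : traceNorm (0 : V →ₗ[ℂ] V) = 0 := by
  simp [traceNorm]

end TraceNorm

/-! ### The unitary dual of a compact group and central Beurling-Fourier algebras -/

section Compact

/-- Two representations on Hilbert spaces are unitarily equivalent. -/
def UnitarilyEquivalent {G V W : Type*} [Group G]
    [NormedAddCommGroup V] [InnerProductSpace ℂ V] [NormedAddCommGroup W] [InnerProductSpace ℂ W]
    (π : Representation ℂ G V) (σ : Representation ℂ G W) : Prop :=
  ∃ U : V ≃ₗᵢ[ℂ] W, ∀ g v, U (π g v) = σ g (U v)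

variable (G : Type) [Group G] [TopologicalSpace G]

/-- A continuous irreducible unitary representation of `G` on some `ℂ^d`. -/
structure UnitaryIrrep where
  dim : ℕ
  rep : Representation ℂ G (EuclideanSpace ℂ (Fin dim))
  norm_map : ∀ g v, ‖rep g v‖ = ‖v‖
  continuous : Continuous fun g => LinearMap.toContinuousLinearMap (rep g)
  irreducible : rep.IsIrreducible

/-- Unitary equivalence of irreducible unitary representations. -/
instance unitaryIrrepSetoid : Setoid (UnitaryIrrep G) where
  r π σ := UnitarilyEquivalent π.rep σ.rep
  iseqv :=
    { refl := fun _ => ⟨LinearIsometryEquiv.refl ℂ _, fun _ _ => rfl⟩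
      symm := fun ⟨U, hU⟩ => ⟨U.symm, fun g v => by
        rw [LinearIsometryEquiv.symm_apply_eq, hU, LinearIsometryEquiv.apply_symm_apply]⟩
      trans := fun ⟨U, hU⟩ ⟨W, hW⟩ => ⟨U.trans W, fun g v => by
        simp [LinearIsometryEquiv.trans_apply, hU, hW]⟩ }

/-- The unitary dual of the compact group `G` (whose irreducible unitary representations are
finite-dimensional): classes of irreducible unitary representations. -/
def UnitaryDual : Type := Quotient (unitaryIrrepSetoid G)

variable {G}

/-- A representative of a class in the unitary dual. -/
def UnitaryDual.irrep (p : UnitaryDual G) : UnitaryIrrep G := Quotient.out p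

/-- `p ⊆ σ₁ ⊗ ⋯ ⊗ σ_k`: the irreducible representation `p` is a subrepresentation of the tensor
product of the `σ i` (the trivial representation on `ℂ` if `k = 0`). -/
def IsSubrepOfTensor (p : UnitaryDual G) {k : ℕ} (σ : Fin k → UnitaryDual G) : Prop :=
  ∃ T : EuclideanSpace ℂ (Fin p.irrep.dim) →ₗ[ℂ]
      ⨂[ℂ] i : Fin k, EuclideanSpace ℂ (Fin (σ i).irrep.dim),
    Function.Injective T ∧
      ∀ g v, T (p.irrep.rep g v) = PiTensorProduct.map (fun i => (σ i).irrep.rep g) (T v)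

/-- The length function `τ_S` of a generating set `S` of the unitary dual: the smallest `k` such
that `p` is contained in a tensor product of `k` elements of `S`. (Allowing factors from `S ∪ {1}`
instead, as is often done, gives the same minimum.) -/
def lengthFun (S : Set (UnitaryDual G)) (p : UnitaryDual G) : ℕ :=
  sInf {k | ∃ σ : Fin k → UnitaryDual G, (∀ i, σ i ∈ S) ∧ IsSubrepOfTensor p σ}

/-- The exponential weight `w^S_β(π) = β ^ τ_S(π)`, a function on the dual with values in
`(0, ∞)`. -/
def expWeight (S : Set (UnitaryDual G)) (β : ℝ) (hβ : 1 ≤ β) (p : UnitaryDual G) :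
    Set.Ioi (0 : ℝ) :=
  ⟨β ^ lengthFun S p, pow_pos (zero_lt_one.trans_le hβ) _⟩

/-- The coefficient function `g ↦ ⟨π(g) v, w⟩`. -/
def UnitaryIrrep.coeff (π : UnitaryIrrep G) (v w : EuclideanSpace ℂ (Fin π.dim)) : C(G, ℂ) where
  toFun g := inner ℂ w (π.rep g v)
  continuous_toFun := by
    have h : Continuous fun g => (LinearMap.toContinuousLinearMap (π.rep g)) v :=
      π.continuous.clm_apply continuous_const
    exact continuous_const.inner h

variable [IsTopologicalGroup G] [CompactSpace G] [MeasurableSpace G] [BorelSpace G]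

/-- The Fourier coefficient `f̂(π) = ∫ f(g) π(g) dg` for the normalized Haar measure. -/
def fourierCoeff (f : C(G, ℂ)) (π : UnitaryIrrep G) :
    EuclideanSpace ℂ (Fin π.dim) →L[ℂ] EuclideanSpace ℂ (Fin π.dim) :=
  ∫ g, f g • LinearMap.toContinuousLinearMap (π.rep g) ∂(Measure.haarMeasure ⊤)

theorem integrable_fourier (f : C(G, ℂ)) (π : UnitaryIrrep G) :
    Integrable (fun g => f g • LinearMap.toContinuousLinearMap (π.rep g))
      (Measure.haarMeasure (⊤ : TopologicalSpace.PositiveCompacts G)) :=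
  (f.continuous.smul π.continuous).integrable_of_hasCompactSupport
    (HasCompactSupport.of_compactSpace _)

theorem fourierCoeff_add (f g : C(G, ℂ)) (π : UnitaryIrrep G) :
    fourierCoeff (f + g) π = fourierCoeff f π + fourierCoeff g π := by
  rw [fourierCoeff, fourierCoeff, fourierCoeff,
    ← integral_add (integrable_fourier f π) (integrable_fourier g π)]
  refine integral_congr_ae (Filter.Eventually.of_forall fun x => ?_)
  exact add_smul (f x) (g x) (LinearMap.toContinuousLinearMap (π.rep x))

theorem fourierCoeff_smul (c : ℂ) (f : C(G, ℂ)) (π : UnitaryIrrep G) :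
    fourierCoeff (c • f) π = c • fourierCoeff f π := by
  rw [fourierCoeff, fourierCoeff, ← integral_smul]
  refine integral_congr_ae (Filter.Eventually.of_forall fun x => ?_)
  exact mul_smul c (f x) (LinearMap.toContinuousLinearMap (π.rep x))

/-- The term `d_π w(π) ‖f̂(π)‖₁`. -/
def bfTerm (w : UnitaryDual G → Set.Ioi (0 : ℝ)) (f : C(G, ℂ)) (p : UnitaryDual G) : ℝ :=
  p.irrep.dim * (w p : ℝ) * traceNorm (fourierCoeff f p.irrep).toLinearMap

theorem bfTerm_nonneg (w : UnitaryDual G → Set.Ioi (0 : ℝ)) (f : C(G, ℂ)) (p : UnitaryDual G) :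
    0 ≤ bfTerm w f p :=
  mul_nonneg (mul_nonneg (Nat.cast_nonneg _) (le_of_lt (w p).2)) (traceNorm_nonneg _)

/-- The central Beurling-Fourier algebra
`A(G, w) = {f ∈ C(G) : ∑_π d_π w(π) ‖f̂(π)‖₁ < ∞}`. -/
def beurlingFourier (w : UnitaryDual G → Set.Ioi (0 : ℝ)) : Submodule ℂ C(G, ℂ) where
  carrier := {f | Summable (bfTerm w f)}
  zero_mem' := by
    have h0 : ∀ π : UnitaryIrrep G, fourierCoeff (0 : C(G, ℂ)) π = 0 := fun π => by
      have h := fourierCoeff_smul (0 : ℂ) (0 : C(G, ℂ)) π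
      rw [smul_zero] at h
      exact h.trans (zero_smul ℂ (fourierCoeff (0 : C(G, ℂ)) π))
    have h : bfTerm w (0 : C(G, ℂ)) = 0 := by
      funext p
      simp [bfTerm, h0, traceNorm_zero]
    change Summable (bfTerm w (0 : C(G, ℂ)))
    rw [h]
    exact summable_zero
  add_mem' := by
    intro f g hf hg
    refine Summable.of_nonneg_of_le (bfTerm_nonneg w _) (fun p => ?_) (hf.add hg)
    simp only [bfTerm, fourierCoeff_add, ContinuousLinearMap.toLinearMap_add]
    rw [← mul_add]
    exact mul_le_mul_of_nonneg_left (traceNorm_add_le _ _)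
      (mul_nonneg (Nat.cast_nonneg _) (le_of_lt (w p).2))
  smul_mem' := by
    intro c f hf
    refine Summable.of_nonneg_of_le (bfTerm_nonneg w _) (fun p => ?_) (hf.mul_left ‖c‖)
    simp only [bfTerm, fourierCoeff_smul, ContinuousLinearMap.toLinearMap_smul]
    rw [mul_left_comm]
    exact mul_le_mul_of_nonneg_left (traceNorm_smul_le _ _)
      (mul_nonneg (Nat.cast_nonneg _) (le_of_lt (w p).2))

/-- The norm `∑_π d_π w(π) ‖f̂(π)‖₁` of `A(G, w)`. -/
def bfNorm (w : UnitaryDual G → Set.Ioi (0 : ℝ)) (f : beurlingFourier w) : ℝ :=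
  ∑' p, bfTerm w f p

/-- The Gelfand spectrum of `A(G, w)`: non-zero bounded linear functionals that are multiplicative
for the pointwise product. -/
def Spec (w : UnitaryDual G → Set.Ioi (0 : ℝ)) : Type :=
  {φ : beurlingFourier w →ₗ[ℂ] ℂ //
    φ ≠ 0 ∧
    (∀ (f g : beurlingFourier w) (h : (f * g : C(G, ℂ)) ∈ beurlingFourier w),
      φ ⟨f * g, h⟩ = φ f * φ g) ∧
    ∃ C : ℝ, ∀ f, ‖φ f‖ ≤ C * bfNorm w f}

/-- The Gelfand (weak-*) topology: pointwise convergence on `A(G, w)`. -/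
instance (w : UnitaryDual G → Set.Ioi (0 : ℝ)) : TopologicalSpace (Spec w) :=
  TopologicalSpace.induced (fun φ (f : beurlingFourier w) => φ.1 f) inferInstance

end Compact

/-! ### `SU(n)`, `SL(n, ℂ)` and their representations -/

section SU

/-- The group `SU(n)`. -/
abbrev SU (n : ℕ) := Matrix.specialUnitaryGroup (Fin n) ℂ

/-- The group `SL(n, ℂ)`, the complexification of `SU(n)`. -/
abbrev SL (n : ℕ) := Matrix.SpecialLinearGroup (Fin n) ℂ

variable (n : ℕ)

instance : IsTopologicalGroup (SU n) where
  continuous_inv :=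
    Continuous.subtype_mk (continuous_star.comp continuous_subtype_val) _

instance : CompactSpace (SU n) := by
  change CompactSpace (SetLike.coe (SU n))
  rw [← isCompact_iff_compactSpace]
  have hK : IsCompact (Set.univ.pi fun _ : Fin n => Set.univ.pi fun _ : Fin n =>
      Metric.closedBall (0 : ℂ) 1) :=
    isCompact_univ_pi fun _ => isCompact_univ_pi fun _ => isCompact_closedBall _ _
  refine IsCompact.of_isClosed_subset (s := (Set.univ.pi fun _ : Fin n => Set.univ.pi
    fun _ : Fin n => Metric.closedBall (0 : ℂ) 1 : Set (Matrix (Fin n) (Fin n) ℂ))) hK ?_ ?_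
  · have h : SetLike.coe (SU n)
        = {A | star A * A = 1} ∩ {A | A * star A = 1} ∩ {A | A.det = 1} := by
      ext A
      simp [Matrix.mem_specialUnitaryGroup_iff, Unitary.mem_iff, Matrix.unitaryGroup]
    rw [h]
    exact ((isClosed_eq (by fun_prop) (by fun_prop)).inter
      (isClosed_eq (by fun_prop) (by fun_prop))).inter (isClosed_eq (by fun_prop) (by fun_prop))
  · intro A hA i _ j _
    simpa using entry_norm_bound_of_unitary (Matrix.mem_specialUnitaryGroup_iff.mp hA).1 i j

instance : MeasurableSpace (SU n) := borel _

instance : BorelSpace (SU n) := ⟨rfl⟩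

/-- The inclusion of `SU(n)` into `SL(n, ℂ)`. -/
def toSL : SU n →* SL n where
  toFun g := ⟨g.1, (Matrix.mem_specialUnitaryGroup_iff.mp g.2).2⟩
  map_one' := rfl
  map_mul' _ _ := rfl

variable {n}

/-- Holomorphic maps on the complex submanifold `SL(n, ℂ)` of the space of `n × n` matrices:
those that locally extend to complex differentiable maps on open sets of matrices. -/
def IsHolomorphic {E : Type*} [NormedAddCommGroup E] [NormedSpace ℂ E] (f : SL n → E) : Prop :=
  ∀ x : SL n, ∃ (U : Set (Fin n → Fin n → ℂ)) (F : (Fin n → Fin n → ℂ) → E),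
    IsOpen U ∧ (fun i j => x.1 i j) ∈ U ∧ DifferentiableOn ℂ F U ∧
      ∀ y : SL n, (fun i j => y.1 i j) ∈ U → F (fun i j => y.1 i j) = f y

/-- `σ` is a holomorphic representation of `SL(n, ℂ)` that extends the representation `π` of
`SU(n)`. -/
def IsHolomorphicExtension {V : Type*} [NormedAddCommGroup V] [InnerProductSpace ℂ V]
    [FiniteDimensional ℂ V] (π : Representation ℂ (SU n) V) (σ : Representation ℂ (SL n) V) :
    Prop :=
  IsHolomorphic (fun x => LinearMap.toContinuousLinearMap (σ x)) ∧ ∀ g, σ (toSL n g) = π g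

variable (n)

/-- The boxes of the Young diagram with `a k` columns of height `k + 1` for each
`k = 0, …, n - 2`; the box `⟨k, c, r⟩` is in row `r` of the `c`-th column of height `k + 1`. -/
abbrev Box (a : Fin (n - 1) → ℕ) := Σ k : Fin (n - 1), Fin (a k) × Fin (k.1 + 1)

/-- The Hilbert space `⨂_{boxes} ℂⁿ`, with the orthonormal basis indexed by fillings of the
diagram with numbers in `{0, …, n - 1}`. -/
abbrev TensorSpace (a : Fin (n - 1) → ℕ) := EuclideanSpace ℂ (Box n a → Fin n)

/-- The matrix of `A ⊗ ⋯ ⊗ A` (one factor for each box). -/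
def tensorMatrix (a : Fin (n - 1) → ℕ) :
    Matrix (Fin n) (Fin n) ℂ →* Matrix (Box n a → Fin n) (Box n a → Fin n) ℂ where
  toFun A := Matrix.of fun I J => ∏ b, A (I b) (J b)
  map_one' := by
    ext I J
    simp only [Matrix.of_apply, Matrix.one_apply, Finset.prod_ite_zero, Finset.prod_const_one]
    simp [funext_iff]
  map_mul' A B := by
    ext I J
    simp only [Matrix.of_apply, Matrix.mul_apply, ← Finset.prod_mul_distrib]
    rw [Finset.prod_univ_sum]
    simp

/-- The representation `x ↦ x ⊗ ⋯ ⊗ x` of `SL(n, ℂ)`. -/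
def tensorRep (a : Fin (n - 1) → ℕ) : Representation ℂ (SL n) (TensorSpace n a) where
  toFun x := Matrix.toLpLinAlgEquiv 2 (tensorMatrix n a x.1)
  map_one' := by rw [Matrix.SpecialLinearGroup.coe_one, map_one, map_one]
  map_mul' x y := by rw [Matrix.SpecialLinearGroup.coe_mul, map_mul, map_mul]

/-- The tensor `⨂_{columns} e₀ ∧ ⋯ ∧ e_k` (one factor for each column, of height `k + 1`): the
highest weight vector of `⨂_k (Λ^{k+1} ℂⁿ)^{⊗ a k}`, the wedge products being realized as
antisymmetric tensors. -/
def highestWeightVector (a : Fin (n - 1) → ℕ) : TensorSpace n a :=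
  WithLp.toLp 2 fun I => ∏ k : Fin (n - 1), ∏ c : Fin (a k),
    Matrix.det (Matrix.of fun r s : Fin (k.1 + 1) =>
      if (I ⟨k, c, r⟩).val = s.val then (1 : ℂ) else 0)

/-- The subrepresentation of `⨂_k (Λ^{k+1} ℂⁿ)^{⊗ a k}` generated by the highest weight vector. -/
def highestWeightSubrep (a : Fin (n - 1) → ℕ) : Subrepresentation (tensorRep n a) where
  toSubmodule := Submodule.span ℂ (Set.range fun x : SL n =>
    tensorRep n a x (highestWeightVector n a))
  apply_mem_toSubmodule g v hv := by
    induction hv using Submodule.span_induction with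
    | mem v hv =>
      obtain ⟨x, rfl⟩ := hv
      refine Submodule.subset_span ⟨g * x, ?_⟩
      simp only [map_mul, Module.End.mul_apply]
    | zero => simp
    | add v w _ _ hv hw => rw [map_add]; exact Submodule.add_mem _ hv hw
    | smul c v _ hv => rw [map_smul]; exact Submodule.smul_mem _ c hv

/-- The Hilbert space of `π_a`, with the inner product inherited from the tensor space. -/
abbrev HWSpace (a : Fin (n - 1) → ℕ) := (highestWeightSubrep n a).toSubmodule

/-- The irreducible representation of `SL(n, ℂ)` with highest weight `∑_k a_k ω_k`, where `ω_k` is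
the highest weight of `Λ^k ℂⁿ`; here `a k` (`k = 0, …, n - 2`) is the coefficient of `ω_{k+1}`. -/
def hwRepC (a : Fin (n - 1) → ℕ) : Representation ℂ (SL n) (HWSpace n a) :=
  (highestWeightSubrep n a).toRepresentation

/-- The representation `π_a` of `SU(n)` with highest weight `∑_k a_k ω_k`. -/
def hwRep (a : Fin (n - 1) → ℕ) : Representation ℂ (SU n) (HWSpace n a) :=
  (hwRepC n a).comp (toSL n)

/-- The canonical generating set `S = {π_{(1,0,…,0)}, …, π_{(0,…,0,1)}}` of the dual of `SU(n)`. -/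
def generators : Set (UnitaryDual (SU n)) :=
  {p | ∃ k : Fin (n - 1),
    UnitarilyEquivalent (W := HWSpace n (Pi.single k 1)) p.irrep.rep (hwRep n (Pi.single k 1))}

/-- The matrices `U D V` with `U, V ∈ SU(n)` and `D = diag(x₁, …, x_n) ∈ SL(n, ℂ)` such that
`|x₁| ≥ ⋯ ≥ |x_n|` and `|x₁ ⋯ x_k| ≤ β` for `1 ≤ k ≤ n - 1`. -/
def spectralSet (β : ℝ) : Set (SL n) :=
  {A | ∃ (U V : SU n) (D : SL n) (x : Fin n → ℂ), D.1 = Matrix.diagonal x ∧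
    Antitone (fun i => ‖x i‖) ∧
    (∀ k : Fin (n - 1), ‖∏ i with i.val ≤ k.val, x i‖ ≤ β) ∧
    A = toSL n U * D * toSL n V}

end SU

end BeurlingFourier

end

open BeurlingFourier

noncomputable section

set_option linter.unusedSectionVars false

open MeasureTheory Matrix
open scoped TensorProduct

namespace BeurlingFourier

/-! ### Averaging and Schur orthogonality -/

section Schur

/-! Norm formula. In the tensor model `diag(x)` multiplies the basis vector of a filling `I` by `∏
b, x (I b)`. Elements of `π_a` are antisymmetric in each column, hence supported on fillings with
distinct entries in each column. If the `|x i|` decrease, the modulus of such a product is largest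
when every column holds the first indices, which happens on the support of the highest weight
vector; so the norm is the modulus of the highest weight at `x` (`norm_hwRepC_diagonal`). An
arbitrary diagonal matrix is conjugate to an ordered one under a permutation matrix with phases in
`SU(n)`.

Reduction to matrices. The trigonometric polynomials on `SU(n)` are exactly the polynomials in the
matrix entries `u_ij`: the latter are dense by Stone–Weierstrass, and Schur orthogonality upgrades
density to equality. They extend to `SL(n, ℂ)` holomorphically, and uniquely, by the Cartan
decomposition and the identity theorem (`IsHolomorphic.ext`). They are also dense in the
Beurling-Fourier algebra, so a point `φ` of the spectrum is determined by the matrix `A =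
(φ(u_ij))`, which has determinant one, and `φ` evaluates holomorphic extensions at `A`. It remains
to see which `A` give bounded functionals.

Necessity. Points of the spectrum are contractive, by taking roots of powers. Applied to conjugated
coefficients of an irreducible `p`, this gives `‖p_ℂ(A⁻¹)‖ ≤ w(p)`, and for the fundamental
representations the bound is at most `β`. By the norm formula and the Cartan decomposition, this
puts `A⁻¹` in the spectral set, which is stable under inversion.

Sufficiency. If `‖(π_k)_ℂ(A)‖ ≤ β` for all `k`, the coefficients of `p` are polynomials of degree
`τ_S(p)` in coefficients of the `π_k`, so they are bounded by a constant times `β ^ τ_S(p)`. The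
constant disappears on passing to the powers `2 ^ m`, because `p_ℂ` is self-adjoint on the positive
diagonal part of `A` (`norm_extension_le`). Thus `f ↦ ∑ d_p Tr(p_ℂ(A⁻¹) f̂(p))` is dominated term by
term by the norm of `f`.

The algebra property rests on reading `τ_S` off from functions: `p` occurs in a product of `k`
elements of `S` exactly when its coefficients lie in the `k`-th power of the span of the
coefficients of `S`. This makes `τ_S` subadditive and the weight submultiplicative. Since `f̂(π) = ∫
f π` contains no inverse, the Fourier series of `f` is made of the conjugated coefficients
`antiCoeff`. -/

/-- A strongly continuous isometric representation. -/
def IsContUnitary {G H : Type*} [Group G] [TopologicalSpace G] [NormedAddCommGroup H]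
    [InnerProductSpace ℂ H] (π : Representation ℂ G H) : Prop :=
  (∀ g v, ‖π g v‖ = ‖v‖) ∧ ∀ v, Continuous fun g => π g v

/-! ### Schur's lemma and unitary equivalence. -/

section Basic

variable {G : Type*} [Group G] [TopologicalSpace G]
variable {H : Type*} [NormedAddCommGroup H] [InnerProductSpace ℂ H]
variable {π : Representation ℂ G H}

theorem IsContUnitary.inner_map (h : IsContUnitary π) (g : G) (x y : H) :
    inner ℂ (π g x) (π g y) = inner ℂ x y :=
  LinearIsometry.inner_map_map (⟨π g, h.1 g⟩ : H →ₗᵢ[ℂ] H) x y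

theorem rep_apply_inv_apply (π : Representation ℂ G H) (g : G) (x : H) : π g (π g⁻¹ x) = x := by
  rw [← Module.End.mul_apply, ← map_mul, mul_inv_cancel, map_one, Module.End.one_apply]

theorem IsContUnitary.inner_inv (h : IsContUnitary π) (g : G) (x y : H) :
    inner ℂ (π g⁻¹ x) y = inner ℂ x (π g y) := by
  rw [← h.inner_map g, rep_apply_inv_apply]

theorem UnitaryIrrep.isContUnitary {G : Type} [Group G] [TopologicalSpace G] (p : UnitaryIrrep G) :
    IsContUnitary p.rep :=
  ⟨p.norm_map, fun v => p.continuous.clm_apply (continuous_const (y := v))⟩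

/-- The function `g ↦ ⟨y, π(g) x⟩`-conjugate, i.e. `g ↦ inner (π g x) y`. -/
def antiCoeff (h : IsContUnitary π) (x y : H) : C(G, ℂ) :=
  ⟨fun g => inner ℂ (π g x) y, (h.2 x).inner continuous_const⟩

@[simp] theorem antiCoeff_apply (h : IsContUnitary π) (x y : H) (g : G) :
    antiCoeff h x y g = inner ℂ (π g x) y := rfl

/-- The coefficient function `g ↦ inner y (π g x)`. -/
def coeffFun (h : IsContUnitary π) (x y : H) : C(G, ℂ) :=
  ⟨fun g => inner ℂ y (π g x), continuous_const.inner (h.2 x)⟩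

@[simp] theorem coeffFun_apply (h : IsContUnitary π) (x y : H) (g : G) :
    coeffFun h x y g = inner ℂ y (π g x) := rfl

theorem irreducible_eq_top {V : Type*} [AddCommGroup V] [Module ℂ V] {π : Representation ℂ G V}
    (hπ : π.IsIrreducible) (K : Submodule ℂ V) (hK : ∀ g, ∀ v ∈ K, π g v ∈ K) (h0 : K ≠ ⊥) :
    K = ⊤ := by
  have := hπ.eq_bot_or_eq_top ⟨K, fun g v hv => hK g v hv⟩
  rcases this with h | h
  · exact absurd (congrArg Subrepresentation.toSubmodule h) h0
  · exact congrArg Subrepresentation.toSubmodule h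

theorem irreducible_nontrivial {V : Type*} [AddCommGroup V] [Module ℂ V] {π : Representation ℂ G V}
    (hπ : π.IsIrreducible) : Nontrivial V := by
  by_contra h
  rw [not_nontrivial_iff_subsingleton] at h
  obtain ⟨a, b, hab⟩ := hπ.toNontrivial
  exact hab (Subrepresentation.toSubmodule_injective (Subsingleton.elim _ _))

theorem irreducible_iff {V : Type*} [AddCommGroup V] [Module ℂ V] {π : Representation ℂ G V} :
    π.IsIrreducible ↔ Nontrivial V ∧
      ∀ K : Submodule ℂ V, (∀ g, ∀ v ∈ K, π g v ∈ K) → K = ⊥ ∨ K = ⊤ := by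
  refine ⟨fun h => ⟨irreducible_nontrivial h, fun K hK => ?_⟩, fun ⟨h0, h⟩ => ?_⟩
  · exact or_iff_not_imp_left.2 fun h1 => irreducible_eq_top h K hK h1
  · refine { exists_pair_ne := ⟨⊥, ⊤, fun h => ?_⟩, eq_bot_or_eq_top := fun K => ?_ }
    · exact bot_ne_top (α := Submodule ℂ V) (congrArg Subrepresentation.toSubmodule h)
    · exact (h K.toSubmodule fun g v hv => K.apply_mem_toSubmodule g hv).imp
        (fun h => Subrepresentation.toSubmodule_injective h)
        (fun h => Subrepresentation.toSubmodule_injective h)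

/-- Schur's lemma: an endomorphism commuting with an irreducible representation is scalar. -/
theorem exists_eq_smul_of_commute [FiniteDimensional ℂ H] (hπ : π.IsIrreducible) (T : H →ₗ[ℂ] H)
    (hT : ∀ g z, T (π g z) = π g (T z)) : ∃ c : ℂ, ∀ z, T z = c • z := by
  have := irreducible_nontrivial hπ
  obtain ⟨c, hc⟩ := Module.End.exists_eigenvalue T
  refine ⟨c, fun z => ?_⟩
  have h : Module.End.eigenspace T c = ⊤ := by
    refine irreducible_eq_top hπ _ (fun g v hv => ?_) hc
    rw [Module.End.mem_eigenspace_iff] at hv ⊢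
    rw [hT, hv, map_smul]
  exact Module.End.mem_eigenspace_iff.1 (h ▸ Submodule.mem_top)

theorem intertwiner_injective {V W : Type*} [AddCommGroup V] [Module ℂ V] [AddCommGroup W]
    [Module ℂ W] {π : Representation ℂ G V} (hπ : π.IsIrreducible) {σ : Representation ℂ G W}
    (T : V →ₗ[ℂ] W) (hT : ∀ g z, T (π g z) = σ g (T z)) (h0 : T ≠ 0) : Function.Injective T := by
  rw [← LinearMap.ker_eq_bot]
  by_contra h
  have h1 := irreducible_eq_top hπ (LinearMap.ker T) (fun g v hv => by
    rw [LinearMap.mem_ker] at hv ⊢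
    rw [hT, hv, map_zero]) h
  exact h0 (LinearMap.ker_eq_top.1 h1)

/-- `T* T` commutes with `π`, so it is a scalar by Schur's lemma; the scalar is positive because `T`
is injective, and dividing `T` by its square root gives an isometry, onto because the range is
invariant. -/
theorem unitarilyEquivalent_of_intertwiner [FiniteDimensional ℂ H] {K : Type*}
    [NormedAddCommGroup K] [InnerProductSpace ℂ K] [FiniteDimensional ℂ K]
    {σ : Representation ℂ G K} (hπ : IsContUnitary π) (hσ : IsContUnitary σ)
    (hπi : π.IsIrreducible) (hσi : σ.IsIrreducible) (T : H →ₗ[ℂ] K)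
    (hT : ∀ g z, T (π g z) = σ g (T z)) (h0 : T ≠ 0) : UnitarilyEquivalent π σ := by
  have hinj := intertwiner_injective hπi T hT h0
  have hsurj : Function.Surjective T := by
    rw [← LinearMap.range_eq_top]
    refine irreducible_eq_top hσi _ ?_ (fun h => h0 (LinearMap.range_eq_bot.1 h))
    rintro g _ ⟨z, rfl⟩
    exact ⟨π g z, hT g z⟩
  obtain ⟨c, hc⟩ := exists_eq_smul_of_commute hπi (T.adjoint ∘ₗ T) (fun g z => by
    refine ext_inner_left ℂ fun w => ?_
    simp only [LinearMap.comp_apply, LinearMap.adjoint_inner_right, hT]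
    rw [← hπ.inner_inv, LinearMap.adjoint_inner_right, hT, hσ.inner_inv])
  have key : ∀ x y, inner ℂ (T x) (T y) = c * inner ℂ x y := by
    intro x y
    rw [← LinearMap.adjoint_inner_right, ← LinearMap.comp_apply, hc, inner_smul_right]
  have := irreducible_nontrivial hπi
  -- A unit vector identifies the scalar as `‖T e‖ ^ 2`.
  obtain ⟨e, he⟩ := exists_norm_eq H (zero_le_one' ℝ)
  have hce : c = (‖T e‖ ^ 2 : ℝ) := by
    have := key e e
    rw [inner_self_eq_norm_sq_to_K, inner_self_eq_norm_sq_to_K, he] at this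
    simpa using this.symm
  set r : ℝ := ‖T e‖ with hr
  have hr0 : r ≠ 0 := by
    rw [hr, norm_ne_zero_iff]
    intro h
    rw [← map_zero T] at h
    rw [hinj h, norm_zero] at he
    exact zero_ne_one he
  have hn : ∀ x, ‖T x‖ = r * ‖x‖ := by
    intro x
    have h1 := key x x
    rw [inner_self_eq_norm_sq_to_K, inner_self_eq_norm_sq_to_K, hce] at h1
    have h2 : ‖T x‖ ^ 2 = (r * ‖x‖) ^ 2 := by
      have h3 := congrArg Complex.re h1
      rw [mul_pow]
      simpa [← Complex.ofReal_pow, ← Complex.ofReal_mul] using h3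
    exact (pow_left_inj₀ (norm_nonneg _) (by positivity) two_ne_zero).1 h2
  let U : H →ₗᵢ[ℂ] K := ⟨((r : ℂ)⁻¹) • T, fun x => by
    rw [LinearMap.smul_apply, norm_smul, hn, norm_inv, Complex.norm_real,
      Real.norm_of_nonneg (norm_nonneg _), inv_mul_cancel_left₀ hr0]⟩
  refine ⟨LinearIsometryEquiv.ofSurjective U fun y => ?_, fun g v => ?_⟩
  · obtain ⟨x, hx⟩ := hsurj ((r : ℂ) • y)
    refine ⟨x, ?_⟩
    change (r : ℂ)⁻¹ • T x = y
    rw [hx, inv_smul_smul₀ (by exact_mod_cast hr0)]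
  · change (r : ℂ)⁻¹ • T (π g v) = σ g ((r : ℂ)⁻¹ • T v)
    rw [hT, map_smul]

theorem UnitarilyEquivalent.symm {K : Type*}
    [NormedAddCommGroup K] [InnerProductSpace ℂ K] {σ : Representation ℂ G K}
    (h : UnitarilyEquivalent π σ) : UnitarilyEquivalent σ π := by
  obtain ⟨U, hU⟩ := h
  refine ⟨U.symm, fun g v => ?_⟩
  rw [LinearIsometryEquiv.symm_apply_eq, hU, LinearIsometryEquiv.apply_symm_apply]

theorem UnitarilyEquivalent.trans {K L : Type*}
    [NormedAddCommGroup K] [InnerProductSpace ℂ K] {σ : Representation ℂ G K}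
    [NormedAddCommGroup L] [InnerProductSpace ℂ L] {τ : Representation ℂ G L}
    (h : UnitarilyEquivalent π σ) (h' : UnitarilyEquivalent σ τ) : UnitarilyEquivalent π τ := by
  obtain ⟨U, hU⟩ := h
  obtain ⟨W, hW⟩ := h'
  exact ⟨U.trans W, fun g v => by simp [LinearIsometryEquiv.trans_apply, hU, hW]⟩

end Basic

/-- Every finite-dimensional irreducible unitary representation is equivalent to the chosen
representative of a class in the unitary dual. -/
theorem exists_unitaryDual_equiv {G : Type} [Group G] [TopologicalSpace G] {H : Type*}
    [NormedAddCommGroup H] [InnerProductSpace ℂ H] [FiniteDimensional ℂ H]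
    {π : Representation ℂ G H} (h : IsContUnitary π) (hi : π.IsIrreducible) :
    ∃ p : UnitaryDual G, UnitarilyEquivalent p.irrep.rep π := by
  let U := (stdOrthonormalBasis ℂ H).repr
  let ρ : Representation ℂ G (EuclideanSpace ℂ (Fin (Module.finrank ℂ H))) :=
    { toFun := fun g => U.toLinearEquiv.toLinearMap ∘ₗ π g ∘ₗ U.symm.toLinearEquiv.toLinearMap
      map_one' := by ext v; simp
      map_mul' := fun a b => by ext v; simp }
  have hρ : ∀ g v, ρ g v = U (π g (U.symm v)) := fun g v => rfl
  let P : UnitaryIrrep G :=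
    { dim := Module.finrank ℂ H
      rep := ρ
      norm_map := fun g v => by rw [hρ, U.norm_map, h.1, U.symm.norm_map]
      continuous := by
        rw [continuous_clm_apply]
        intro v
        exact U.continuous.comp (h.2 (U.symm v))
      irreducible := by
        rw [irreducible_iff] at hi ⊢
        have := hi.1
        refine ⟨U.symm.toEquiv.nontrivial, fun K hK => ?_⟩
        have h1 := hi.2 (K.comap U.toLinearEquiv.toLinearMap) (fun g v hv => by
          have := hK g _ hv
          rw [hρ] at this
          simpa using this)
        refine h1.imp (fun h => ?_) (fun h => ?_)
        · rw [eq_bot_iff] at h ⊢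
          intro v hv
          have := h (show U.symm v ∈ _ by simpa using hv)
          simpa using this
        · rw [eq_top_iff] at h ⊢
          intro v _
          have := h (show U.symm v ∈ _ from trivial)
          simpa using this }
  refine ⟨Quotient.mk _ P, ?_⟩
  have h1 : UnitarilyEquivalent (UnitaryDual.irrep (Quotient.mk _ P)).rep P.rep :=
    Quotient.exact (Quotient.out_eq (Quotient.mk (unitaryIrrepSetoid G) P))
  refine h1.trans ⟨U.symm, fun g v => ?_⟩
  change U.symm (U (π g (U.symm v))) = _
  rw [U.symm_apply_apply]

theorem UnitaryDual.eq_of_equiv {G : Type} [Group G] [TopologicalSpace G] {p q : UnitaryDual G}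
    (h : UnitarilyEquivalent p.irrep.rep q.irrep.rep) : p = q := by
  rw [← Quotient.out_eq p, ← Quotient.out_eq q]
  exact Quotient.sound h

variable {G : Type} [Group G] [TopologicalSpace G] [IsTopologicalGroup G] [CompactSpace G]
  [MeasurableSpace G] [BorelSpace G]

/-- The normalized Haar measure. -/
abbrev haarProb (G : Type) [Group G] [TopologicalSpace G] [IsTopologicalGroup G] [CompactSpace G]
    [MeasurableSpace G] [BorelSpace G] : Measure G := Measure.haarMeasure ⊤

instance : IsProbabilityMeasure (haarProb G) :=
  ⟨Measure.haarMeasure_self (K₀ := (⊤ : TopologicalSpace.PositiveCompacts G))⟩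

theorem integrable_of_continuous {E : Type*} [NormedAddCommGroup E] {f : G → E}
    (hf : Continuous f) : Integrable f (haarProb G) :=
  hf.integrable_of_hasCompactSupport (HasCompactSupport.of_compactSpace _)

/-- `T` is the average over `g` of `σ g ∘ (z ↦ ⟨x, z⟩ a) ∘ π g⁻¹`. The space `V` carries no norm,
and everything is phrased through linear functionals, so that the result also applies to algebraic
tensor products, where containment of representations is tested. -/
theorem exists_intertwiner {V H : Type*} [AddCommGroup V] [Module ℂ V] [FiniteDimensional ℂ V]
    [NormedAddCommGroup H] [InnerProductSpace ℂ H] {σ : Representation ℂ G V}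
    (hσ : ∀ (l : Module.Dual ℂ V) (a : V), Continuous fun g => l (σ g a))
    {π : Representation ℂ G H} (hπ : IsContUnitary π) (a : V) (x : H) :
    ∃ T : H →ₗ[ℂ] V, (∀ g z, T (π g z) = σ g (T z)) ∧ ∀ (l : Module.Dual ℂ V) (z : H),
      l (T z) = ∫ g, l (σ g a) * inner ℂ (π g x) z ∂(haarProb G) := by
  set b := Module.finBasis ℂ V
  have hc : ∀ (l : Module.Dual ℂ V) (z : H),
      Continuous fun g => l (σ g a) * inner ℂ (π g x) z := fun l z =>
    (hσ l a).mul ((hπ.2 x).inner continuous_const)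
  have hI := fun l z => integrable_of_continuous (hc l z)
  let T : H →ₗ[ℂ] V :=
    { toFun := fun z => ∑ i, (∫ g, b.coord i (σ g a) * inner ℂ (π g x) z ∂(haarProb G)) • b i
      map_add' := fun z w => by
        simp only [inner_add_right, mul_add, integral_add (hI _ _) (hI _ _), add_smul,
          Finset.sum_add_distrib]
      map_smul' := fun c z => by
        simp only [inner_smul_right, RingHom.id_apply, Finset.smul_sum, smul_smul]
        refine Finset.sum_congr rfl fun i _ => ?_
        rw [← integral_const_mul]
        congr 2
        funext g
        ring }
  have hl : ∀ (l : Module.Dual ℂ V) (z : H),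
      l (T z) = ∫ g, l (σ g a) * inner ℂ (π g x) z ∂(haarProb G) := by
    intro l z
    change l (∑ i, (∫ g, b.coord i (σ g a) * inner ℂ (π g x) z ∂(haarProb G)) • b i) = _
    rw [map_sum]
    simp only [map_smul, smul_eq_mul]
    simp_rw [← integral_mul_const]
    rw [← integral_finsetSum _ fun i _ => (hI _ _).mul_const _]
    refine integral_congr_ae (Filter.Eventually.of_forall fun g => ?_)
    have h1 : l (σ g a) = ∑ i, b.coord i (σ g a) * l (b i) := by
      conv_lhs => rw [← b.sum_repr (σ g a), map_sum]
      exact Finset.sum_congr rfl fun i _ => by rw [map_smul, smul_eq_mul, Module.Basis.coord_apply]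
    beta_reduce
    rw [h1, Finset.sum_mul]
    exact Finset.sum_congr rfl fun i _ => by ring
  refine ⟨T, fun h z => ?_, hl⟩
  refine b.ext_elem fun i => ?_
  change b.coord i (T (π h z)) = (b.coord i ∘ₗ σ h) (T z)
  -- Left invariance of Haar measure: replacing `g` by `h * g` moves `h` out of both factors.
  rw [hl, hl, ← integral_mul_left_eq_self _ h]
  refine integral_congr_ae (Filter.Eventually.of_forall fun g => ?_)
  simp only [map_mul, Module.End.mul_apply, LinearMap.comp_apply, hπ.inner_map]

/-! ### Orthogonality relations for matrix coefficients. -/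

section Orthogonality

variable {H K : Type*} [NormedAddCommGroup H] [InnerProductSpace ℂ H] [FiniteDimensional ℂ H]
  [NormedAddCommGroup K] [InnerProductSpace ℂ K] [FiniteDimensional ℂ K]
  {π : Representation ℂ G H} {σ : Representation ℂ G K}

theorem IsContUnitary.continuous_dual (hσ : IsContUnitary σ) (l : Module.Dual ℂ K) (a : K) :
    Continuous fun g => l (σ g a) :=
  (LinearMap.continuous_of_finiteDimensional l).comp (hσ.2 a)

theorem schur_orthogonality_ne (hπ : IsContUnitary π) (hσ : IsContUnitary σ)
    (hπi : π.IsIrreducible) (hσi : σ.IsIrreducible) (hne : ¬ UnitarilyEquivalent π σ)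
    (a b : K) (x y : H) :
    ∫ g, inner ℂ b (σ g a) * inner ℂ (π g x) y ∂(haarProb G) = 0 := by
  obtain ⟨T, hT, hl⟩ := exists_intertwiner hσ.continuous_dual hπ a x
  have h0 : T = 0 := by
    by_contra h
    exact hne (unitarilyEquivalent_of_intertwiner hπ hσ hπi hσi T hT h)
  have := hl (innerₛₗ ℂ b) y
  simpa [h0] using this.symm

/-- The averaged operator is a scalar `c` by Schur's lemma. Averaging preserves the trace of `z ↦
⟨x, z⟩ a`, so `dim H * c = ⟨x, a⟩`. -/
theorem schur_orthogonality_self (hπ : IsContUnitary π) (hπi : π.IsIrreducible) (a b x y : H) :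
    ∫ g, inner ℂ b (π g a) * inner ℂ (π g x) y ∂(haarProb G)
      = (Module.finrank ℂ H : ℂ)⁻¹ * inner ℂ x a * inner ℂ b y := by
  obtain ⟨T, hT, hl⟩ := exists_intertwiner hπ.continuous_dual hπ a x
  obtain ⟨c, hc⟩ := exists_eq_smul_of_commute hπi T hT
  have := irreducible_nontrivial hπi
  have hd : (Module.finrank ℂ H : ℂ) ≠ 0 := by
    exact_mod_cast (Module.finrank_pos (R := ℂ) (M := H)).ne'
  let e := stdOrthonormalBasis ℂ H
  have htr : (Module.finrank ℂ H : ℂ) * c = inner ℂ x a := by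
    have h1 : ∑ i, inner ℂ (e i) (T (e i)) = (Module.finrank ℂ H : ℂ) * c := by
      simp [hc, e.orthonormal.1]
    rw [← h1]
    have h2 : ∀ i, inner ℂ (e i) (T (e i))
        = ∫ g, inner ℂ (e i) (π g a) * inner ℂ (π g x) (e i) ∂(haarProb G) := fun i =>
      hl (innerₛₗ ℂ (e i)) (e i)
    rw [Finset.sum_congr rfl fun i _ => h2 i, ← integral_finsetSum]
    · have h3 : ∀ g, ∑ i, inner ℂ (e i) (π g a) * inner ℂ (π g x) (e i) = inner ℂ x a := by
        intro g
        rw [← hπ.inner_map g x a, ← e.sum_inner_mul_inner (π g x) (π g a)]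
        exact Finset.sum_congr rfl fun i _ => mul_comm _ _
      simp [h3]
    · intro i _
      exact integrable_of_continuous ((continuous_const.inner (hπ.2 a)).mul
        ((hπ.2 x).inner continuous_const))
  have := hl (innerₛₗ ℂ b) y
  rw [hc] at this
  simp only [map_smul, innerₛₗ_apply_apply, smul_eq_mul] at this
  rw [← this, ← htr, inv_mul_cancel_left₀ hd]

end Orthogonality

theorem inner_fourierCoeff (f : C(G, ℂ)) (q : UnitaryIrrep G) (a b : EuclideanSpace ℂ (Fin q.dim)) :
    inner ℂ b (fourierCoeff f q a) = ∫ g, inner ℂ b (q.rep g a) * f g ∂(haarProb G) := by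
  rw [fourierCoeff, ContinuousLinearMap.integral_apply (integrable_fourier f q), ← integral_inner]
  · refine integral_congr_ae (Filter.Eventually.of_forall fun g => ?_)
    simp [inner_smul_right, mul_comm]
  · exact (integrable_fourier f q).apply_continuousLinearMap a

/-- With the convention `f̂(π) = ∫ f π`, the functions whose Fourier transform lives at `p` alone
are the conjugated coefficients of `p`. -/
theorem fourierCoeff_antiCoeff_ne {p q : UnitaryDual G} (h : p ≠ q)
    (x y : EuclideanSpace ℂ (Fin p.irrep.dim)) :
    fourierCoeff (antiCoeff p.irrep.isContUnitary x y) q.irrep = 0 := by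
  refine ContinuousLinearMap.ext fun a => ext_inner_left ℂ fun b => ?_
  rw [inner_fourierCoeff]
  simpa using schur_orthogonality_ne p.irrep.isContUnitary q.irrep.isContUnitary
    p.irrep.irreducible q.irrep.irreducible (fun h' => h (UnitaryDual.eq_of_equiv h')) a b x y

theorem fourierCoeff_antiCoeff_self (p : UnitaryDual G)
    (x y a : EuclideanSpace ℂ (Fin p.irrep.dim)) :
    fourierCoeff (antiCoeff p.irrep.isContUnitary x y) p.irrep a
      = ((p.irrep.dim : ℂ)⁻¹ * inner ℂ x a) • y := by
  refine ext_inner_left ℂ fun b => ?_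
  rw [inner_fourierCoeff, inner_smul_right]
  simpa using schur_orthogonality_self p.irrep.isContUnitary p.irrep.irreducible a b x y

end Schur

end BeurlingFourier

end

noncomputable section

set_option linter.unusedSectionVars false

open MeasureTheory Matrix
open scoped TensorProduct

namespace BeurlingFourier

/-! ### Decomposition of unitary representations into irreducible ones -/

section Decomposition

variable {G : Type} [Group G] [TopologicalSpace G]

/-- Induction on the dimension: an invariant subspace and its orthogonal complement are both
invariant, and `π` splits along them. The sum is encoded by equivariant surjections `W j` that
jointly preserve inner products, which avoids forming a direct sum of Hilbert spaces. -/
theorem exists_decomposition_aux (d : ℕ) : ∀ {H : Type} [NormedAddCommGroup H]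
    [InnerProductSpace ℂ H] [FiniteDimensional ℂ H] {π : Representation ℂ G H},
    IsContUnitary π → Module.finrank ℂ H = d →
    ∃ (J : Type) (_ : Fintype J) (p : J → UnitaryDual G)
      (W : ∀ j, H →ₗ[ℂ] EuclideanSpace ℂ (Fin (p j).irrep.dim)),
      (∀ j g x, W j (π g x) = (p j).irrep.rep g (W j x)) ∧ (∀ j, Function.Surjective (W j)) ∧
      ∀ x y, inner ℂ x y = ∑ j, inner ℂ (W j x) (W j y) := by
  induction d using Nat.strong_induction_on with
  | _ d ih =>
  intro H _ _ _ π hπ hd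
  by_cases hirr : π.IsIrreducible
  · obtain ⟨p, hp⟩ := exists_unitaryDual_equiv hπ hirr
    obtain ⟨U, hU⟩ := hp.symm
    refine ⟨Unit, inferInstance, fun _ => p, fun _ => U.toLinearEquiv.toLinearMap,
      fun _ g x => hU g x, fun _ => U.surjective, fun x y => ?_⟩
    rw [Fintype.sum_unique]
    exact (U.inner_map_map x y).symm
  rw [irreducible_iff, not_and_or] at hirr
  rcases hirr with hirr | hirr
  · rw [not_nontrivial_iff_subsingleton] at hirr
    refine ⟨Empty, inferInstance, fun j => j.elim, fun j => j.elim, fun j => j.elim,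
      fun j => j.elim, fun x y => ?_⟩
    rw [Subsingleton.elim x 0]
    simp
  push Not at hirr
  obtain ⟨K, hK, hK0, hK1⟩ := hirr
  have hKo : ∀ g, ∀ v ∈ Kᗮ, π g v ∈ Kᗮ := by
    intro g v hv u hu
    rw [← hπ.inner_inv]
    exact hv _ (hK _ u hu)
  have key : ∀ L : Submodule ℂ H, (∀ g, ∀ v ∈ L, π g v ∈ L) → (∀ g, ∀ v ∈ Lᗮ, π g v ∈ Lᗮ) →
      L ≠ ⊤ → ∃ (J : Type) (_ : Fintype J) (p : J → UnitaryDual G)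
      (W : ∀ j, H →ₗ[ℂ] EuclideanSpace ℂ (Fin (p j).irrep.dim)),
      (∀ j g x, W j (π g x) = (p j).irrep.rep g (W j x)) ∧ (∀ j, Function.Surjective (W j)) ∧
      ∀ x y, inner ℂ (L.orthogonalProjectionOnto x) (L.orthogonalProjectionOnto y)
        = ∑ j, inner ℂ (W j x) (W j y) := by
    intro L hL hLo hLt
    let ρ : Subrepresentation π := ⟨L, fun g v hv => hL g v hv⟩
    have hρ : IsContUnitary (H := L) ρ.toRepresentation :=
      ⟨fun g v => hπ.1 g v, fun v => Continuous.subtype_mk (hπ.2 v) _⟩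
    obtain ⟨J, hJ, p, W, h1, h2, h3⟩ := ih (Module.finrank ℂ L)
      (hd ▸ Submodule.finrank_lt hLt) hρ rfl
    have hcomm : ∀ g x, L.orthogonalProjectionOnto (π g x)
        = ρ.toRepresentation g (L.orthogonalProjectionOnto x) := by
      intro g x
      refine Subtype.ext (Submodule.eq_starProjection_of_mem_of_inner_eq_zero
        (hL g _ (L.orthogonalProjectionOnto x).2) fun w hw => ?_)
      change inner ℂ (π g x - π g (L.orthogonalProjectionOnto x)) w = 0
      rw [← map_sub]
      refine Submodule.inner_left_of_mem_orthogonal hw (hLo g _ ?_)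
      exact Submodule.sub_starProjection_mem_orthogonal x
    refine ⟨J, hJ, p, fun j => W j ∘ₗ L.orthogonalProjectionOnto.toLinearMap, fun j g x => ?_,
      fun j => ?_, fun x y => h3 _ _⟩
    · simp only [LinearMap.comp_apply, ContinuousLinearMap.coe_coe, hcomm, h1]
    · refine (h2 j).comp fun v => ⟨v, ?_⟩
      exact Submodule.orthogonalProjectionOnto_mem_subspace_eq_self v
  obtain ⟨J, _, p, W, h1, h2, h3⟩ := key K hK hKo hK1
  obtain ⟨J', _, p', W', h1', h2', h3'⟩ := key Kᗮ hKo (by rwa [Submodule.orthogonal_orthogonal])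
    (fun h => hK0 ((Submodule.orthogonal_eq_top_iff _).1 h))
  refine ⟨J ⊕ J', inferInstance, Sum.elim p p', fun j => Sum.rec W W' j, ?_, ?_, ?_⟩
  · rintro (j | j)
    exacts [h1 j, h1' j]
  · rintro (j | j)
    exacts [h2 j, h2' j]
  · intro x y
    refine Eq.symm ((Fintype.sum_sum_type _).trans
      (Eq.trans (congrArg₂ (· + ·) (h3 x y) (h3' x y)).symm (Eq.symm ?_)))
    rw [Submodule.coe_inner, Submodule.coe_inner]
    conv_lhs => rw [← K.starProjection_add_starProjection_orthogonal x,
      ← K.starProjection_add_starProjection_orthogonal y]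
    have e1 : inner ℂ (K.starProjection x) (Kᗮ.starProjection y) = 0 :=
      Submodule.inner_right_of_mem_orthogonal (Submodule.starProjection_apply_mem _ _)
        (Submodule.starProjection_apply_mem _ _)
    have e2 : inner ℂ (Kᗮ.starProjection x) (K.starProjection y) = 0 :=
      Submodule.inner_left_of_mem_orthogonal (Submodule.starProjection_apply_mem _ _)
        (Submodule.starProjection_apply_mem _ _)
    simp only [inner_add_left, inner_add_right, e1, e2, add_zero, zero_add]
    rfl

/-- A finite-dimensional unitary representation is an orthogonal sum of irreducible ones. -/
theorem exists_decomposition {H : Type} [NormedAddCommGroup H]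
    [InnerProductSpace ℂ H] [FiniteDimensional ℂ H] {π : Representation ℂ G H}
    (hπ : IsContUnitary π) :
    ∃ (J : Type) (_ : Fintype J) (p : J → UnitaryDual G)
      (W : ∀ j, H →ₗ[ℂ] EuclideanSpace ℂ (Fin (p j).irrep.dim)),
      (∀ j g x, W j (π g x) = (p j).irrep.rep g (W j x)) ∧ (∀ j, Function.Surjective (W j)) ∧
      ∀ x y, inner ℂ x y = ∑ j, inner ℂ (W j x) (W j y) :=
  exists_decomposition_aux _ hπ rfl

/-- Every coefficient of an irreducible quotient of `π` is a coefficient of `π`. -/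
theorem exists_coeffFun_eq {H K : Type*} [NormedAddCommGroup H]
    [InnerProductSpace ℂ H] [FiniteDimensional ℂ H] {π : Representation ℂ G H}
    [NormedAddCommGroup K] [InnerProductSpace ℂ K] [FiniteDimensional ℂ K]
    {σ : Representation ℂ G K}
    (hπ : IsContUnitary π) (hσ : IsContUnitary σ) (W : H →ₗ[ℂ] K)
    (hW : ∀ g x, W (π g x) = σ g (W x)) (hs : Function.Surjective W) (x y : K) :
    ∃ x' y', coeffFun hσ x y = coeffFun hπ x' y' := by
  obtain ⟨x', rfl⟩ := hs x
  refine ⟨x', W.adjoint y, ContinuousMap.ext fun g => ?_⟩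
  rw [coeffFun_apply, coeffFun_apply, LinearMap.adjoint_inner_left, hW]

/-! ### Tensor products and products of coefficients. -/

theorem IsContUnitary.tprod {H K : Type*} [NormedAddCommGroup H]
    [InnerProductSpace ℂ H] [FiniteDimensional ℂ H] {π : Representation ℂ G H}
    [NormedAddCommGroup K] [InnerProductSpace ℂ K] [FiniteDimensional ℂ K]
    {σ : Representation ℂ G K} (hπ : IsContUnitary π) (hσ : IsContUnitary σ) :
    IsContUnitary (π.tprod σ) := by
  refine ⟨fun g v => ?_, fun v => ?_⟩
  · exact TensorProduct.norm_map (⟨π g, hπ.1 g⟩ : H →ₗᵢ[ℂ] H) (⟨σ g, hσ.1 g⟩ : K →ₗᵢ[ℂ] K) v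
  · induction v using TensorProduct.induction_on with
    | zero => simpa using continuous_const
    | tmul x y =>
      simp only [Representation.tprod_apply, TensorProduct.map_tmul]
      exact TensorProduct.continuous_tmul.comp ((hπ.2 x).prodMk (hσ.2 y))
    | add x y hx hy => 
      simp only [map_add]
      exact hx.add hy

variable {H K : Type} [NormedAddCommGroup H]
    [InnerProductSpace ℂ H] [FiniteDimensional ℂ H] {π : Representation ℂ G H}
    [NormedAddCommGroup K] [InnerProductSpace ℂ K] [FiniteDimensional ℂ K]
    {σ : Representation ℂ G K}

theorem coeffFun_mul (hπ : IsContUnitary π) (hσ : IsContUnitary σ) (x y : H) (x' y' : K) :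
    coeffFun hπ x y * coeffFun hσ x' y' = coeffFun (hπ.tprod hσ) (x ⊗ₜ x') (y ⊗ₜ y') := by
  ext g
  simp

theorem antiCoeff_mul (hπ : IsContUnitary π) (hσ : IsContUnitary σ) (x y : H) (x' y' : K) :
    antiCoeff hπ x y * antiCoeff hσ x' y' = antiCoeff (hπ.tprod hσ) (x ⊗ₜ x') (y ⊗ₜ y') := by
  ext g
  simp

theorem coeffFun_tprod_mem (hπ : IsContUnitary π) (hσ : IsContUnitary σ)
    {M N : Submodule ℂ C(G, ℂ)}
    (hM : ∀ x y, coeffFun hπ x y ∈ M) (hN : ∀ x y, coeffFun hσ x y ∈ N) (u v : H ⊗[ℂ] K) :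
    coeffFun (hπ.tprod hσ) u v ∈ M * N := by
  induction u using TensorProduct.induction_on with
  | zero =>
    convert (M * N).zero_mem
    ext g; simp
  | add u u' hu hu' =>
    convert (M * N).add_mem hu hu'
    ext g; simp
  | tmul x x' =>
    induction v using TensorProduct.induction_on with
    | zero =>
      convert (M * N).zero_mem
      ext g; simp
    | add v v' hv hv' =>
      convert (M * N).add_mem hv hv'
      ext g; simp
    | tmul y y' =>
      rw [← coeffFun_mul hπ hσ]
      exact Submodule.mul_mem_mul (hM _ _) (hN _ _)

/-- Decomposition of a conjugated coefficient into conjugated coefficients of irreducible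
representations. -/
theorem exists_antiCoeff_eq_sum (hπ : IsContUnitary π) (x y : H) :
    ∃ (J : Type) (_ : Fintype J) (p : J → UnitaryDual G)
      (u v : ∀ j, EuclideanSpace ℂ (Fin (p j).irrep.dim)),
      antiCoeff hπ x y = ∑ j, antiCoeff (p j).irrep.isContUnitary (u j) (v j) ∧
      ∑ j, ‖u j‖ * ‖v j‖ ≤ ‖x‖ * ‖y‖ ∧
      ∀ j a b, ∃ a' b', coeffFun (p j).irrep.isContUnitary a b = coeffFun hπ a' b' := by
  obtain ⟨J, _, p, W, h1, h2, h3⟩ := exists_decomposition hπ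
  refine ⟨J, inferInstance, p, fun j => W j x, fun j => W j y, ?_, ?_, fun j =>
    exists_coeffFun_eq hπ _ (W j) (h1 j) (h2 j)⟩
  · ext g
    simp [h3, h1]
  -- The `W j` are jointly isometric, so Cauchy–Schwarz bounds the total norm of the summands
  -- without loss.
  · have hn : ∀ z, ∑ j, ‖W j z‖ ^ 2 = ‖z‖ ^ 2 := by
      intro z
      have := congrArg Complex.re (h3 z z)
      simp only [inner_self_eq_norm_sq_to_K] at this
      simpa [← Complex.ofReal_pow] using this.symm
    refine (Real.sum_mul_le_sqrt_mul_sqrt _ _ _).trans ?_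
    rw [hn, hn, Real.sqrt_sq (norm_nonneg _), Real.sqrt_sq (norm_nonneg _)]

theorem exists_coeffFun_eq_sum (hπ : IsContUnitary π) (x y : H) :
    ∃ (J : Type) (_ : Fintype J) (p : J → UnitaryDual G)
      (u v : ∀ j, EuclideanSpace ℂ (Fin (p j).irrep.dim)),
      coeffFun hπ x y = ∑ j, coeffFun (p j).irrep.isContUnitary (u j) (v j) := by
  obtain ⟨J, _, p, W, h1, -, h3⟩ := exists_decomposition hπ
  refine ⟨J, inferInstance, p, fun j => W j x, fun j => W j y, ?_⟩
  ext g
  simp [h3, h1]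

/-- The coordinatewise complex conjugation of `ℂ^d`. -/
def conjVec {ι : Type*} [Fintype ι] (v : EuclideanSpace ℂ ι) : EuclideanSpace ℂ ι :=
  WithLp.toLp 2 fun i => star (v i)

@[simp] theorem conjVec_apply {ι : Type*} [Fintype ι] (v : EuclideanSpace ℂ ι) (i : ι) :
    conjVec v i = star (v i) := rfl

@[simp] theorem conjVec_conjVec {ι : Type*} [Fintype ι] (v : EuclideanSpace ℂ ι) :
    conjVec (conjVec v) = v := by
  ext i; simp

theorem conjVec_add {ι : Type*} [Fintype ι] (v w : EuclideanSpace ℂ ι) :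
    conjVec (v + w) = conjVec v + conjVec w := by
  ext i; simp

theorem conjVec_smul {ι : Type*} [Fintype ι] (c : ℂ) (v : EuclideanSpace ℂ ι) :
    conjVec (c • v) = star c • conjVec v := by
  ext i; simp

@[simp] theorem norm_conjVec {ι : Type*} [Fintype ι] (v : EuclideanSpace ℂ ι) :
    ‖conjVec v‖ = ‖v‖ := by
  simp [EuclideanSpace.norm_eq]

theorem inner_conjVec {ι : Type*} [Fintype ι] (v w : EuclideanSpace ℂ ι) :
    inner ℂ (conjVec v) w = inner ℂ (conjVec w) v := by
  simp [PiLp.inner_apply, mul_comm]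

/-- The complex conjugate of a representation on `ℂ^d`. -/
def conjRep {ι : Type*} [Fintype ι] (ρ : Representation ℂ G (EuclideanSpace ℂ ι)) :
    Representation ℂ G (EuclideanSpace ℂ ι) where
  toFun g :=
    { toFun := fun v => conjVec (ρ g (conjVec v))
      map_add' := fun v w => by rw [conjVec_add, map_add, conjVec_add]
      map_smul' := fun c v => by rw [conjVec_smul, map_smul, conjVec_smul]; simp }
  map_one' := by ext v; simp
  map_mul' a b := by ext v; simp

theorem conjRep_apply {ι : Type*} [Fintype ι] (ρ : Representation ℂ G (EuclideanSpace ℂ ι)) (g : G)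
    (v : EuclideanSpace ℂ ι) : conjRep ρ g v = conjVec (ρ g (conjVec v)) := rfl

theorem IsContUnitary.conj {ι : Type*} [Fintype ι] {ρ : Representation ℂ G (EuclideanSpace ℂ ι)}
    (h : IsContUnitary ρ) : IsContUnitary (conjRep ρ) := by
  refine ⟨fun g v => ?_, fun v => ?_⟩
  · rw [conjRep_apply, norm_conjVec, h.1, norm_conjVec]
  · have h1 : Continuous (conjVec : EuclideanSpace ℂ ι → EuclideanSpace ℂ ι) := by
      unfold conjVec
      fun_prop
    exact h1.comp (h.2 (conjVec v))

/-- Lengths are expressed through plain coefficients, Fourier series through conjugated ones.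
Passing to the conjugate representation exchanges the two, so both kinds span the same space. -/
theorem coeffFun_eq_antiCoeff_conj {ι : Type*} [Fintype ι]
    {ρ : Representation ℂ G (EuclideanSpace ℂ ι)}
    (h : IsContUnitary ρ) (x y : EuclideanSpace ℂ ι) :
    coeffFun h x y = antiCoeff h.conj (conjVec x) (conjVec y) := by
  ext g
  rw [coeffFun_apply, antiCoeff_apply, conjRep_apply, conjVec_conjVec, inner_conjVec,
    conjVec_conjVec]

theorem antiCoeff_eq_coeffFun_conj {ι : Type*} [Fintype ι]
    {ρ : Representation ℂ G (EuclideanSpace ℂ ι)}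
    (h : IsContUnitary ρ) (x y : EuclideanSpace ℂ ι) :
    antiCoeff h x y = coeffFun h.conj (conjVec x) (conjVec y) := by
  ext g
  rw [coeffFun_apply, antiCoeff_apply, conjRep_apply, conjVec_conjVec, inner_conjVec,
    conjVec_conjVec]

/-! ### The algebra of trigonometric polynomials. -/

variable (G) in
/-- The trigonometric polynomials: linear combinations of coefficients of irreducible unitary
representations. -/
def trigPoly : Submodule ℂ C(G, ℂ) :=
  Submodule.span ℂ {f | ∃ (p : UnitaryDual G) (x y : EuclideanSpace ℂ (Fin p.irrep.dim)),
    f = antiCoeff p.irrep.isContUnitary x y}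

theorem antiCoeff_irrep_mem (p : UnitaryDual G) (x y : EuclideanSpace ℂ (Fin p.irrep.dim)) :
    antiCoeff p.irrep.isContUnitary x y ∈ trigPoly G :=
  Submodule.subset_span ⟨p, x, y, rfl⟩

theorem antiCoeff_mem_trigPoly (hπ : IsContUnitary π) (x y : H) :
    antiCoeff hπ x y ∈ trigPoly G := by
  obtain ⟨J, _, p, u, v, h, -⟩ := exists_antiCoeff_eq_sum hπ x y
  rw [h]
  exact Submodule.sum_mem _ fun j _ => antiCoeff_irrep_mem _ _ _

theorem coeffFun_mem_trigPoly (hπ : IsContUnitary π) (x y : H) :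
    coeffFun hπ x y ∈ trigPoly G := by
  obtain ⟨J, _, p, u, v, h⟩ := exists_coeffFun_eq_sum hπ x y
  rw [h]
  refine Submodule.sum_mem _ fun j _ => ?_
  rw [coeffFun_eq_antiCoeff_conj]
  exact antiCoeff_mem_trigPoly _ _ _

theorem trigPoly_eq_span_coeffFun :
    trigPoly G = Submodule.span ℂ {f | ∃ (p : UnitaryDual G)
      (x y : EuclideanSpace ℂ (Fin p.irrep.dim)), f = coeffFun p.irrep.isContUnitary x y} := by
  refine le_antisymm (Submodule.span_le.2 ?_) (Submodule.span_le.2 ?_)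
  · rintro _ ⟨p, x, y, rfl⟩
    rw [antiCoeff_eq_coeffFun_conj]
    obtain ⟨J, _, p, u, v, h⟩ :=
      exists_coeffFun_eq_sum p.irrep.isContUnitary.conj (conjVec x) (conjVec y)
    rw [h]
    exact Submodule.sum_mem _ fun j _ => Submodule.subset_span ⟨_, _, _, rfl⟩
  · rintro _ ⟨p, x, y, rfl⟩
    exact coeffFun_mem_trigPoly _ _ _

theorem trigPoly_mul_mem {f g : C(G, ℂ)} (hf : f ∈ trigPoly G) (hg : g ∈ trigPoly G) :
    f * g ∈ trigPoly G := by
  have h : trigPoly G * trigPoly G ≤ trigPoly G := by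
    conv_lhs => rw [trigPoly, Submodule.span_mul_span]
    rw [Submodule.span_le]
    rintro _ ⟨_, ⟨p, x, y, rfl⟩, _, ⟨q, x', y', rfl⟩, rfl⟩
    change antiCoeff _ _ _ * antiCoeff _ _ _ ∈ trigPoly G
    rw [antiCoeff_mul]
    exact antiCoeff_mem_trigPoly _ _ _
  exact h (Submodule.mul_mem_mul hf hg)

theorem one_mem_trigPoly : (1 : C(G, ℂ)) ∈ trigPoly G := by
  have h : IsContUnitary (Representation.trivial ℂ G ℂ) :=
    ⟨fun g v => rfl, fun v => continuous_const⟩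
  convert coeffFun_mem_trigPoly h 1 1
  ext g
  simp

end Decomposition

end BeurlingFourier

end

noncomputable section

set_option linter.unusedSectionVars false

open MeasureTheory Matrix
open scoped TensorProduct

namespace BeurlingFourier

/-! ### The length function through spans of coefficients -/

section Length

variable {G : Type} [Group G] [TopologicalSpace G]

/-- The coefficients of the elements of a set of classes of irreducible representations. -/
def coeffSet (S : Set (UnitaryDual G)) : Set C(G, ℂ) :=
  {f | ∃ p ∈ S, ∃ x y, f = coeffFun p.irrep.isContUnitary x y}

/-- The span of the coefficients of the elements of `S`. -/
def coeffSpan (S : Set (UnitaryDual G)) : Submodule ℂ C(G, ℂ) := Submodule.span ℂ (coeffSet S)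

theorem coeffFun_mem_coeffSpan {S : Set (UnitaryDual G)} {p : UnitaryDual G} (hp : p ∈ S)
    (x y : EuclideanSpace ℂ (Fin p.irrep.dim)) :
    coeffFun p.irrep.isContUnitary x y ∈ coeffSpan S :=
  Submodule.subset_span ⟨p, hp, x, y, rfl⟩

theorem prod_mem_pow_submodule {A : Type*} [CommSemiring A] [Algebra ℂ A] (M : Submodule ℂ A) :
    ∀ {k : ℕ} (f : Fin k → A), (∀ i, f i ∈ M) → ∏ i, f i ∈ M ^ k
  | 0, f, _ => by simp [Submodule.one_le.1 le_rfl]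
  | k + 1, f, hf => by
    rw [Fin.prod_univ_succ, pow_succ']
    exact Submodule.mul_mem_mul (hf 0) (prod_mem_pow_submodule M _ fun i => hf i.succ)

/-- The tensor product of a finite family of irreducible representations. -/
def piTensorRep {k : ℕ} (σ : Fin k → UnitaryDual G) :
    Representation ℂ G (⨂[ℂ] i : Fin k, EuclideanSpace ℂ (Fin (σ i).irrep.dim)) where
  toFun g := PiTensorProduct.map fun i => (σ i).irrep.rep g
  map_one' := by simp only [map_one]; exact PiTensorProduct.map_one
  map_mul' a b := by simp only [map_mul]; exact PiTensorProduct.map_mul _ _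

theorem piTensorRep_apply {k : ℕ} (σ : Fin k → UnitaryDual G) (g : G) :
    piTensorRep σ g = PiTensorProduct.map fun i => (σ i).irrep.rep g := rfl

/-- Expanding every factor `σ i g (v i)` in the standard basis writes a coefficient of the tensor
product as a linear combination of products of `k` coefficients, one for each factor. -/
theorem exists_mem_pow_eq_dual_piTensorRep {S : Set (UnitaryDual G)} {k : ℕ}
    {σ : Fin k → UnitaryDual G}
    (hσ : ∀ i, σ i ∈ S)
    (l : Module.Dual ℂ (⨂[ℂ] i : Fin k, EuclideanSpace ℂ (Fin (σ i).irrep.dim)))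
    (t : ⨂[ℂ] i : Fin k, EuclideanSpace ℂ (Fin (σ i).irrep.dim)) :
    ∃ f ∈ coeffSpan S ^ k, ∀ g, f g = l (piTensorRep σ g t) := by
  classical
  induction t using PiTensorProduct.induction_on with
  | smul_tprod c v =>
    let e := fun i => EuclideanSpace.basisFun (Fin (σ i).irrep.dim) ℂ
    refine ⟨∑ J : (∀ i, Fin (σ i).irrep.dim),
      (c * l (⨂ₜ[ℂ] i, e i (J i))) •
        ∏ i, coeffFun (σ i).irrep.isContUnitary (v i) (e i (J i)), ?_, fun g => ?_⟩
    · exact Submodule.sum_mem _ fun J _ => Submodule.smul_mem _ _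
        (prod_mem_pow_submodule _ _ fun i => coeffFun_mem_coeffSpan (hσ i) _ _)
    · rw [map_smul, map_smul, piTensorRep_apply, PiTensorProduct.map_tprod]
      have h1 : ∀ i, (σ i).irrep.rep g (v i)
          = ∑ j, inner ℂ (e i j) ((σ i).irrep.rep g (v i)) • e i j := fun i =>
        ((e i).sum_repr' _).symm
      conv_rhs => rw [funext h1, MultilinearMap.map_sum]
      simp only [MultilinearMap.map_smul_univ, map_sum, map_smul, smul_eq_mul,
        ContinuousMap.coe_sum, Finset.sum_apply, ContinuousMap.coe_smul, Pi.smul_apply,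
        ContinuousMap.coe_prod, Finset.prod_apply, coeffFun_apply, Finset.mul_sum]
      exact Finset.sum_congr rfl fun J _ => by ring
  | add t t' h h' =>
    obtain ⟨f, hf, h⟩ := h
    obtain ⟨f', hf', h'⟩ := h'
    exact ⟨f + f', Submodule.add_mem _ hf hf', fun g => by
      rw [ContinuousMap.add_apply, h, h', map_add, map_add]⟩

/-- A linear left inverse of the embedding, equivariant or not, turns `⟨y, ·⟩` into a functional on
the tensor product. -/
theorem coeffFun_mem_pow_of_isSubrepOfTensor {S : Set (UnitaryDual G)} {p : UnitaryDual G} {k : ℕ}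
    {σ : Fin k → UnitaryDual G} (hσ : ∀ i, σ i ∈ S) (h : IsSubrepOfTensor p σ)
    (x y : EuclideanSpace ℂ (Fin p.irrep.dim)) :
    coeffFun p.irrep.isContUnitary x y ∈ coeffSpan S ^ k := by
  obtain ⟨T, hinj, hT⟩ := h
  obtain ⟨L, hL⟩ := T.exists_leftInverse_of_injective (LinearMap.ker_eq_bot.2 hinj)
  obtain ⟨f, hf, hfg⟩ := exists_mem_pow_eq_dual_piTensorRep hσ (innerₛₗ ℂ y ∘ₗ L) (T x)
  convert hf
  ext g
  rw [hfg, piTensorRep_apply, ← hT, LinearMap.comp_apply, ← LinearMap.comp_apply L T, hL]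
  rfl

variable [IsTopologicalGroup G] [CompactSpace G] [MeasurableSpace G] [BorelSpace G]

/-- The functional `f ↦ ∫ f h`. -/
def haarInt (h : C(G, ℂ)) : C(G, ℂ) →L[ℂ] ℂ :=
  LinearMap.mkContinuous
    { toFun := fun f => ∫ g, f g * h g ∂(haarProb G)
      map_add' := fun f f' => by
        simp only [ContinuousMap.add_apply, add_mul]
        exact integral_add (integrable_of_continuous (f * h).continuous)
          (integrable_of_continuous (f' * h).continuous)
      map_smul' := fun c f => by
        simp only [ContinuousMap.smul_apply, smul_eq_mul, mul_assoc, RingHom.id_apply]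
        exact integral_const_mul _ _ } ‖h‖ (fun f => by
      refine (norm_integral_le_of_norm_le_const (C := ‖h‖ * ‖f‖)
        (Filter.Eventually.of_forall fun g => ?_)).trans ?_
      · rw [norm_mul, mul_comm]
        gcongr
        exacts [h.norm_coe_le_norm g, f.norm_coe_le_norm g]
      · simp)

theorem haarInt_apply (h f : C(G, ℂ)) : haarInt h f = ∫ g, f g * h g ∂(haarProb G) := rfl

/-- A partial converse: if a product of `k` coefficients has a non-zero pairing with a conjugated
coefficient of `p`, the pairing is a value of an averaged intertwiner from `p` to the tensor
product. That intertwiner is then non-zero, hence injective because `p` is irreducible. -/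
theorem exists_isSubrepOfTensor {S : Set (UnitaryDual G)} {p : UnitaryDual G} {k : ℕ}
    {f : C(G, ℂ)} (hf : f ∈ coeffSpan S ^ k) (x z : EuclideanSpace ℂ (Fin p.irrep.dim))
    (h : haarInt (antiCoeff p.irrep.isContUnitary x z) f ≠ 0) :
    ∃ σ : Fin k → UnitaryDual G, (∀ i, σ i ∈ S) ∧ IsSubrepOfTensor p σ := by
  classical
  by_contra hno
  refine h ?_
  clear h
  rw [coeffSpan, Submodule.span_pow] at hf
  induction hf using Submodule.span_induction with
  | zero => exact map_zero _
  | add f f' _ _ h h' => rw [map_add, h, h', add_zero]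
  | smul c f _ h => rw [map_smul, h, smul_zero]
  | mem f hf =>
    obtain ⟨F, rfl⟩ := Set.mem_pow.1 hf
    choose σ hσ v u hF using fun i => (F i).2
    obtain ⟨T, hT, hl⟩ := exists_intertwiner (σ := piTensorRep σ) (fun l a => by
      obtain ⟨f, -, hf⟩ := exists_mem_pow_eq_dual_piTensorRep hσ l a
      simpa only [← hf] using f.continuous) p.irrep.isContUnitary (⨂ₜ[ℂ] i, v i) x
    have hT0 : T = 0 := by
      by_contra hT0
      exact hno ⟨σ, hσ, T, intertwiner_injective p.irrep.irreducible T hT hT0, hT⟩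
    -- The functional `⨂ ⟨u i, ·⟩`, whose coefficient at `⨂ v i` is the product of the given
    -- coefficients.
    let l : Module.Dual ℂ (⨂[ℂ] i : Fin k, EuclideanSpace ℂ (Fin (σ i).irrep.dim)) :=
      PiTensorProduct.lift ((MultilinearMap.mkPiAlgebra ℂ (Fin k) ℂ).compLinearMap
        fun i => innerₛₗ ℂ (u i))
    have h1 := hl l z
    rw [hT0, LinearMap.zero_apply, map_zero] at h1
    rw [haarInt_apply, h1]
    refine integral_congr_ae (Filter.Eventually.of_forall fun g => ?_)
    simp only [List.prod_ofFn, hF]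
    simp [l, piTensorRep_apply, PiTensorProduct.map_tprod]

theorem exists_coeffFun_haarInt_ne_zero (p : UnitaryDual G) :
    ∃ x : EuclideanSpace ℂ (Fin p.irrep.dim),
      haarInt (antiCoeff p.irrep.isContUnitary x x) (coeffFun p.irrep.isContUnitary x x) ≠ 0 := by
  have := irreducible_nontrivial p.irrep.irreducible
  obtain ⟨x, hx⟩ := exists_norm_eq (EuclideanSpace ℂ (Fin p.irrep.dim)) (zero_le_one' ℝ)
  refine ⟨x, ?_⟩
  have hd : (Module.finrank ℂ (EuclideanSpace ℂ (Fin p.irrep.dim)) : ℂ) ≠ 0 := by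
    exact_mod_cast (Module.finrank_pos (R := ℂ)).ne'
  have h := schur_orthogonality_self p.irrep.isContUnitary p.irrep.irreducible x x x x
  rw [haarInt_apply]
  simp only [coeffFun_apply, antiCoeff_apply]
  rw [h, inner_self_eq_norm_sq_to_K, hx]
  simpa using hd

/-- A coefficient of `p` pairs non-trivially with its own conjugate, so lying in the `k`-th power
already forces `p` to occur in a product of `k` elements of `S`. -/
theorem lengthFun_le {S : Set (UnitaryDual G)} {p : UnitaryDual G} {k : ℕ}
    (h : ∀ x y, coeffFun p.irrep.isContUnitary x y ∈ coeffSpan S ^ k) : lengthFun S p ≤ k := by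
  obtain ⟨x, hx⟩ := exists_coeffFun_haarInt_ne_zero p
  exact Nat.sInf_le (exists_isSubrepOfTensor (h x x) x x hx)

theorem exists_mem_pow_of_mem_adjoin {A : Type*} [CommSemiring A] [Algebra ℂ A] {s : Set A} {f : A}
    (hf : f ∈ Algebra.adjoin ℂ s) :
    f ∈ Submodule.span ℂ {h : A | ∃ k, h ∈ Submodule.span ℂ s ^ k} := by
  rw [← Subalgebra.mem_toSubmodule, Algebra.adjoin_eq_span] at hf
  refine Submodule.span_mono (fun x hx => ?_) hf
  induction hx using Submonoid.closure_induction with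
  | mem x hx => exact ⟨1, by rw [pow_one]; exact Submodule.subset_span hx⟩
  | one => exact ⟨0, by rw [pow_zero]; exact Submodule.one_le.1 le_rfl⟩
  | mul x y _ _ hx hy =>
    obtain ⟨k, hk⟩ := hx
    obtain ⟨l, hl⟩ := hy
    exact ⟨k + l, by rw [pow_add]; exact Submodule.mul_mem_mul hk hl⟩

/-- If the coefficients of `S` generate a dense algebra, then every irreducible representation is
contained in a tensor product of elements of `S`. -/
theorem coeffFun_mem_pow_lengthFun {S : Set (UnitaryDual G)}
    (hS : Dense (Algebra.adjoin ℂ (coeffSet S) : Set C(G, ℂ))) (p : UnitaryDual G)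
    (x y : EuclideanSpace ℂ (Fin p.irrep.dim)) :
    coeffFun p.irrep.isContUnitary x y ∈ coeffSpan S ^ lengthFun S p := by
  -- `lengthFun` is an infimum in `ℕ`, with value `0` on the empty set, so density is needed to rule
  -- this case out: otherwise a coefficient of `p` would be orthogonal to a dense algebra.
  have hne : {k | ∃ σ : Fin k → UnitaryDual G, (∀ i, σ i ∈ S) ∧ IsSubrepOfTensor p σ}.Nonempty := by
    by_contra hno
    obtain ⟨x, hx⟩ := exists_coeffFun_haarInt_ne_zero p
    refine hx ?_
    suffices h : haarInt (antiCoeff p.irrep.isContUnitary x x) = 0 by rw [h]; rfl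
    refine ContinuousLinearMap.coeFn_injective (Continuous.ext_on hS
      (ContinuousLinearMap.continuous _) continuous_zero fun f hf => ?_)
    replace hf := exists_mem_pow_of_mem_adjoin hf
    induction hf using Submodule.span_induction with
    | zero => exact map_zero _
    | add f f' _ _ h h' => exact (map_add _ f f').trans (by rw [h, h']; exact add_zero 0)
    | smul c f _ h => exact (map_smul _ c f).trans (by rw [h]; exact smul_zero c)
    | mem f hf =>
      obtain ⟨k, hk⟩ := hf
      by_contra h0
      exact hno ⟨k, exists_isSubrepOfTensor hk x x h0⟩
  obtain ⟨σ, hσ, h⟩ := Nat.sInf_mem hne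
  exact coeffFun_mem_pow_of_isSubrepOfTensor hσ h x y

/-- In terms of spans of coefficients, subadditivity is just the addition of exponents. No
associativity of tensor products of representations is required. -/
theorem lengthFun_le_add {S : Set (UnitaryDual G)}
    (hS : Dense (Algebra.adjoin ℂ (coeffSet S) : Set C(G, ℂ))) {p q r : UnitaryDual G}
    (h : ∀ x y, coeffFun r.irrep.isContUnitary x y ∈ coeffSpan {p} * coeffSpan {q}) :
    lengthFun S r ≤ lengthFun S p + lengthFun S q := by
  have key : ∀ p : UnitaryDual G, coeffSpan {p} ≤ coeffSpan S ^ lengthFun S p := by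
    intro p
    refine Submodule.span_le.2 ?_
    rintro _ ⟨_, rfl, x, y, rfl⟩
    exact coeffFun_mem_pow_lengthFun hS _ x y
  refine lengthFun_le fun x y => ?_
  rw [pow_add (coeffSpan S) (lengthFun S p)]
  exact mul_le_mul' (key p) (key q) (h x y)

theorem adjoin_coeffSet_le_trigPoly (S : Set (UnitaryDual G)) :
    (Algebra.adjoin ℂ (coeffSet S) : Set C(G, ℂ)) ⊆ trigPoly G := by
  intro f hf
  induction hf using Algebra.adjoin_induction with
  | mem f hf =>
    obtain ⟨p, -, x, y, rfl⟩ := hf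
    exact coeffFun_mem_trigPoly _ _ _
  | algebraMap c =>
    rw [Algebra.algebraMap_eq_smul_one]
    exact Submodule.smul_mem _ _ one_mem_trigPoly
  | add f g _ _ hf hg => exact Submodule.add_mem _ hf hg
  | mul f g _ _ hf hg => exact trigPoly_mul_mem hf hg

end Length

end BeurlingFourier

end

noncomputable section

set_option linter.unusedSectionVars false

open MeasureTheory Matrix
open scoped TensorProduct ENNReal

namespace BeurlingFourier

/-! ### The norm of the Beurling-Fourier algebra -/

section Norm

variable {G : Type} [Group G] [TopologicalSpace G] [IsTopologicalGroup G] [CompactSpace G]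
  [MeasurableSpace G] [BorelSpace G]

/-- The trace norm is attained by pairing with two orthonormal families; for a rank-one operator
that pairing factors, and Cauchy–Schwarz with Bessel's inequality bounds it. -/
theorem traceNorm_le_of_rank_one {V : Type*} [NormedAddCommGroup V] [InnerProductSpace ℂ V]
    [FiniteDimensional ℂ V] {T : V →ₗ[ℂ] V} {c : ℂ} {x y : V}
    (hT : ∀ a, T a = (c * inner ℂ x a) • y) : traceNorm T ≤ ‖c‖ * (‖x‖ * ‖y‖) := by
  obtain ⟨I, e, f, he, hf, h⟩ := exists_traceNorm_eq T
  have h1 : traceNorm T = ‖∑ i, inner ℂ (f i) (T (e i))‖ := by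
    rw [← h, Complex.norm_real, Real.norm_of_nonneg (traceNorm_nonneg _)]
  rw [h1]
  simp only [hT, inner_smul_right, mul_assoc, ← Finset.mul_sum, norm_mul]
  gcongr
  calc ‖∑ i, inner ℂ x (e i) * inner ℂ (f i) y‖
      ≤ ∑ i, ‖inner ℂ (e i) x‖ * ‖inner ℂ (f i) y‖ := by
        refine (norm_sum_le _ _).trans (le_of_eq (Finset.sum_congr rfl fun i _ => ?_))
        rw [norm_mul, norm_inner_symm]
    _ ≤ √(∑ i, ‖inner ℂ (e i) x‖ ^ 2) * √(∑ i, ‖inner ℂ (f i) y‖ ^ 2) :=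
        Real.sum_mul_le_sqrt_mul_sqrt _ _ _
    _ ≤ √(‖x‖ ^ 2) * √(‖y‖ ^ 2) := by
        gcongr
        · exact he.sum_inner_products_le x
        · exact hf.sum_inner_products_le y
    _ = ‖x‖ * ‖y‖ := by rw [Real.sqrt_sq (norm_nonneg _), Real.sqrt_sq (norm_nonneg _)]

/-- The Fourier coefficient as a linear map. -/
def fourierLin (q : UnitaryIrrep G) :
    C(G, ℂ) →ₗ[ℂ] (EuclideanSpace ℂ (Fin q.dim) →L[ℂ] EuclideanSpace ℂ (Fin q.dim)) where
  toFun f := fourierCoeff f q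
  map_add' f g := fourierCoeff_add f g q
  map_smul' c f := fourierCoeff_smul c f q

@[simp] theorem fourierLin_apply (q : UnitaryIrrep G) (f : C(G, ℂ)) :
    fourierLin q f = fourierCoeff f q := rfl

theorem inner_fourierCoeff_eq_haarInt (f : C(G, ℂ)) (q : UnitaryIrrep G)
    (a b : EuclideanSpace ℂ (Fin q.dim)) :
    inner ℂ b (fourierCoeff f q a) = haarInt (coeffFun q.isContUnitary a b) f := by
  rw [inner_fourierCoeff, haarInt_apply]
  simp only [coeffFun_apply, mul_comm]

/-- The norm of `A(G, w)` with values in `[0, ∞]`. -/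
def bfENorm (w : UnitaryDual G → Set.Ioi (0 : ℝ)) (f : C(G, ℂ)) : ℝ≥0∞ :=
  ∑' p, ENNReal.ofReal (bfTerm w f p)

variable {w : UnitaryDual G → Set.Ioi (0 : ℝ)}

theorem bfENorm_eq (f : beurlingFourier w) : bfENorm w f = ENNReal.ofReal (bfNorm w f) :=
  (ENNReal.ofReal_tsum_of_nonneg (bfTerm_nonneg w _) f.2).symm

theorem bfNorm_nonneg (f : beurlingFourier w) : 0 ≤ bfNorm w f := tsum_nonneg (bfTerm_nonneg w _)

theorem mem_beurlingFourier_iff {f : C(G, ℂ)} : f ∈ beurlingFourier w ↔ bfENorm w f ≠ ∞ := by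
  refine ⟨fun h => ?_, fun h => ?_⟩
  · rw [bfENorm_eq ⟨f, h⟩]
    exact ENNReal.ofReal_ne_top
  · have := ENNReal.summable_toReal h
    refine this.congr fun p => ?_
    rw [ENNReal.toReal_ofReal (bfTerm_nonneg w _ _)]

theorem bfNorm_le {f : beurlingFourier w} {c : ℝ} (hc : 0 ≤ c)
    (h : bfENorm w f ≤ ENNReal.ofReal c) : bfNorm w f ≤ c := by
  rwa [bfENorm_eq, ENNReal.ofReal_le_ofReal_iff hc] at h

/-- Countable subadditivity under uniform convergence: the orthonormal families that attain the
trace norm of `f̂(q)` define a functional continuous for the uniform norm, which can be applied to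
the series term by term. -/
theorem hasSum_traceNorm_le {J : Type*} {F : J → C(G, ℂ)} {f : C(G, ℂ)} (h : HasSum F f)
    (q : UnitaryIrrep G) : ENNReal.ofReal (traceNorm (fourierCoeff f q).toLinearMap)
      ≤ ∑' j, ENNReal.ofReal (traceNorm (fourierCoeff (F j) q).toLinearMap) := by
  obtain ⟨I, e, u, he, hu, hT⟩ := exists_traceNorm_eq (fourierCoeff f q).toLinearMap
  have h1 : HasSum (fun j => ∑ i, inner ℂ (u i) (fourierCoeff (F j) q (e i)))
      (∑ i, inner ℂ (u i) (fourierCoeff f q (e i))) := by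
    refine hasSum_sum fun i _ => ?_
    simp only [inner_fourierCoeff_eq_haarInt]
    exact h.mapL (haarInt _)
  have h2 : ENNReal.ofReal (traceNorm (fourierCoeff f q).toLinearMap)
      = ‖∑ i, inner ℂ (u i) (fourierCoeff f q (e i))‖ₑ := by
    rw [← ofReal_norm]
    congr 1
    have := congrArg norm hT
    rw [Complex.norm_real, Real.norm_of_nonneg (traceNorm_nonneg _)] at this
    exact this
  rw [h2, ← h1.tsum_eq]
  refine (enorm_tsum_le_tsum_enorm).trans (ENNReal.tsum_le_tsum fun j => ?_)
  rw [← ofReal_norm]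
  exact ENNReal.ofReal_le_ofReal
    (norm_sum_inner_le_traceNorm (fourierCoeff (F j) q).toLinearMap he hu)

theorem bfENorm_le_tsum {J : Type*} {F : J → C(G, ℂ)} {f : C(G, ℂ)} (h : HasSum F f) :
    bfENorm w f ≤ ∑' j, bfENorm w (F j) := by
  unfold bfENorm
  rw [ENNReal.tsum_comm]
  refine ENNReal.tsum_le_tsum fun p => ?_
  have hc : 0 ≤ (p.irrep.dim : ℝ) * (w p : ℝ) := mul_nonneg (Nat.cast_nonneg _) (le_of_lt (w p).2)
  simp only [bfTerm, ENNReal.ofReal_mul hc]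
  rw [ENNReal.tsum_mul_left]
  gcongr
  exact hasSum_traceNorm_le h p.irrep

theorem bfENorm_sum_le {J : Type*} (s : Finset J) (F : J → C(G, ℂ)) :
    bfENorm w (∑ j ∈ s, F j) ≤ ∑ j ∈ s, bfENorm w (F j) := by
  rw [← Finset.sum_coe_sort s F, ← Finset.sum_coe_sort s fun j => bfENorm w (F j)]
  refine (bfENorm_le_tsum (hasSum_fintype fun j : s => F j)).trans_eq (tsum_fintype _)

theorem bfTerm_eq_zero {f : C(G, ℂ)} {p : UnitaryDual G} (h : fourierCoeff f p.irrep = 0) :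
    bfTerm w f p = 0 := by
  rw [bfTerm, h]
  exact mul_eq_zero_of_right _ traceNorm_zero

theorem dim_ne_zero (p : UnitaryDual G) : (p.irrep.dim : ℂ) ≠ 0 := by
  have := irreducible_nontrivial p.irrep.irreducible
  have h := (Module.finrank_pos (R := ℂ) (M := EuclideanSpace ℂ (Fin p.irrep.dim))).ne'
  rw [finrank_euclideanSpace_fin] at h
  exact_mod_cast h

/-- Only the term at `p` survives. There the Fourier coefficient has rank one, and its factor `1 /
d_p` cancels the `d_p` in the norm. -/
theorem bfENorm_antiCoeff_le (p : UnitaryDual G) (x y : EuclideanSpace ℂ (Fin p.irrep.dim)) :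
    bfENorm w (antiCoeff p.irrep.isContUnitary x y) ≤ ENNReal.ofReal (w p * (‖x‖ * ‖y‖)) := by
  rw [bfENorm, tsum_eq_single p fun q hq => by
    rw [bfTerm_eq_zero (fourierCoeff_antiCoeff_ne hq.symm x y), ENNReal.ofReal_zero]]
  refine ENNReal.ofReal_le_ofReal ?_
  have h := traceNorm_le_of_rank_one
    (T := (fourierCoeff (antiCoeff p.irrep.isContUnitary x y) p.irrep).toLinearMap)
    (c := (p.irrep.dim : ℂ)⁻¹) fun a => fourierCoeff_antiCoeff_self p x y a
  have hd : (p.irrep.dim : ℝ) ≠ 0 := by exact_mod_cast dim_ne_zero p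
  rw [norm_inv, Complex.norm_natCast] at h
  have hc : 0 ≤ (p.irrep.dim : ℝ) * (w p : ℝ) := mul_nonneg (Nat.cast_nonneg _) (le_of_lt (w p).2)
  calc bfTerm w (antiCoeff p.irrep.isContUnitary x y) p
      ≤ p.irrep.dim * w p * ((p.irrep.dim : ℝ)⁻¹ * (‖x‖ * ‖y‖)) := mul_le_mul_of_nonneg_left h hc
    _ = w p * (‖x‖ * ‖y‖) := by field_simp

theorem trigPoly_le_beurlingFourier : trigPoly G ≤ beurlingFourier w := by
  refine Submodule.span_le.2 ?_
  rintro _ ⟨p, x, y, rfl⟩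
  exact mem_beurlingFourier_iff.2
    (ne_top_of_le_ne_top ENNReal.ofReal_ne_top (bfENorm_antiCoeff_le p x y))

/-! ### Isotypic components and absolute convergence of Fourier series. -/

/-- The `p`-isotypic component of `f`. -/
def component (f : C(G, ℂ)) (p : UnitaryDual G) : C(G, ℂ) :=
  ∑ i, antiCoeff p.irrep.isContUnitary (EuclideanSpace.basisFun (Fin p.irrep.dim) ℂ i)
    ((p.irrep.dim : ℂ) • fourierCoeff f p.irrep (EuclideanSpace.basisFun (Fin p.irrep.dim) ℂ i))

/-- The sum is the trace of `d_p p(g⁻¹) f̂(p)`, so any orthonormal basis may be used; a singular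
basis of `f̂(p)` makes the norms add up to the trace norm. -/
theorem component_eq_sum (f : C(G, ℂ)) (p : UnitaryDual G) {ι : Type} [Fintype ι]
    (u : OrthonormalBasis ι ℂ (EuclideanSpace ℂ (Fin p.irrep.dim))) :
    component f p = ∑ i, antiCoeff p.irrep.isContUnitary (u i)
      ((p.irrep.dim : ℂ) • fourierCoeff f p.irrep (u i)) := by
  have key : ∀ {κ : Type} [Fintype κ]
      (u : OrthonormalBasis κ ℂ (EuclideanSpace ℂ (Fin p.irrep.dim))) (g : G),
      (∑ i, antiCoeff p.irrep.isContUnitary (u i)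
        ((p.irrep.dim : ℂ) • fourierCoeff f p.irrep (u i))) g =
      LinearMap.trace ℂ _ (p.irrep.rep g⁻¹ ∘ₗ
        ((p.irrep.dim : ℂ) • (fourierCoeff f p.irrep).toLinearMap)) := by
    intro κ _ u g
    rw [LinearMap.trace_eq_sum_inner _ u, ContinuousMap.coe_sum, Finset.sum_apply]
    refine Finset.sum_congr rfl fun i _ => ?_
    rw [antiCoeff_apply, LinearMap.comp_apply, ← p.irrep.isContUnitary.inner_map g (u i),
      rep_apply_inv_apply]
    rfl
  ext g
  rw [component, key, key]

theorem fourierCoeff_component_ne (f : C(G, ℂ)) {p q : UnitaryDual G} (h : p ≠ q) :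
    fourierCoeff (component f p) q.irrep = 0 := by
  rw [component, ← fourierLin_apply, map_sum]
  exact Finset.sum_eq_zero fun i _ => fourierCoeff_antiCoeff_ne h _ _

theorem fourierCoeff_component_self (f : C(G, ℂ)) (p : UnitaryDual G) :
    fourierCoeff (component f p) p.irrep = fourierCoeff f p.irrep := by
  rw [component, ← fourierLin_apply, map_sum]
  refine ContinuousLinearMap.ext fun a => ?_
  rw [_root_.sum_apply]
  simp only [fourierLin_apply, fourierCoeff_antiCoeff_self]
  conv_rhs => rw [← (EuclideanSpace.basisFun (Fin p.irrep.dim) ℂ).sum_repr' a, map_sum]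
  refine Finset.sum_congr rfl fun i _ => ?_
  rw [smul_smul, map_smul, mul_right_comm, inv_mul_cancel₀ (dim_ne_zero p), one_mul]

theorem component_mem_trigPoly (f : C(G, ℂ)) (p : UnitaryDual G) : component f p ∈ trigPoly G :=
  Submodule.sum_mem _ fun _ _ => antiCoeff_irrep_mem _ _ _

/-- The component as a sum of conjugated coefficients, with optimal norms. -/
theorem exists_component_eq (f : C(G, ℂ)) (p : UnitaryDual G) :
    ∃ (ι : Type) (_ : Fintype ι) (x y : ι → EuclideanSpace ℂ (Fin p.irrep.dim)),
      component f p = ∑ i, antiCoeff p.irrep.isContUnitary (x i) (y i) ∧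
      w p * ∑ i, ‖x i‖ * ‖y i‖ = bfTerm w f p := by
  obtain ⟨u, -, hu⟩ := exists_singularBasis (fourierCoeff f p.irrep).toLinearMap
  refine ⟨_, inferInstance, u, fun i => (p.irrep.dim : ℂ) • fourierCoeff f p.irrep (u i),
    component_eq_sum f p u, ?_⟩
  rw [bfTerm, hu]
  simp only [u.orthonormal.1, norm_smul, one_mul, ← Finset.mul_sum, Complex.norm_natCast]
  rw [mul_left_comm, mul_assoc]
  rfl

theorem norm_component_le (hw : ∀ p, 1 ≤ (w p : ℝ)) (f : C(G, ℂ)) (p : UnitaryDual G) :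
    ‖component f p‖ ≤ bfTerm w f p := by
  obtain ⟨ι, _, x, y, h1, h2⟩ := exists_component_eq (w := w) f p
  rw [ContinuousMap.norm_le _ (bfTerm_nonneg w f p), ← h2, h1]
  intro g
  have h3 : ‖(∑ i, antiCoeff p.irrep.isContUnitary (x i) (y i)) g‖ ≤ ∑ i, ‖x i‖ * ‖y i‖ := by
    rw [ContinuousMap.coe_sum, Finset.sum_apply]
    refine (norm_sum_le _ _).trans (Finset.sum_le_sum fun i _ => ?_)
    have h4 := norm_inner_le_norm (𝕜 := ℂ) (p.irrep.rep g (x i)) (y i)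
    rwa [p.irrep.norm_map] at h4
  exact h3.trans (le_mul_of_one_le_left
    (Finset.sum_nonneg fun i _ => mul_nonneg (norm_nonneg _) (norm_nonneg _)) (hw p))

/-- The functional `h ↦ ∫ h f` kills all coefficients, hence by density everything, in particular
the conjugate of `f`; so `∫ |f|² = 0`. -/
theorem eq_zero_of_fourierCoeff (hd : Dense (trigPoly G : Set C(G, ℂ))) {f : C(G, ℂ)}
    (h : ∀ q : UnitaryDual G, fourierCoeff f q.irrep = 0) : f = 0 := by
  have h1 : haarInt f = 0 := by
    refine ContinuousLinearMap.coeFn_injective (Continuous.ext_on hd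
      (ContinuousLinearMap.continuous _) continuous_zero fun t ht => ?_)
    rw [SetLike.mem_coe, trigPoly_eq_span_coeffFun] at ht
    induction ht using Submodule.span_induction with
    | zero => exact map_zero _
    | add f f' _ _ h h' => exact (map_add _ f f').trans (by rw [h, h']; exact add_zero 0)
    | smul c f _ h => exact (map_smul _ c f).trans (by rw [h]; exact smul_zero c)
    | mem t ht =>
      obtain ⟨q, x, y, rfl⟩ := ht
      have h2 := inner_fourierCoeff_eq_haarInt f q.irrep x y
      rw [h, _root_.zero_apply, inner_zero_right, haarInt_apply] at h2
      simp only [haarInt_apply, mul_comm _ (f _)]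
      exact h2.symm
  have h2 : haarInt f (star f) = 0 := by rw [h1]; rfl
  have h3 : ∫ g, ‖f g‖ ^ 2 ∂(haarProb G) = 0 := by
    have h4 : haarInt f (star f) = ((∫ g, ‖f g‖ ^ 2 ∂(haarProb G) : ℝ) : ℂ) := by
      rw [haarInt_apply, ← integral_complex_ofReal]
      refine integral_congr_ae (Filter.Eventually.of_forall fun g => ?_)
      simp [Complex.conj_mul']
    rw [h4] at h2
    exact_mod_cast h2
  have hc : Continuous fun g => ‖f g‖ ^ 2 := (f.continuous.norm).pow 2
  rw [integral_eq_zero_iff_of_nonneg (fun g => sq_nonneg _) (integrable_of_continuous hc)] at h3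
  have h5 := (hc.ae_eq_iff_eq _ continuous_zero).1 h3
  ext g
  simpa using congrFun h5 g

/-- Absolute convergence of the Fourier series of an element of `A(G, w)`. -/
theorem hasSum_component (hd : Dense (trigPoly G : Set C(G, ℂ))) (hw : ∀ p, 1 ≤ (w p : ℝ))
    {f : C(G, ℂ)} (hf : f ∈ beurlingFourier w) : HasSum (component f) f := by
  have hs : Summable (component f) := Summable.of_norm_bounded hf (norm_component_le hw f)
  convert hs.hasSum
  rw [← sub_eq_zero]
  refine eq_zero_of_fourierCoeff hd fun q => ?_
  rw [← fourierLin_apply, map_sub, sub_eq_zero]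
  refine ContinuousLinearMap.ext fun a => ext_inner_left ℂ fun b => ?_
  simp only [fourierLin_apply, inner_fourierCoeff_eq_haarInt]
  rw [(haarInt _).map_tsum hs, tsum_eq_single q]
  · rw [← inner_fourierCoeff_eq_haarInt, ← inner_fourierCoeff_eq_haarInt,
      fourierCoeff_component_self]
  · intro p hp
    rw [← inner_fourierCoeff_eq_haarInt, fourierCoeff_component_ne f hp,
      _root_.zero_apply, inner_zero_right]

/-! ### Products in the algebra. -/

/-- Submultiplicativity of a weight on the dual. -/
def IsSubmultWeight (w : UnitaryDual G → Set.Ioi (0 : ℝ)) : Prop :=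
  ∀ p q r : UnitaryDual G,
    (∀ x y, coeffFun r.irrep.isContUnitary x y ∈ coeffSpan {p} * coeffSpan {q}) →
    (w r : ℝ) ≤ w p * w q

/-- The product is a conjugated coefficient of `p ⊗ q`. Every constituent of `p ⊗ q` has weight at
most `w p * w q`, and the orthogonal decomposition does not increase the product of the norms of the
two vectors. -/
theorem bfENorm_antiCoeff_mul_le (hs : IsSubmultWeight w) (p q : UnitaryDual G)
    (x y : EuclideanSpace ℂ (Fin p.irrep.dim)) (x' y' : EuclideanSpace ℂ (Fin q.irrep.dim)) :
    bfENorm w (antiCoeff p.irrep.isContUnitary x y * antiCoeff q.irrep.isContUnitary x' y')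
      ≤ ENNReal.ofReal ((w p * (‖x‖ * ‖y‖)) * (w q * (‖x'‖ * ‖y'‖))) := by
  rw [antiCoeff_mul]
  obtain ⟨J, _, r, u, v, h1, h2, h3⟩ := exists_antiCoeff_eq_sum
    (p.irrep.isContUnitary.tprod q.irrep.isContUnitary) (x ⊗ₜ x') (y ⊗ₜ y')
  have hr : ∀ j, (w (r j) : ℝ) ≤ w p * w q := by
    refine fun j => hs _ _ _ fun a b => ?_
    obtain ⟨a', b', h⟩ := h3 j a b
    rw [h]
    exact coeffFun_tprod_mem _ _ (coeffFun_mem_coeffSpan (Set.mem_singleton p))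
      (coeffFun_mem_coeffSpan (Set.mem_singleton q)) _ _
  have hpq : 0 ≤ (w p * w q : ℝ) := mul_nonneg (le_of_lt (w p).2) (le_of_lt (w q).2)
  rw [h1]
  calc bfENorm w (∑ j, antiCoeff (r j).irrep.isContUnitary (u j) (v j))
      ≤ ∑ j, ENNReal.ofReal (w (r j) * (‖u j‖ * ‖v j‖)) := (bfENorm_sum_le _ _).trans
        (Finset.sum_le_sum fun j _ => bfENorm_antiCoeff_le _ _ _)
    _ = ENNReal.ofReal (∑ j, w (r j) * (‖u j‖ * ‖v j‖)) :=
        (ENNReal.ofReal_sum_of_nonneg fun j _ => mul_nonneg (le_of_lt (w (r j)).2)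
          (mul_nonneg (norm_nonneg _) (norm_nonneg _))).symm
    _ ≤ ENNReal.ofReal ((w p * w q) * ∑ j, ‖u j‖ * ‖v j‖) := by
        rw [Finset.mul_sum]
        refine ENNReal.ofReal_le_ofReal (Finset.sum_le_sum fun j _ => ?_)
        exact mul_le_mul_of_nonneg_right (hr j) (mul_nonneg (norm_nonneg _) (norm_nonneg _))
    _ ≤ _ := by
        refine ENNReal.ofReal_le_ofReal ((mul_le_mul_of_nonneg_left h2 hpq).trans_eq ?_)
        rw [TensorProduct.norm_tmul, TensorProduct.norm_tmul]
        ring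

theorem bfENorm_component_mul_le (hs : IsSubmultWeight w) (f g : C(G, ℂ)) (p q : UnitaryDual G) :
    bfENorm w (component f p * component g q)
      ≤ ENNReal.ofReal (bfTerm w f p) * ENNReal.ofReal (bfTerm w g q) := by
  obtain ⟨ι, _, x, y, h1, h2⟩ := exists_component_eq (w := w) f p
  obtain ⟨κ, _, x', y', h1', h2'⟩ := exists_component_eq (w := w) g q
  have hnn : ∀ i j, 0 ≤ (w p * (‖x i‖ * ‖y i‖)) * (w q * (‖x' j‖ * ‖y' j‖)) := fun i j =>
    mul_nonneg (mul_nonneg (le_of_lt (w p).2) (by positivity))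
      (mul_nonneg (le_of_lt (w q).2) (by positivity))
  rw [← ENNReal.ofReal_mul (bfTerm_nonneg w f p), ← h2, ← h2', h1, h1',
    Finset.sum_mul_sum, Finset.mul_sum _ _ (w p : ℝ), Finset.mul_sum _ _ (w q : ℝ),
    Finset.sum_mul_sum,
    ENNReal.ofReal_sum_of_nonneg fun i _ => Finset.sum_nonneg fun j _ => hnn i j]
  refine (bfENorm_sum_le _ _).trans (Finset.sum_le_sum fun i _ => ?_)
  rw [ENNReal.ofReal_sum_of_nonneg fun j _ => hnn i j]
  exact (bfENorm_sum_le _ _).trans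
    (Finset.sum_le_sum fun j _ => bfENorm_antiCoeff_mul_le hs _ _ _ _ _ _)

/-- The two Fourier series converge absolutely in the uniform norm, because `w ≥ 1`. Their product
can be expanded as a double series and estimated component by component. -/
theorem bfENorm_mul_le (hd : Dense (trigPoly G : Set C(G, ℂ))) (hw : ∀ p, 1 ≤ (w p : ℝ))
    (hs : IsSubmultWeight w) {f g : C(G, ℂ)} (hf : f ∈ beurlingFourier w)
    (hg : g ∈ beurlingFourier w) : bfENorm w (f * g) ≤ bfENorm w f * bfENorm w g := by
  have h1 : Summable fun p => ‖component f p‖ :=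
    Summable.of_nonneg_of_le (fun _ => norm_nonneg _) (norm_component_le hw f) hf
  have h2 : Summable fun p => ‖component g p‖ :=
    Summable.of_nonneg_of_le (fun _ => norm_nonneg _) (norm_component_le hw g) hg
  have h := (hasSum_component hd hw hf).mul (hasSum_component hd hw hg)
    (summable_mul_of_summable_norm h1 h2)
  refine (bfENorm_le_tsum h).trans ?_
  rw [ENNReal.tsum_prod (f := fun p q => bfENorm w (component f p * component g q))]
  calc _ ≤ ∑' p, ∑' q, ENNReal.ofReal (bfTerm w f p) * ENNReal.ofReal (bfTerm w g q) :=
        ENNReal.tsum_le_tsum fun p => ENNReal.tsum_le_tsum fun q =>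
          bfENorm_component_mul_le hs f g p q
    _ = _ := by simp only [ENNReal.tsum_mul_left, ENNReal.tsum_mul_right, bfENorm]

theorem mul_mem_beurlingFourier (hd : Dense (trigPoly G : Set C(G, ℂ))) (hw : ∀ p, 1 ≤ (w p : ℝ))
    (hs : IsSubmultWeight w) {f g : C(G, ℂ)} (hf : f ∈ beurlingFourier w)
    (hg : g ∈ beurlingFourier w) : f * g ∈ beurlingFourier w :=
  mem_beurlingFourier_iff.2 (ne_top_of_le_ne_top
    (ENNReal.mul_ne_top (mem_beurlingFourier_iff.1 hf) (mem_beurlingFourier_iff.1 hg))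
    (bfENorm_mul_le hd hw hs hf hg))

theorem bfNorm_mul_le (hd : Dense (trigPoly G : Set C(G, ℂ))) (hw : ∀ p, 1 ≤ (w p : ℝ))
    (hs : IsSubmultWeight w) (f g : beurlingFourier w) (h : (f * g : C(G, ℂ)) ∈ beurlingFourier w) :
    bfNorm w ⟨f * g, h⟩ ≤ bfNorm w f * bfNorm w g := by
  refine bfNorm_le (mul_nonneg (bfNorm_nonneg f) (bfNorm_nonneg g)) ?_
  rw [ENNReal.ofReal_mul (bfNorm_nonneg f), ← bfENorm_eq, ← bfENorm_eq]
  exact bfENorm_mul_le hd hw hs f.2 g.2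

/-- Trigonometric polynomials are dense in `A(G, w)`. -/
theorem exists_trigPoly_bfNorm_sub_lt (f : beurlingFourier w) {ε : ℝ} (hε : 0 < ε) :
    ∃ t : beurlingFourier w, (t : C(G, ℂ)) ∈ trigPoly G ∧ bfNorm w (f - t) < ε := by
  classical
  have hf : Summable (bfTerm w f) := f.2
  obtain ⟨s, hs⟩ := ((tendsto_order.1 (tendsto_tsum_compl_atTop_zero (bfTerm w f))).2 ε hε).exists
  have hmem : ∑ p ∈ s, component f p ∈ trigPoly G :=
    Submodule.sum_mem _ fun p _ => component_mem_trigPoly _ _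
  refine ⟨⟨∑ p ∈ s, component f p, trigPoly_le_beurlingFourier hmem⟩, hmem, ?_⟩
  refine lt_of_eq_of_lt ?_ hs
  have h1 : ∀ q, bfTerm w (f - ∑ p ∈ s, component f p) q
      = Set.indicator {q | q ∉ s} (bfTerm w f) q := by
    intro q
    have h2 : fourierCoeff ((f : C(G, ℂ)) - ∑ p ∈ s, component f p) q.irrep
        = fourierCoeff f q.irrep - if q ∈ s then fourierCoeff f q.irrep else 0 := by
      rw [← fourierLin_apply, map_sub, map_sum, fourierLin_apply]
      congr 1
      rw [← Finset.sum_ite_eq s q fun _ => fourierCoeff f q.irrep]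
      refine Finset.sum_congr rfl fun p _ => ?_
      split_ifs with h
      · subst h; exact fourierCoeff_component_self _ _
      · exact fourierCoeff_component_ne _ (Ne.symm h)
    by_cases hq : q ∈ s
    · rw [Set.indicator_of_notMem (by simpa using hq), bfTerm_eq_zero]
      rw [h2, if_pos hq, sub_self]
    · rw [Set.indicator_of_mem hq, bfTerm, h2, if_neg hq, sub_zero, bfTerm]
  rw [bfNorm]
  exact (tsum_congr h1).trans (tsum_subtype {q | q ∉ s} (bfTerm w f)).symm

/-- Bounded functionals on the algebra are determined by trigonometric polynomials; this is used
both for multiplicativity and for identifying points of the spectrum. -/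
theorem eq_zero_of_vanish_trigPoly (L : beurlingFourier w →ₗ[ℂ] ℂ) {C : ℝ}
    (hL : ∀ f, ‖L f‖ ≤ C * bfNorm w f)
    (h0 : ∀ f : beurlingFourier w, (f : C(G, ℂ)) ∈ trigPoly G → L f = 0) : L = 0 := by
  ext f
  rw [LinearMap.zero_apply, ← norm_le_zero_iff]
  refine le_of_forall_pos_lt_add fun ε hε => ?_
  obtain ⟨t, ht, hft⟩ := exists_trigPoly_bfNorm_sub_lt f (ε := ε / (|C| + 1)) (by positivity)
  have h1 : L f = L (f - t) := by rw [map_sub, h0 t ht, sub_zero]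
  rw [h1, zero_add]
  calc ‖L (f - t)‖ ≤ (|C| + 1) * bfNorm w (f - t) := (hL _).trans
        (mul_le_mul_of_nonneg_right (by linarith [le_abs_self C]) (bfNorm_nonneg _))
    _ < (|C| + 1) * (ε / (|C| + 1)) := by gcongr
    _ = ε := by field_simp

theorem isSubmultWeight_expWeight {S : Set (UnitaryDual G)}
    (hS : Dense (Algebra.adjoin ℂ (coeffSet S) : Set C(G, ℂ))) (β : ℝ) (hβ : 1 ≤ β) :
    IsSubmultWeight (expWeight S β hβ) := by
  intro p q r h
  change β ^ _ ≤ β ^ _ * β ^ _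
  rw [← pow_add]
  exact pow_le_pow_right₀ hβ (lengthFun_le_add hS h)

theorem one_le_expWeight (S : Set (UnitaryDual G)) (β : ℝ) (hβ : 1 ≤ β) (p : UnitaryDual G) :
    1 ≤ (expWeight S β hβ p : ℝ) := one_le_pow₀ hβ

/-- A bounded linear functional that is multiplicative on trigonometric polynomials is
multiplicative. -/
theorem map_mul_of_map_mul_trigPoly (hd : Dense (trigPoly G : Set C(G, ℂ)))
    (hw : ∀ p, 1 ≤ (w p : ℝ)) (hs : IsSubmultWeight w) (φ : beurlingFourier w →ₗ[ℂ] ℂ) {C : ℝ}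
    (hC : ∀ f, ‖φ f‖ ≤ C * bfNorm w f)
    (hm : ∀ (f g : beurlingFourier w) (h : (f * g : C(G, ℂ)) ∈ beurlingFourier w),
      (f : C(G, ℂ)) ∈ trigPoly G → (g : C(G, ℂ)) ∈ trigPoly G → φ ⟨f * g, h⟩ = φ f * φ g)
    (f g : beurlingFourier w) (h : (f * g : C(G, ℂ)) ∈ beurlingFourier w) :
    φ ⟨f * g, h⟩ = φ f * φ g := by
  have hC' : ∀ f, ‖φ f‖ ≤ |C| * bfNorm w f := fun f =>
    (hC f).trans (mul_le_mul_of_nonneg_right (le_abs_self C) (bfNorm_nonneg _))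
  -- The multiplicativity defect `φ(fg) - φ(f)φ(g)`: symmetric, and bounded in each variable. It
  -- vanishes on pairs of polynomials, then on pairs with one polynomial, then everywhere.
  let L : beurlingFourier w → beurlingFourier w →ₗ[ℂ] ℂ := fun g =>
    { toFun := fun f => φ ⟨f * g, mul_mem_beurlingFourier hd hw hs f.2 g.2⟩ - φ f * φ g
      map_add' := fun f f' => by
        have : (⟨(f + f' : beurlingFourier w) * g, mul_mem_beurlingFourier hd hw hs (f + f').2 g.2⟩
            : beurlingFourier w) = ⟨f * g, mul_mem_beurlingFourier hd hw hs f.2 g.2⟩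
            + ⟨f' * g, mul_mem_beurlingFourier hd hw hs f'.2 g.2⟩ :=
          Subtype.ext (add_mul (f : C(G, ℂ)) f' g)
        rw [this, map_add, map_add]
        ring
      map_smul' := fun c f => by
        have : (⟨(c • f : beurlingFourier w) * g, mul_mem_beurlingFourier hd hw hs (c • f).2 g.2⟩
            : beurlingFourier w) = c • ⟨f * g, mul_mem_beurlingFourier hd hw hs f.2 g.2⟩ :=
          Subtype.ext (smul_mul_assoc c (f : C(G, ℂ)) g)
        rw [this, map_smul, map_smul, RingHom.id_apply, smul_eq_mul, smul_eq_mul, smul_eq_mul]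
        ring }
  have hL : ∀ g f, L g f = φ ⟨f * g, mul_mem_beurlingFourier hd hw hs f.2 g.2⟩ - φ f * φ g :=
    fun g f => rfl
  have hb : ∀ g f, ‖L g f‖ ≤ ((|C| + |C| * |C|) * bfNorm w g) * bfNorm w f := by
    intro g f
    have e1 : ‖φ ⟨f * g, mul_mem_beurlingFourier hd hw hs f.2 g.2⟩‖
        ≤ |C| * (bfNorm w f * bfNorm w g) := (hC' _).trans
      (mul_le_mul_of_nonneg_left (bfNorm_mul_le hd hw hs f g _) (abs_nonneg _))
    have e2 : ‖φ f * φ g‖ ≤ (|C| * bfNorm w f) * (|C| * bfNorm w g) := by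
      rw [norm_mul]
      exact mul_le_mul (hC' f) (hC' g) (norm_nonneg _)
        (mul_nonneg (abs_nonneg _) (bfNorm_nonneg _))
    rw [hL]
    refine (norm_sub_le _ _).trans ((add_le_add e1 e2).trans_eq ?_)
    ring
  have step1 : ∀ g : beurlingFourier w, (g : C(G, ℂ)) ∈ trigPoly G → L g = 0 := fun g hg =>
    eq_zero_of_vanish_trigPoly (L g) (hb g) fun f hf => by rw [hL, hm f g _ hf hg, sub_self]
  have hsymm : ∀ f g, L f g = L g f := by
    intro f g
    rw [hL, hL, mul_comm (φ g)]
    congr 3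
    exact mul_comm _ _
  have step2 : L f = 0 := eq_zero_of_vanish_trigPoly (L f) (hb f) fun g hg => by
    rw [hsymm, step1 g hg, LinearMap.zero_apply]
  have := hL g f
  rw [hsymm, step2, LinearMap.zero_apply] at this
  exact (sub_eq_zero.1 this.symm)

end Norm

end BeurlingFourier

end

noncomputable section

set_option linter.unusedSectionVars false

open MeasureTheory Matrix
open scoped TensorProduct

namespace BeurlingFourier

/-! ### The Cartan decomposition of `SL(n, ℂ)` and holomorphic functions -/

section Cartan

variable {n : ℕ}

@[simp] theorem coe_toSL (g : SU n) : (toSL n g).1 = g.1 := rfl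

theorem SU_star_mul (g : SU n) : star g.1 * g.1 = 1 :=
  Matrix.mem_unitaryGroup_iff'.1 (Matrix.mem_specialUnitaryGroup_iff.1 g.2).1

theorem SU_mul_star (g : SU n) : g.1 * star g.1 = 1 :=
  Matrix.mem_unitaryGroup_iff.1 (Matrix.mem_specialUnitaryGroup_iff.1 g.2).1

theorem SU_det (g : SU n) : g.1.det = 1 := (Matrix.mem_specialUnitaryGroup_iff.1 g.2).2

/-- The matrix `diag(e^{z h₁}, …, e^{z h_n})`. -/
def expSL (h : Fin n → ℝ) (hs : ∑ i, h i = 0) (z : ℂ) : SL n :=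
  ⟨Matrix.diagonal fun i => Complex.exp (z * h i), by
    rw [Matrix.det_diagonal, ← Complex.exp_sum, ← Finset.mul_sum, ← Complex.ofReal_sum, hs]
    simp⟩

theorem coe_expSL (h : Fin n → ℝ) (hs : ∑ i, h i = 0) (z : ℂ) :
    (expSL h hs z).1 = Matrix.diagonal fun i => Complex.exp (z * h i) := rfl

theorem expSL_add (h : Fin n → ℝ) (hs : ∑ i, h i = 0) (z w : ℂ) :
    expSL h hs (z + w) = expSL h hs z * expSL h hs w := by
  apply Subtype.ext
  rw [Matrix.SpecialLinearGroup.coe_mul]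
  simp [coe_expSL, add_mul, Complex.exp_add]

/-- A diagonal matrix with phases of product `1` is in `SU(n)`. -/
theorem diagonal_mem_SU {x : Fin n → ℂ} (h1 : ∀ i, ‖x i‖ = 1) (h2 : ∏ i, x i = 1) :
    Matrix.diagonal x ∈ Matrix.specialUnitaryGroup (Fin n) ℂ := by
  rw [Matrix.mem_specialUnitaryGroup_iff, Matrix.mem_unitaryGroup_iff, Matrix.det_diagonal]
  refine ⟨?_, h2⟩
  rw [Matrix.star_eq_conjTranspose, Matrix.diagonal_conjTranspose, Matrix.diagonal_mul_diagonal,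
    ← Matrix.diagonal_one]
  congr 1
  funext i
  simp [Complex.mul_conj', h1]

theorem exists_toSL_eq_expSL (h : Fin n → ℝ) (hs : ∑ i, h i = 0) (t : ℝ) :
    ∃ g : SU n, toSL n g = expSL h hs (t * Complex.I) := by
  refine ⟨⟨(expSL h hs (t * Complex.I)).1, ?_⟩, rfl⟩
  refine diagonal_mem_SU (fun i => ?_) ?_
  · rw [mul_right_comm, ← Complex.ofReal_mul, Complex.norm_exp_ofReal_mul_I]
  · have := (expSL h hs (t * Complex.I)).2
    rwa [coe_expSL, Matrix.det_diagonal] at this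

theorem mem_unitaryGroup_of_orthonormal {u : Fin n → EuclideanSpace ℂ (Fin n)}
    (hu : Orthonormal ℂ u) :
    (Matrix.of fun i j => u j i) ∈ Matrix.unitaryGroup (Fin n) ℂ := by
  rw [Matrix.mem_unitaryGroup_iff']
  ext i j
  rw [Matrix.mul_apply, Matrix.one_apply]
  have h := orthonormal_iff_ite.1 hu i j
  rw [PiLp.inner_apply] at h
  rw [← h]
  refine Finset.sum_congr rfl fun k _ => ?_
  simp [mul_comm]

theorem norm_det_of_mem_unitaryGroup {A : Matrix (Fin n) (Fin n) ℂ}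
    (hA : A ∈ Matrix.unitaryGroup (Fin n) ℂ) : ‖A.det‖ = 1 :=
  CStarRing.norm_of_mem_unitary (Matrix.det_of_mem_unitary hA)

/-- Singular value decomposition. -/
theorem exists_svd (A : SL n) : ∃ (F U : Matrix (Fin n) (Fin n) ℂ) (s : Fin n → ℝ),
    F ∈ Matrix.unitaryGroup (Fin n) ℂ ∧ U ∈ Matrix.unitaryGroup (Fin n) ℂ ∧ (∀ i, 0 < s i) ∧
    Antitone s ∧ A.1 = F * Matrix.diagonal (fun i => (s i : ℂ)) * star U := by
  let T : EuclideanSpace ℂ (Fin n) →ₗ[ℂ] EuclideanSpace ℂ (Fin n) := Matrix.toLpLin 2 2 A.1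
  have hT : ∀ v i, T v i = ∑ j, A.1 i j * v j := fun v i => rfl
  have hinj : ∀ v, T v = 0 → v = 0 := by
    intro v hv
    have h1 : A.1 *ᵥ v.ofLp = 0 := congrArg WithLp.ofLp hv
    have h2 : A.1.adjugate *ᵥ (A.1 *ᵥ v.ofLp) = v.ofLp := by
      rw [Matrix.mulVec_mulVec, Matrix.adjugate_mul, A.2, one_smul, Matrix.one_mulVec]
    rw [h1, Matrix.mulVec_zero] at h2
    ext i
    exact (congrFun h2 i).symm
  have hn : Module.finrank ℂ (EuclideanSpace ℂ (Fin n)) = n := finrank_euclideanSpace_fin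
  set u := T.isSymmetric_adjoint_comp_self.eigenvectorBasis hn with hu
  set lam := T.isSymmetric_adjoint_comp_self.eigenvalues hn with hlam
  have key : ∀ i j, inner ℂ (T (u i)) (T (u j)) = (lam j : ℂ) * inner ℂ (u i) (u j) := by
    intro i j
    rw [← LinearMap.adjoint_inner_right, ← LinearMap.comp_apply, hu,
      LinearMap.IsSymmetric.apply_eigenvectorBasis, inner_smul_right]
    rfl
  have hnorm : ∀ i, ‖T (u i)‖ ^ 2 = lam i := by
    intro i
    have h := key i i
    rw [inner_self_eq_norm_sq_to_K, inner_self_eq_norm_sq_to_K, u.orthonormal.1 i] at h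
    have h3 := congrArg Complex.re h
    simpa [← Complex.ofReal_pow] using h3
  have hpos : ∀ i, 0 < ‖T (u i)‖ := by
    intro i
    rw [norm_pos_iff]
    intro h
    have h0 := hinj _ h
    have h1 := u.orthonormal.1 i
    rw [h0, norm_zero] at h1
    exact zero_ne_one h1
  let f : Fin n → EuclideanSpace ℂ (Fin n) := fun i => ((‖T (u i)‖ : ℂ)⁻¹) • T (u i)
  have hf : Orthonormal ℂ f := by
    refine ⟨fun i => ?_, fun i j hij => ?_⟩
    · rw [norm_smul, norm_inv, Complex.norm_real, norm_norm, inv_mul_cancel₀ (hpos i).ne']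
    · simp [f, inner_smul_left, inner_smul_right, key, u.orthonormal.2 hij]
  have hU := mem_unitaryGroup_of_orthonormal u.orthonormal
  refine ⟨_, _, fun i => ‖T (u i)‖, mem_unitaryGroup_of_orthonormal hf, hU, hpos, ?_, ?_⟩
  · intro i j hij
    have h := T.isSymmetric_adjoint_comp_self.eigenvalues_antitone hn hij
    rw [← hlam, ← hnorm, ← hnorm] at h
    exact (pow_le_pow_iff_left₀ (norm_nonneg _) (norm_nonneg _) two_ne_zero).1 h
  · have h1 : A.1 * Matrix.of (fun i j => u j i)
        = Matrix.of (fun i j => f j i) * Matrix.diagonal (fun i => (‖T (u i)‖ : ℂ)) := by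
      ext i j
      rw [Matrix.mul_apply, Matrix.mul_diagonal]
      have h0 : (‖T (u j)‖ : ℂ) ≠ 0 := by exact_mod_cast (hpos j).ne'
      change _ = (‖T (u j)‖ : ℂ)⁻¹ * T (u j) i * _
      rw [mul_right_comm, inv_mul_cancel₀ h0, one_mul, hT]
      rfl
    rw [← h1, Matrix.mul_assoc, Matrix.mem_unitaryGroup_iff.1 hU, Matrix.mul_one]

/-- The Cartan decomposition `A = U exp(h) V`. -/
theorem exists_cartan (hn : 1 ≤ n) (A : SL n) :
    ∃ (U V : SU n) (h : Fin n → ℝ) (hs : ∑ i, h i = 0), Antitone h ∧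
      A = toSL n U * expSL h hs 1 * toSL n V := by
  obtain ⟨F, U, s, hF, hU, hpos, hanti, hA⟩ := exists_svd A
  have hU' : star U ∈ Matrix.unitaryGroup (Fin n) ℂ := Unitary.star_mem hU
  have hdet : F.det * ((∏ i, s i : ℝ) : ℂ) * (star U).det = 1 := by
    have := A.2
    rw [hA, Matrix.det_mul, Matrix.det_mul, Matrix.det_diagonal] at this
    rw [← this]
    push_cast
    rfl
  have hprod : ∏ i, s i = 1 := by
    have h1 := congrArg norm hdet
    rw [norm_mul, norm_mul, norm_det_of_mem_unitaryGroup hF, norm_det_of_mem_unitaryGroup hU',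
      Complex.norm_real, Real.norm_of_nonneg (Finset.prod_nonneg fun i _ => (hpos i).le),
      norm_one] at h1
    simpa using h1
  rw [hprod, Complex.ofReal_one, mul_one] at hdet
  set c := (star U).det with hc
  have hcn : ‖c‖ = 1 := norm_det_of_mem_unitaryGroup hU'
  have hc0 : c ≠ 0 := norm_ne_zero_iff.1 (by rw [hcn]; exact one_ne_zero)
  -- The singular values have product one, so the determinants of the two unitary factors are
  -- inverse phases. Putting `c` and `c⁻¹` in the first diagonal entry makes both factors special,
  -- and the two corrections cancel through the diagonal matrix.
  have hphase : ∀ a : ℂ, ‖a‖ = 1 → (Matrix.diagonal (Function.update 1 ⟨0, hn⟩ a) :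
      Matrix (Fin n) (Fin n) ℂ) ∈ Matrix.unitaryGroup (Fin n) ℂ ∧
      (Matrix.diagonal (Function.update 1 ⟨0, hn⟩ a) : Matrix (Fin n) (Fin n) ℂ).det = a := by
    intro a ha
    refine ⟨?_, ?_⟩
    · rw [Matrix.mem_unitaryGroup_iff, Matrix.star_eq_conjTranspose, Matrix.diagonal_conjTranspose,
        Matrix.diagonal_mul_diagonal, ← Matrix.diagonal_one]
      congr 1
      funext i
      by_cases hi : i = ⟨0, hn⟩
      · subst hi; simp [Complex.mul_conj', ha]
      · simp [Function.update_of_ne hi]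
    · rw [Matrix.det_diagonal, Finset.prod_update_of_mem (Finset.mem_univ _)]
      simp
  obtain ⟨hP1, hP2⟩ := hphase c hcn
  obtain ⟨hQ1, hQ2⟩ := hphase c⁻¹ (by rw [norm_inv, hcn, inv_one])
  set P : Matrix (Fin n) (Fin n) ℂ := Matrix.diagonal (Function.update 1 ⟨0, hn⟩ c) with hP
  set Q : Matrix (Fin n) (Fin n) ℂ := Matrix.diagonal (Function.update 1 ⟨0, hn⟩ c⁻¹) with hQ
  have hlog : ∀ i, Real.exp (Real.log (s i)) = s i := fun i => Real.exp_log (hpos i)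
  refine ⟨⟨F * P, ?_⟩, ⟨Q * star U, ?_⟩, fun i => Real.log (s i), ?_, ?_, ?_⟩
  · rw [Matrix.mem_specialUnitaryGroup_iff, Matrix.det_mul, hP2]
    exact ⟨mul_mem hF hP1, hdet⟩
  · rw [Matrix.mem_specialUnitaryGroup_iff, Matrix.det_mul, hQ2]
    exact ⟨mul_mem hQ1 hU', inv_mul_cancel₀ hc0⟩
  · rw [← Real.log_prod fun i _ => (hpos i).ne', hprod, Real.log_one]
  · exact fun i j hij => Real.log_le_log (hpos j) (hanti hij)
  · apply Subtype.ext
    rw [Matrix.SpecialLinearGroup.coe_mul, Matrix.SpecialLinearGroup.coe_mul, hA]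
    simp only [coe_toSL, coe_expSL, one_mul, ← Complex.ofReal_exp, hlog]
    have h1 : P * Matrix.diagonal (fun i => (s i : ℂ)) * Q
        = Matrix.diagonal (fun i => (s i : ℂ)) := by
      rw [hP, hQ, Matrix.diagonal_mul_diagonal, Matrix.diagonal_mul_diagonal]
      congr 1
      funext i
      by_cases hi : i = ⟨0, hn⟩
      · subst hi
        rw [Function.update_self, Function.update_self, mul_right_comm, mul_inv_cancel₀ hc0,
          one_mul]
      · simp [Function.update_of_ne hi]
    conv_lhs => rw [← h1]
    simp only [Matrix.mul_assoc]

end Cartan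

/-! ### Holomorphic functions on `SL(n, ℂ)` and the unitarian trick. -/

section Holomorphic

variable {n : ℕ} {E F : Type*} [NormedAddCommGroup E] [NormedSpace ℂ E]
  [NormedAddCommGroup F] [NormedSpace ℂ F]

theorem IsHolomorphic.clm_comp {f : SL n → E} (hf : IsHolomorphic f) (L : E →L[ℂ] F) :
    IsHolomorphic fun x => L (f x) := by
  intro x
  obtain ⟨U, F, hU, hx, hF, h⟩ := hf x
  exact ⟨U, fun y => L (F y), hU, hx, L.differentiable.comp_differentiableOn hF,
    fun y hy => congrArg L (h y hy)⟩

theorem IsHolomorphic.add {f g : SL n → E} (hf : IsHolomorphic f) (hg : IsHolomorphic g) :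
    IsHolomorphic fun x => f x + g x := by
  intro x
  obtain ⟨U, F, hU, hx, hF, h⟩ := hf x
  obtain ⟨U', F', hU', hx', hF', h'⟩ := hg x
  exact ⟨U ∩ U', fun y => F y + F' y, hU.inter hU', ⟨hx, hx'⟩,
    (hF.mono Set.inter_subset_left).add (hF'.mono Set.inter_subset_right),
    fun y hy => congrArg₂ (· + ·) (h y hy.1) (h' y hy.2)⟩

theorem IsHolomorphic.smul {f : SL n → ℂ} {g : SL n → E} (hf : IsHolomorphic f)
    (hg : IsHolomorphic g) : IsHolomorphic fun x => f x • g x := by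
  intro x
  obtain ⟨U, F, hU, hx, hF, h⟩ := hf x
  obtain ⟨U', F', hU', hx', hF', h'⟩ := hg x
  exact ⟨U ∩ U', fun y => F y • F' y, hU.inter hU', ⟨hx, hx'⟩,
    (hF.mono Set.inter_subset_left).smul (hF'.mono Set.inter_subset_right),
    fun y hy => congrArg₂ (· • ·) (h y hy.1) (h' y hy.2)⟩

theorem IsHolomorphic.mul {f g : SL n → ℂ} (hf : IsHolomorphic f)
    (hg : IsHolomorphic g) : IsHolomorphic fun x => f x * g x := hf.smul hg

theorem isHolomorphic_const (c : E) : IsHolomorphic fun _ : SL n => c := fun _ =>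
  ⟨Set.univ, fun _ => c, isOpen_univ, trivial, differentiableOn_const c, fun _ _ => rfl⟩

theorem isHolomorphic_entry (i j : Fin n) : IsHolomorphic fun x : SL n => x.1 i j := fun _ =>
  ⟨Set.univ, fun M => M i j, isOpen_univ, trivial, by fun_prop, fun _ _ => rfl⟩

theorem isHolomorphic_sum {ι : Type*} (s : Finset ι) {f : ι → SL n → E}
    (hf : ∀ i, IsHolomorphic (f i)) : IsHolomorphic fun x => ∑ i ∈ s, f i x := by
  classical
  induction s using Finset.induction_on with
  | empty => simpa using isHolomorphic_const (0 : E)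
  | insert a s ha ih => simpa [Finset.sum_insert ha] using (hf a).add ih

theorem isHolomorphic_prod {ι : Type*} (s : Finset ι) {f : ι → SL n → ℂ}
    (hf : ∀ i, IsHolomorphic (f i)) : IsHolomorphic fun x => ∏ i ∈ s, f i x := by
  classical
  induction s using Finset.induction_on with
  | empty => simpa using isHolomorphic_const (1 : ℂ)
  | insert a s ha ih => simpa [Finset.prod_insert ha] using (hf a).mul ih

theorem IsHolomorphic.comp_map {f : SL n → E} (hf : IsHolomorphic f) {m : SL n → SL n}
    {M : (Fin n → Fin n → ℂ) → (Fin n → Fin n → ℂ)} (hM : Differentiable ℂ M)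
    (h : ∀ x : SL n, M (fun i j => x.1 i j) = fun i j => (m x).1 i j) :
    IsHolomorphic fun x => f (m x) := by
  intro x
  obtain ⟨U, F, hU, hx, hF, h'⟩ := hf (m x)
  refine ⟨M ⁻¹' U, F ∘ M, hU.preimage hM.continuous, by rw [Set.mem_preimage, h]; exact hx,
    hF.comp hM.differentiableOn (Set.mapsTo_preimage M U), fun y hy => ?_⟩
  rw [Set.mem_preimage, h] at hy
  rw [Function.comp_apply, h, h' _ hy]

theorem differentiable_finset_prod {ι : Type*} {s : Finset ι} {f : ι → E → ℂ}
    (hf : ∀ i, Differentiable ℂ (f i)) : Differentiable ℂ fun x => ∏ i ∈ s, f i x := by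
  classical
  induction s using Finset.induction_on with
  | empty => simp
  | insert a s ha ih =>
    simp only [Finset.prod_insert ha]
    exact (hf a).mul ih

/-- On `SL(n, ℂ)` inversion is the adjugate, which is polynomial on all matrices and so extends off
the group. -/
theorem IsHolomorphic.comp_inv {f : SL n → E} (hf : IsHolomorphic f) :
    IsHolomorphic fun x => f x⁻¹ := by
  refine hf.comp_map (m := fun x => x⁻¹)
    (M := fun A => fun i j => (Matrix.of A).adjugate i j) ?_ fun x => ?_
  · refine differentiable_pi.2 fun i => differentiable_pi.2 fun j => ?_
    simp only [Matrix.adjugate_apply, Matrix.det_apply]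
    refine Differentiable.fun_sum fun σ _ => Differentiable.const_smul ?_ _
    refine differentiable_finset_prod fun k => ?_
    by_cases hk : σ k = j
    · simp [Matrix.updateRow_apply, hk]
    · simp only [Matrix.updateRow_apply, hk, if_false, Matrix.of_apply]
      fun_prop
  · rw [Matrix.SpecialLinearGroup.coe_inv]
    rfl

theorem IsHolomorphic.comp_mul_left {f : SL n → E} (hf : IsHolomorphic f) (a : SL n) :
    IsHolomorphic fun x => f (a * x) := by
  refine hf.comp_map (M := fun A => fun i j => ∑ k, a.1 i k * A k j) (by fun_prop) fun x => ?_
  rw [Matrix.SpecialLinearGroup.coe_mul]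
  rfl

theorem IsHolomorphic.comp_mul_right {f : SL n → E} (hf : IsHolomorphic f) (a : SL n) :
    IsHolomorphic fun x => f (x * a) := by
  refine hf.comp_map (M := fun A => fun i j => ∑ k, A i k * a.1 k j) (by fun_prop) fun x => ?_
  rw [Matrix.SpecialLinearGroup.coe_mul]
  rfl

theorem IsHolomorphic.differentiable_comp_expSL {f : SL n → E} (hf : IsHolomorphic f)
    (h : Fin n → ℝ) (hs : ∑ i, h i = 0) : Differentiable ℂ fun z => f (expSL h hs z) := by
  intro z
  obtain ⟨U, F, hU, hx, hF, h'⟩ := hf (expSL h hs z)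
  have hd : Differentiable ℂ fun z => fun i j => (expSL h hs z).1 i j := by
    refine differentiable_pi.2 fun i => differentiable_pi.2 fun j => ?_
    simp only [coe_expSL, Matrix.diagonal_apply]
    split_ifs <;> fun_prop
  have h1 : DifferentiableAt ℂ (fun z => F fun i j => (expSL h hs z).1 i j) z :=
    DifferentiableAt.comp z (hF.differentiableAt (hU.mem_nhds hx)) (hd z)
  refine h1.congr_of_eventuallyEq ?_
  filter_upwards [hd.continuous.continuousAt.preimage_mem_nhds (hU.mem_nhds hx)] with w hw
  exact (h' _ hw).symm

/-- The identity theorem: points of the imaginary axis accumulate at `0`. -/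
theorem eq_of_eq_imaginary {f g : ℂ → ℂ} (hf : Differentiable ℂ f) (hg : Differentiable ℂ g)
    (h : ∀ t : ℝ, f (t * Complex.I) = g (t * Complex.I)) : f = g := by
  have hfa : AnalyticOnNhd ℂ f Set.univ := fun z _ => hf.analyticAt z
  have hga : AnalyticOnNhd ℂ g Set.univ := fun z _ => hg.analyticAt z
  refine hfa.eq_of_frequently_eq hga (z₀ := 0) ?_
  have ht : Filter.Tendsto (fun t : ℝ => (t : ℂ) * Complex.I) (nhdsWithin 0 {0}ᶜ)
      (nhdsWithin 0 {0}ᶜ) := by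
    refine tendsto_nhdsWithin_of_tendsto_nhds_of_eventually_within _ ?_ ?_
    · have : Continuous fun t : ℝ => (t : ℂ) * Complex.I := by fun_prop
      have h2 := this.tendsto 0
      simp only [Complex.ofReal_zero, zero_mul] at h2
      exact h2.mono_left nhdsWithin_le_nhds
    · filter_upwards [self_mem_nhdsWithin] with t ht
      simpa using ht
  exact ht.frequently (Filter.Eventually.frequently (Filter.Eventually.of_forall h))

/-- A holomorphic function on `SL(n, ℂ)` is determined by its restriction to `SU(n)`. -/
theorem IsHolomorphic.ext (hn : 1 ≤ n) {f g : SL n → ℂ} (hf : IsHolomorphic f)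
    (hg : IsHolomorphic g) (h : ∀ u : SU n, f (toSL n u) = g (toSL n u)) (x : SL n) :
    f x = g x := by
  obtain ⟨U, V, a, hs, -, rfl⟩ := exists_cartan hn x
  -- For fixed `U`, `V` and exponent `a`, the curve `U exp(z a) V` stays in `SU(n)` for imaginary
  -- `z` and reaches the given matrix at `z = 1`.
  have hd : ∀ {f : SL n → ℂ}, IsHolomorphic f →
      Differentiable ℂ fun z => f (toSL n U * expSL a hs z * toSL n V) := fun hf =>
    ((hf.comp_mul_right (toSL n V)).comp_mul_left (toSL n U)).differentiable_comp_expSL a hs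
  refine congrFun (eq_of_eq_imaginary (hd hf) (hd hg) fun t => ?_) 1
  obtain ⟨g, hg⟩ := exists_toSL_eq_expSL a hs t
  rw [← hg, ← map_mul, ← map_mul, h]

variable {V : Type*} [NormedAddCommGroup V] [InnerProductSpace ℂ V] [FiniteDimensional ℂ V]

theorem isHolomorphic_inner {σ : SL n → V →ₗ[ℂ] V}
    (h : IsHolomorphic fun x => LinearMap.toContinuousLinearMap (σ x)) (v w : V) :
    IsHolomorphic fun x => inner ℂ w (σ x v) :=
  h.clm_comp ((innerSL ℂ w).comp (ContinuousLinearMap.apply ℂ V v))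

theorem isHolomorphic_of_inner {ι : Type*} [Fintype ι] (b : OrthonormalBasis ι ℂ V)
    {σ : SL n → V →ₗ[ℂ] V} (h : ∀ i j, IsHolomorphic fun x => inner ℂ (b i) (σ x (b j))) :
    IsHolomorphic fun x => LinearMap.toContinuousLinearMap (σ x) := by
  have h1 : (fun x => LinearMap.toContinuousLinearMap (σ x)) = fun x => ∑ i, ∑ j,
      inner ℂ (b i) (σ x (b j)) • ((innerSL ℂ (b j)).smulRight (b i) : V →L[ℂ] V) := by
    funext x
    refine ContinuousLinearMap.ext fun v => ?_
    simp only [_root_.sum_apply, _root_.smul_apply,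
      ContinuousLinearMap.smulRight_apply, innerSL_apply_apply, LinearMap.coe_toContinuousLinearMap']
    conv_lhs => rw [← b.sum_repr' v, map_sum]
    simp only [map_smul]
    rw [Finset.sum_comm]
    refine Finset.sum_congr rfl fun j _ => ?_
    conv_lhs => rw [← b.sum_repr' (σ x (b j)), Finset.smul_sum]
    exact Finset.sum_congr rfl fun i _ => smul_comm _ _ _
  rw [h1]
  exact isHolomorphic_sum _ fun i => isHolomorphic_sum _ fun j =>
    (h i j).smul (isHolomorphic_const _)

theorem IsHolomorphicExtension.unique (hn : 1 ≤ n) {π : Representation ℂ (SU n) V}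
    {σ τ : Representation ℂ (SL n) V} (hσ : IsHolomorphicExtension π σ)
    (hτ : IsHolomorphicExtension π τ) : σ = τ := by
  ext x v
  refine ext_inner_left ℂ fun w => ?_
  exact (isHolomorphic_inner hσ.1 v w).ext hn (isHolomorphic_inner hτ.1 v w)
    (fun u => by rw [hσ.2, hτ.2]) x

end Holomorphic

end BeurlingFourier

end

noncomputable section

set_option linter.unusedSectionVars false

open MeasureTheory Matrix
open scoped TensorProduct

namespace BeurlingFourier

/-! ### The representations `π_a` -/

section TensorRep

variable {n : ℕ} {a : Fin (n - 1) → ℕ}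

theorem tensorRep_apply (x : SL n) (v : TensorSpace n a) (I : Box n a → Fin n) :
    tensorRep n a x v I = ∑ J, (∏ b, x.1 (I b) (J b)) * v J := rfl

theorem coe_hwRepC (x : SL n) (v : HWSpace n a) :
    (hwRepC n a x v : TensorSpace n a) = tensorRep n a x v := rfl

theorem inner_hwRepC (x : SL n) (v w : HWSpace n a) :
    inner ℂ w (hwRepC n a x v)
      = ∑ I, ∑ J, (v.1 J * star (w.1 I)) * ∏ b, x.1 (I b) (J b) := by
  rw [Submodule.coe_inner, coe_hwRepC, PiLp.inner_apply]
  refine Finset.sum_congr rfl fun I _ => ?_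
  rw [tensorRep_apply, RCLike.inner_apply, Finset.sum_mul]
  refine Finset.sum_congr rfl fun J _ => ?_
  rw [starRingEnd_apply]
  ring

theorem isHolomorphicExtension_hwRepC :
    IsHolomorphicExtension (V := HWSpace n a) (hwRep n a) (hwRepC n a) := by
  refine ⟨isHolomorphic_of_inner (stdOrthonormalBasis ℂ (HWSpace n a)) fun i j => ?_,
    fun g => rfl⟩
  simp only [inner_hwRepC]
  exact isHolomorphic_sum _ fun I => isHolomorphic_sum _ fun J =>
    (isHolomorphic_const _).mul (isHolomorphic_prod _ fun b => isHolomorphic_entry _ _)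

theorem norm_tensorRep_toSL (g : SU n) (v : TensorSpace n a) :
    ‖tensorRep n a (toSL n g) v‖ = ‖v‖ := by
  have hstar : star (tensorMatrix n a g.1) * tensorMatrix n a g.1 = 1 := by
    have h1 : star (tensorMatrix n a g.1) = tensorMatrix n a (star g.1) := by
      ext I J
      simp [tensorMatrix, Matrix.star_apply]
    rw [h1, ← map_mul, SU_star_mul, map_one]
  have h : inner ℂ (tensorRep n a (toSL n g) v) (tensorRep n a (toSL n g) v) = inner ℂ v v := by
    rw [EuclideanSpace.inner_eq_star_dotProduct, EuclideanSpace.inner_eq_star_dotProduct]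
    change (tensorMatrix n a g.1 *ᵥ v.ofLp) ⬝ᵥ star (tensorMatrix n a g.1 *ᵥ v.ofLp) = _
    rw [Matrix.star_mulVec, dotProduct_comm, ← Matrix.dotProduct_mulVec, Matrix.mulVec_mulVec,
      ← Matrix.star_eq_conjTranspose, hstar, Matrix.one_mulVec, dotProduct_comm]
  rw [inner_self_eq_norm_sq_to_K, inner_self_eq_norm_sq_to_K] at h
  have h3 := congrArg Complex.re h
  exact (pow_left_inj₀ (norm_nonneg _) (norm_nonneg _) two_ne_zero).1
    (by simpa [← Complex.ofReal_pow] using h3)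

theorem norm_hwRepC_toSL (g : SU n) (v : HWSpace n a) : ‖hwRepC n a (toSL n g) v‖ = ‖v‖ :=
  norm_tensorRep_toSL g v.1

theorem isContUnitary_hwRep : IsContUnitary (H := HWSpace n a) (hwRep n a) := by
  refine ⟨norm_hwRepC_toSL, fun v => Continuous.subtype_mk ?_ _⟩
  refine (PiLp.continuous_toLp 2 _).comp (continuous_pi fun I => ?_)
  change Continuous fun g : SU n => ∑ J, (∏ b, g.1 (I b) (J b)) * v.1 J
  refine continuous_finsetSum _ fun J _ => Continuous.mul (continuous_finsetProd _ fun b _ => ?_)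
    continuous_const
  exact (continuous_subtype_val.matrix_elem _ _)

/-- Multiplication by unitary operators does not change the norm. -/
theorem norm_mul_isometry {V : Type*} [NormedAddCommGroup V] [InnerProductSpace ℂ V]
    [FiniteDimensional ℂ V] {σ : Representation ℂ (SL n) V}
    (hσ : ∀ (g : SU n) v, ‖σ (toSL n g) v‖ = ‖v‖) (U W : SU n) (A : SL n) :
    ‖LinearMap.toContinuousLinearMap (σ (toSL n U * A * toSL n W))‖
      = ‖LinearMap.toContinuousLinearMap (σ A)‖ := by
  have key : ∀ (U W : SU n) (A : SL n),
      ‖LinearMap.toContinuousLinearMap (σ (toSL n U * A * toSL n W))‖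
        ≤ ‖LinearMap.toContinuousLinearMap (σ A)‖ := by
    intro U W A
    refine ContinuousLinearMap.opNorm_le_bound _ (norm_nonneg _) fun v => ?_
    rw [LinearMap.coe_toContinuousLinearMap', map_mul, map_mul, Module.End.mul_apply,
      Module.End.mul_apply, hσ, ← hσ W v]
    exact (LinearMap.toContinuousLinearMap (σ A)).le_opNorm _
  refine le_antisymm (key U W A) ?_
  have h := key U⁻¹ W⁻¹ (toSL n U * A * toSL n W)
  have h2 : toSL n U⁻¹ * (toSL n U * A * toSL n W) * toSL n W⁻¹ = A := by
    rw [map_inv, map_inv]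
    group
  rwa [h2] at h

/-! #### Antisymmetry in the columns -/

theorem swap_apply_ne_column {k k' : Fin (n - 1)} {c : Fin (a k)} {c' : Fin (a k')}
    (h : (⟨k', c'⟩ : Σ k, Fin (a k)) ≠ ⟨k, c⟩) (r r' : Fin (k.1 + 1)) (s : Fin (k'.1 + 1)) :
    Equiv.swap (⟨k, c, r⟩ : Box n a) ⟨k, c, r'⟩ ⟨k', c', s⟩ = ⟨k', c', s⟩ := by
  refine Equiv.swap_apply_of_ne_of_ne (fun h' => h ?_) (fun h' => h ?_) <;>
    exact congrArg (fun b : Box n a => (⟨b.1, b.2.1⟩ : Σ k, Fin (a k))) h'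

theorem swap_apply_column {k : Fin (n - 1)} (c : Fin (a k)) (r r' s : Fin (k.1 + 1)) :
    Equiv.swap (⟨k, c, r⟩ : Box n a) ⟨k, c, r'⟩ ⟨k, c, s⟩ = ⟨k, c, Equiv.swap r r' s⟩ := by
  have hinj : Function.Injective fun s : Fin (k.1 + 1) => (⟨k, c, s⟩ : Box n a) := by
    intro s s' h
    simpa using h
  exact hinj.swap_apply r r' s

theorem highestWeightVector_apply (I : Box n a → Fin n) :
    highestWeightVector n a I = ∏ x : (Σ k, Fin (a k)), Matrix.det (Matrix.of fun r s :
      Fin (x.1.1 + 1) => if (I ⟨x.1, x.2, r⟩).val = s.val then (1 : ℂ) else 0) := by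
  rw [Fintype.prod_sigma]
  rfl

theorem highestWeightVector_swap {k : Fin (n - 1)} (c : Fin (a k)) {r r' : Fin (k.1 + 1)}
    (hr : r ≠ r') (I : Box n a → Fin n) :
    highestWeightVector n a (I ∘ Equiv.swap (⟨k, c, r⟩ : Box n a) ⟨k, c, r'⟩)
      = - highestWeightVector n a I := by
  rw [highestWeightVector_apply, highestWeightVector_apply]
  rw [← Finset.mul_prod_erase Finset.univ _ (Finset.mem_univ ⟨k, c⟩),
    ← Finset.mul_prod_erase Finset.univ _ (Finset.mem_univ ⟨k, c⟩), ← neg_mul]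
  congr 1
  · simp only [Function.comp_apply, swap_apply_column]
    have h := Matrix.det_permute (Equiv.swap r r') (Matrix.of fun r s : Fin (k.1 + 1) =>
      if (I ⟨k, c, r⟩).val = s.val then (1 : ℂ) else 0)
    rw [Equiv.Perm.sign_swap hr] at h
    exact h.trans (by simp)
  · refine Finset.prod_congr rfl fun x hx => ?_
    simp only [Function.comp_apply, swap_apply_ne_column (Finset.ne_of_mem_erase hx)]

/-- Permutations of the tensor factors commute with `x ⊗ ⋯ ⊗ x`; this carries the antisymmetry of
the highest weight vector over to the whole orbit. -/
theorem tensorRep_comp_perm (x : SL n) (v : TensorSpace n a) (τ : Equiv.Perm (Box n a))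
    (I : Box n a → Fin n) :
    tensorRep n a x v (I ∘ τ) = ∑ J, (∏ b, x.1 (I b) (J b)) * v (J ∘ τ) := by
  rw [tensorRep_apply, ← Equiv.sum_comp (τ.symm.arrowCongr (Equiv.refl (Fin n)))]
  refine Finset.sum_congr rfl fun J _ => ?_
  have h : τ.symm.arrowCongr (Equiv.refl (Fin n)) J = J ∘ τ := by ext; rfl
  rw [h]
  congr 1
  exact Equiv.prod_comp τ fun b => x.1 (I b) (J b)

/-- The elements of `π_a` are antisymmetric in each column. -/
theorem hwSpace_swap (v : HWSpace n a) {k : Fin (n - 1)} (c : Fin (a k)) {r r' : Fin (k.1 + 1)}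
    (hr : r ≠ r') (I : Box n a → Fin n) :
    v.1 (I ∘ Equiv.swap (⟨k, c, r⟩ : Box n a) ⟨k, c, r'⟩) = - v.1 I := by
  obtain ⟨v, hv⟩ := v
  induction hv using Submodule.span_induction generalizing I with
  | mem v hv =>
    obtain ⟨x, rfl⟩ := hv
    change tensorRep n a x _ _ = - tensorRep n a x _ _
    rw [tensorRep_comp_perm, tensorRep_apply, ← Finset.sum_neg_distrib]
    exact Finset.sum_congr rfl fun J _ => by rw [highestWeightVector_swap c hr, mul_neg]
  | zero => exact neg_zero.symm
  | add v w _ _ hv hw =>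
    change v _ + w _ = -(v _ + w _)
    have h1 := hv I
    have h2 := hw I
    dsimp only at h1 h2
    rw [h1, h2, neg_add]
  | smul z v _ hv =>
    change z • v _ = -(z • v _)
    have h1 := hv I
    dsimp only at h1
    rw [h1, smul_neg]

/-- Swapping two equal entries of a column fixes the filling but changes the sign of the coordinate.
-/
theorem hwSpace_injective (v : HWSpace n a) {I : Box n a → Fin n} (hI : v.1 I ≠ 0)
    {k : Fin (n - 1)} (c : Fin (a k)) : Function.Injective fun r => I ⟨k, c, r⟩ := by
  intro r r' h
  by_contra hr
  have h1 := hwSpace_swap v c hr I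
  have h2 : I ∘ Equiv.swap (⟨k, c, r⟩ : Box n a) ⟨k, c, r'⟩ = I := by
    funext b
    rw [Function.comp_apply, Equiv.swap_apply_def]
    split_ifs with h3 h4
    · rw [h3]; exact h.symm
    · rw [h4]; exact h
    · rfl
  rw [h2] at h1
  exact hI (self_eq_neg.1 h1)

/-! #### Diagonal matrices and the highest weight vector -/

theorem tensorRep_diagonal {D : SL n} {x : Fin n → ℂ} (hD : D.1 = Matrix.diagonal x)
    (v : TensorSpace n a) (I : Box n a → Fin n) :
    tensorRep n a D v I = (∏ b, x (I b)) * v I := by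
  rw [tensorRep_apply, Finset.sum_eq_single I]
  · rw [hD]
    simp
  · intro J _ hJ
    obtain ⟨b, hb⟩ := Function.ne_iff.1 hJ
    rw [Finset.prod_eq_zero (Finset.mem_univ b), zero_mul]
    rw [hD, Matrix.diagonal_apply_ne _ hb.symm]
  · simp

/-- The eigenvalue of `diag(x)` on the highest weight vector. -/
def weight (a : Fin (n - 1) → ℕ) (x : Fin n → ℂ) : ℂ :=
  ∏ k : Fin (n - 1), (∏ i with i.val ≤ k.val, x i) ^ a k

theorem prod_box {M : Type*} [CommMonoid M] (f : Box n a → M) :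
    ∏ b, f b = ∏ k, ∏ c, ∏ r, f ⟨k, c, r⟩ := by
  rw [Fintype.prod_sigma]
  exact Finset.prod_congr rfl fun k _ => Fintype.prod_prod_type _

theorem prod_filter_le {M : Type*} [CommMonoid M] (k : Fin (n - 1)) (f : Fin n → M) :
    ∏ i with i.val ≤ k.val, f i = ∏ r : Fin (k.1 + 1), f ⟨r.1, by omega⟩ := by
  symm
  refine Finset.prod_bij (fun r _ => ⟨r.1, by omega⟩) ?_ ?_ ?_ ?_
  · intro r _
    simp only [Finset.mem_filter, Finset.mem_univ, true_and]
    omega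
  · intro r _ s _ h
    exact Fin.ext (by simpa using h)
  · intro i hi
    simp only [Finset.mem_filter, Finset.mem_univ, true_and] at hi
    exact ⟨⟨i.1, by omega⟩, Finset.mem_univ _, rfl⟩
  · intro r _
    rfl

/-- A non-zero determinant forces the entries of a column of height `k + 1` to be a permutation of
`0, …, k`. -/
theorem prod_eq_weight_of_ne_zero (x : Fin n → ℂ) {I : Box n a → Fin n}
    (hI : highestWeightVector n a I ≠ 0) : ∏ b, x (I b) = weight a x := by
  rw [prod_box, weight]
  refine Finset.prod_congr rfl fun k _ => ?_
  conv_rhs => rw [← Fintype.card_fin (a k), ← Finset.card_univ, ← Finset.prod_const]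
  refine Finset.prod_congr rfl fun c _ => ?_
  rw [prod_filter_le]
  rw [highestWeightVector_apply] at hI
  have hdet := Finset.prod_ne_zero_iff.1 hI ⟨k, c⟩ (Finset.mem_univ _)
  dsimp only at hdet
  have hlt : ∀ r, (I ⟨k, c, r⟩).val < k.1 + 1 := by
    intro r
    by_contra h
    refine hdet (Matrix.det_eq_zero_of_row_eq_zero r fun s => ?_)
    rw [Matrix.of_apply, if_neg (by omega)]
  have hinj : Function.Injective fun r => (⟨(I ⟨k, c, r⟩).val, hlt r⟩ : Fin (k.1 + 1)) := by
    intro r r' h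
    by_contra hr
    refine hdet (Matrix.det_zero_of_row_eq hr ?_)
    have h' : (I ⟨k, c, r⟩).val = (I ⟨k, c, r'⟩).val :=
      congrArg (fun r : Fin (k.1 + 1) => r.val) h
    funext s
    simp only [Matrix.of_apply, h']
  exact (Equiv.ofBijective _ (Finite.injective_iff_bijective.1 hinj)).prod_comp
    fun r : Fin (k.1 + 1) => x ⟨r.1, by omega⟩

variable (n a) in
/-- The filling with entry `r` in row `r`. -/
def rowFilling (b : Box n a) : Fin n := ⟨b.2.2.1, by omega⟩

theorem highestWeightVector_rowFilling : highestWeightVector n a (rowFilling n a) = 1 := by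
  rw [highestWeightVector_apply]
  refine Finset.prod_eq_one fun x _ => ?_
  convert Matrix.det_one (R := ℂ) (n := Fin (x.1.1 + 1)) using 2
  ext r s
  rw [Matrix.of_apply, Matrix.one_apply]
  by_cases h : r = s
  · rw [if_pos h, if_pos (by rw [h]; rfl)]
  · rw [if_neg h]
    exact if_neg fun h' => h (Fin.ext h')

variable (n a) in
/-- The highest weight vector as an element of the space of `π_a`. -/
def hwVec : HWSpace n a := ⟨highestWeightVector n a, Submodule.subset_span ⟨1, by
  simp only [map_one, Module.End.one_apply]⟩⟩

theorem hwVec_ne_zero : hwVec n a ≠ 0 := by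
  intro h
  have h1 : highestWeightVector n a (rowFilling n a) = 0 := by
    have := congrArg (fun v : HWSpace n a => v.1 (rowFilling n a)) h
    simpa [hwVec] using this
  rw [highestWeightVector_rowFilling] at h1
  exact one_ne_zero h1

theorem hwRepC_hwVec {D : SL n} {x : Fin n → ℂ} (hD : D.1 = Matrix.diagonal x) :
    hwRepC n a D (hwVec n a) = weight a x • hwVec n a := by
  refine Subtype.ext (PiLp.ext fun I => ?_)
  rw [coe_hwRepC, tensorRep_diagonal hD]
  change _ * highestWeightVector n a I = weight a x * highestWeightVector n a I
  by_cases hI : highestWeightVector n a I = 0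
  · rw [hI, mul_zero, mul_zero]
  · rw [prod_eq_weight_of_ne_zero x hI]

theorem Fin.le_of_strictMono {m : ℕ} {f : Fin m → Fin n} (hf : StrictMono f) (i : Fin m) :
    i.val ≤ (f i).val := by
  obtain ⟨i, hi⟩ := i
  induction i with
  | zero => exact Nat.zero_le _
  | succ j ih =>
    have h1 := ih (by omega)
    have h2 : f ⟨j, by omega⟩ < f ⟨j + 1, hi⟩ := hf (Fin.mk_lt_mk.2 (Nat.lt_succ_self j))
    have h3 : (f ⟨j, by omega⟩).val < (f ⟨j + 1, hi⟩).val := h2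
    dsimp only at h1 ⊢
    omega

/-- Among the products of `k + 1` distinct terms of an antitone sequence, the product of the first
ones is the largest. -/
theorem prod_le_of_antitone {y : Fin n → ℝ} (hy : Antitone y) (h0 : ∀ i, 0 ≤ y i) (k : Fin (n - 1))
    {J : Fin (k.1 + 1) → Fin n} (hJ : Function.Injective J) :
    ∏ r, y (J r) ≤ ∏ i with i.val ≤ k.val, y i := by
  rw [prod_filter_le]
  -- After sorting the values of `J` increasingly, the `r`-th one is at least `r`, so the factors
  -- can be compared one by one.
  set s : Finset (Fin n) := Finset.univ.image J with hs
  have hcard : s.card = k.1 + 1 := by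
    rw [hs, Finset.card_image_of_injective _ hJ, Finset.card_univ, Fintype.card_fin]
  have h1 : ∏ r, y (J r) = ∏ r, y (s.orderEmbOfFin hcard r) := by
    rw [← Finset.prod_image (g := J) (f := y) fun i _ j _ h => hJ h, ← hs]
    conv_lhs => rw [← Finset.image_orderEmbOfFin_univ s hcard]
    exact Finset.prod_image fun i _ j _ h => (s.orderEmbOfFin hcard).injective h
  rw [h1]
  refine Finset.prod_le_prod (fun r _ => h0 _) fun r _ => hy ?_
  exact Fin.le_of_strictMono (s.orderEmbOfFin hcard).strictMono r

/-- `D` is diagonal in the orthonormal basis of fillings, so the upper bound is checked on each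
filling in the support, column by column; the highest weight vector gives equality. -/
theorem norm_hwRepC_diagonal {D : SL n} {x : Fin n → ℂ} (hD : D.1 = Matrix.diagonal x)
    (hx : Antitone fun i => ‖x i‖) :
    ‖LinearMap.toContinuousLinearMap (hwRepC n a D)‖
      = ∏ k : Fin (n - 1), ‖∏ i with i.val ≤ k.val, x i‖ ^ a k := by
  have hw : ‖weight a x‖ = ∏ k : Fin (n - 1), ‖∏ i with i.val ≤ k.val, x i‖ ^ a k := by
    simp [weight, norm_prod]
  rw [← hw]
  refine le_antisymm (ContinuousLinearMap.opNorm_le_bound _ (norm_nonneg _) fun v => ?_) ?_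
  · change ‖tensorRep n a D v.1‖ ≤ ‖weight a x‖ * ‖v.1‖
    rw [← sq_le_sq₀ (norm_nonneg _) (by positivity), mul_pow, EuclideanSpace.norm_sq_eq,
      EuclideanSpace.norm_sq_eq, Finset.mul_sum]
    refine Finset.sum_le_sum fun I _ => ?_
    rw [tensorRep_diagonal hD, norm_mul, mul_pow]
    by_cases hI : v.1 I = 0
    · rw [hI]; simp
    gcongr
    rw [hw, norm_prod, prod_box]
    refine Finset.prod_le_prod (fun k _ => Finset.prod_nonneg fun c _ =>
      Finset.prod_nonneg fun r _ => norm_nonneg _) fun k _ => ?_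
    conv_rhs => rw [← Fintype.card_fin (a k), ← Finset.card_univ, ← Finset.prod_const]
    refine Finset.prod_le_prod (fun c _ => Finset.prod_nonneg fun r _ => norm_nonneg _)
      fun c _ => ?_
    rw [norm_prod]
    exact prod_le_of_antitone hx (fun i => norm_nonneg _) k (hwSpace_injective v hI c)
  · have h := (LinearMap.toContinuousLinearMap (hwRepC n a D)).le_opNorm (hwVec n a)
    rw [LinearMap.coe_toContinuousLinearMap', hwRepC_hwVec hD, norm_smul] at h
    exact le_of_mul_le_mul_right h (norm_pos_iff.2 hwVec_ne_zero)

/-- A permutation matrix with phases in `SU(n)`. -/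
theorem exists_SU_perm (hn : 1 ≤ n) (τ : Equiv.Perm (Fin n)) :
    ∃ (g : SU n) (ε : Fin n → ℂ), (∀ j, ‖ε j‖ = 1) ∧
      ∀ i j, g.1 i j = if i = τ j then ε j else 0 := by
  set s : ℂ := ((Equiv.Perm.sign τ : ℤ) : ℂ) with hs
  have hs1 : ‖s‖ = 1 := by
    rcases Int.units_eq_one_or (Equiv.Perm.sign τ) with h | h <;> simp [hs, h]
  have hss : s * s = 1 := by
    rcases Int.units_eq_one_or (Equiv.Perm.sign τ) with h | h <;> simp [hs, h]
  -- One column is multiplied by the sign of `τ` to make the determinant one.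
  set ε : Fin n → ℂ := Function.update 1 ⟨0, hn⟩ s with hε
  have hε1 : ∀ j, ‖ε j‖ = 1 := by
    intro j
    by_cases hj : j = ⟨0, hn⟩
    · subst hj; simp [hε, hs1]
    · simp [hε, Function.update_of_ne hj]
  set M : Matrix (Fin n) (Fin n) ℂ := Matrix.of fun i j => if i = τ j then ε j else 0 with hM
  refine ⟨⟨M, ?_⟩, ε, hε1, fun i j => rfl⟩
  rw [Matrix.mem_specialUnitaryGroup_iff, Matrix.mem_unitaryGroup_iff']
  constructor
  · ext i j
    rw [Matrix.mul_apply, Matrix.one_apply, Finset.sum_eq_single (τ j)]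
    · rw [Matrix.star_apply]
      simp only [hM, Matrix.of_apply, if_true, EmbeddingLike.apply_eq_iff_eq]
      by_cases h : i = j
      · subst h
        simp [Complex.conj_mul', hε1]
      · simp [h, Ne.symm h]
    · intro k _ hk
      simp [hM, hk]
    · simp
  · have h1 : M = (τ⁻¹).permMatrix ℂ * Matrix.diagonal ε := by
      ext i j
      rw [Matrix.mul_diagonal, Equiv.Perm.permMatrix, PEquiv.toMatrix_apply]
      simp only [hM, Matrix.of_apply, Equiv.toPEquiv_apply, Option.mem_def, Option.some.injEq,
        Equiv.Perm.inv_eq_iff_eq, ite_mul, one_mul, zero_mul]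
    rw [h1, Matrix.det_mul, Matrix.det_permutation, Matrix.det_diagonal, hε,
      Finset.prod_update_of_mem (Finset.mem_univ _), Equiv.Perm.sign_inv]
    simpa using hss

theorem norm_hwRepC_mul (U W : SU n) (A : SL n) :
    ‖LinearMap.toContinuousLinearMap (hwRepC n a (toSL n U * A * toSL n W))‖
      = ‖LinearMap.toContinuousLinearMap (hwRepC n a A)‖ := by
  have h := @norm_mul_isometry n (HWSpace n a) _ _ _
  have h2 := h (σ := hwRepC n a)
  exact h2 (norm_hwRepC_toSL (a := a)) U W A

/-- A permutation matrix in `SU(n)` conjugates `D` to a diagonal matrix with decreasing moduli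
without changing any norm. The same permutation serves `a` and all unit vectors, and the ordered
formula is multiplicative in `a`. -/
theorem norm_hwRepC_diagonal_eq_prod (hn : 1 ≤ n) {D : SL n} {x : Fin n → ℂ}
    (hD : D.1 = Matrix.diagonal x) :
    ‖LinearMap.toContinuousLinearMap (hwRepC n a D)‖
      = ∏ k, ‖LinearMap.toContinuousLinearMap (hwRepC n (Pi.single k 1) D)‖ ^ a k := by
  obtain ⟨τ, hτ⟩ : ∃ τ : Equiv.Perm (Fin n), Antitone fun i => ‖(x ∘ τ) i‖ := by
    refine ⟨Tuple.sort fun i => -‖x i‖, fun i j hij => ?_⟩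
    have := Tuple.monotone_sort (fun i => -‖x i‖) hij
    simpa using this
  obtain ⟨g, ε, hε, hg⟩ := exists_SU_perm hn τ
  have hD'det : (Matrix.diagonal (x ∘ τ)).det = 1 := by
    have := D.2
    rw [hD, Matrix.det_diagonal] at this
    rw [Matrix.det_diagonal, ← this]
    exact Equiv.prod_comp τ x
  obtain ⟨D', hD'⟩ : ∃ D' : SL n, D'.1 = Matrix.diagonal (x ∘ τ) := ⟨⟨_, hD'det⟩, rfl⟩
  have hcomm : D * toSL n g = toSL n g * D' := by
    apply Subtype.ext
    rw [Matrix.SpecialLinearGroup.coe_mul, Matrix.SpecialLinearGroup.coe_mul, hD, hD']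
    ext i j
    rw [coe_toSL, Matrix.diagonal_mul, Matrix.mul_diagonal, hg]
    split_ifs with h
    · rw [h, mul_comm]; rfl
    · simp
  have hDD : D = toSL n g * D' * toSL n g⁻¹ := by
    rw [← hcomm, map_inv, mul_inv_cancel_right]
  have hnorm : ∀ a : Fin (n - 1) → ℕ, ‖LinearMap.toContinuousLinearMap (hwRepC n a D)‖
      = ∏ k : Fin (n - 1), ‖∏ i with i.val ≤ k.val, (x ∘ τ) i‖ ^ a k := by
    intro a
    calc ‖LinearMap.toContinuousLinearMap (hwRepC n a D)‖
        = ‖LinearMap.toContinuousLinearMap (hwRepC n a (toSL n g * D' * toSL n g⁻¹))‖ := by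
          rw [← hDD]
      _ = ‖LinearMap.toContinuousLinearMap (hwRepC n a D')‖ :=
          norm_hwRepC_mul g g⁻¹ D'
      _ = _ := norm_hwRepC_diagonal hD' hτ
  rw [hnorm]
  refine Finset.prod_congr rfl fun k _ => ?_
  rw [hnorm, Finset.prod_eq_single k]
  · simp
  · intro j _ hj
    simp [Pi.single_eq_of_ne hj]
  · simp

end TensorRep

end BeurlingFourier

end

noncomputable section

set_option linter.unusedSectionVars false

open MeasureTheory Matrix
open scoped TensorProduct

namespace BeurlingFourier

/-! ### Irreducibility of the fundamental representations -/

section Fundamental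

variable {n : ℕ}

theorem box_single_fst {k : Fin (n - 1)} (b : Box n (Pi.single k 1)) : b.1 = k := by
  by_contra h
  have h1 : b.2.1.val < _ := b.2.1.2
  have h2 : Pi.single (M := fun _ => ℕ) k 1 b.1 = 0 := Pi.single_eq_of_ne h 1
  exact absurd (h1.trans_eq h2) (Nat.not_lt_zero _)

/-- All boxes of a diagram with a single column are in the same column. -/
theorem exists_box_single_eq {k : Fin (n - 1)} (b b' : Box n (Pi.single k 1)) :
    ∃ (j : Fin (n - 1)) (c : Fin (Pi.single (M := fun _ => ℕ) k 1 j)) (r r' : Fin (j.1 + 1)),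
      b = ⟨j, c, r⟩ ∧ b' = ⟨j, c, r'⟩ := by
  obtain ⟨j, c, r⟩ := b
  obtain ⟨j', c', r'⟩ := b'
  obtain rfl : j = k := box_single_fst ⟨j, c, r⟩
  obtain rfl : j' = j := box_single_fst ⟨j', c', r'⟩
  have hc : c = c' := by
    have h1 := c.2
    have h2 := c'.2
    simp only [Pi.single_eq_same] at h1 h2
    exact Fin.ext (by omega)
  subst hc
  exact ⟨j', c, r, r', rfl, rfl⟩

theorem hwSpace_single_swap {k : Fin (n - 1)} (v : HWSpace n (Pi.single k 1))
    {b b' : Box n (Pi.single k 1)} (hb : b ≠ b') (I : Box n (Pi.single k 1) → Fin n) :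
    v.1 (I ∘ Equiv.swap b b') = - v.1 I := by
  obtain ⟨j, c, r, r', rfl, rfl⟩ := exists_box_single_eq b b'
  exact hwSpace_swap v c (fun h => hb (by rw [h])) I

theorem hwSpace_single_injective {k : Fin (n - 1)} (v : HWSpace n (Pi.single k 1))
    {I : Box n (Pi.single k 1) → Fin n} (hI : v.1 I ≠ 0) : Function.Injective I := by
  intro b b' h
  obtain ⟨j, c, r, r', rfl, rfl⟩ := exists_box_single_eq b b'
  rw [hwSpace_injective v hI c h]

/-- For a single column every permutation of the boxes is a product of column swaps, each of which
only changes a sign. -/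
theorem hwSpace_single_comp_perm {k : Fin (n - 1)} (v : HWSpace n (Pi.single k 1))
    (σ : Equiv.Perm (Box n (Pi.single k 1))) :
    ∀ I : Box n (Pi.single k 1) → Fin n, v.1 I = 0 → v.1 (I ∘ σ) = 0 := by
  induction σ using Equiv.Perm.swap_induction_on with
  | one => exact fun I h => h
  | swap_mul σ b b' hb ih =>
    intro I h
    rw [Equiv.Perm.coe_mul, ← Function.comp_assoc]
    refine ih _ ?_
    rw [hwSpace_single_swap v hb, h, neg_zero]

theorem rowFilling_single_injective (k : Fin (n - 1)) :
    Function.Injective (rowFilling n (Pi.single k 1)) := by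
  intro b b' h
  obtain ⟨j, c, r, r', rfl, rfl⟩ := exists_box_single_eq b b'
  have : r = r' := Fin.ext (congrArg (fun i : Fin n => i.val) h)
  rw [this]

theorem rowFilling_single_le {k : Fin (n - 1)} (b : Box n (Pi.single k 1)) :
    (rowFilling n (Pi.single k 1) b).val ≤ k.val := by
  have h1 := box_single_fst b
  have h2 := b.2.2.2
  have h3 : b.1.val = k.val := congrArg Fin.val h1
  change b.2.2.val ≤ _
  omega

/-- The highest weight space is one-dimensional. -/
theorem mem_span_hwVec {k : Fin (n - 1)} {v : HWSpace n (Pi.single k 1)}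
    (hv : ∀ (g : SU n) (x : Fin n → ℂ), g.1 = Matrix.diagonal x →
      hwRepC n (Pi.single k 1) (toSL n g) v = weight (Pi.single k 1) x • v) :
    ∃ c : ℂ, v = c • hwVec n (Pi.single k 1) := by
  set I₀ := rowFilling n (Pi.single k 1) with hI₀
  have hone : (hwVec n (Pi.single k 1)).1 I₀ = 1 := highestWeightVector_rowFilling
  refine ⟨v.1 I₀, ?_⟩
  rw [← sub_eq_zero]
  set u := v - v.1 I₀ • hwVec n (Pi.single k 1) with hu
  have hu0 : u.1 I₀ = 0 := by
    change v.1 I₀ - v.1 I₀ * (hwVec n (Pi.single k 1)).1 I₀ = 0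
    rw [hone, mul_one, sub_self]
  have hut : ∀ (g : SU n) (x : Fin n → ℂ), g.1 = Matrix.diagonal x →
      hwRepC n (Pi.single k 1) (toSL n g) u = weight (Pi.single k 1) x • u := by
    intro g x hg
    rw [hu, map_sub, map_smul, hv g x hg, hwRepC_hwVec (D := toSL n g) hg, smul_sub, smul_comm]
  refine Subtype.ext (PiLp.ext fun I => ?_)
  change u.1 I = 0
  by_contra hI
  have hinj := hwSpace_single_injective u hI
  -- Any filling in the support of `u` must use all the entries `0, …, k` of `I₀`; it is then a
  -- rearrangement of `I₀`, where `u` vanishes.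
  have hran : ∀ b, ∃ b', I b' = I₀ b := by
    intro b
    by_contra hno
    push Not at hno
    have hle := rowFilling_single_le b
    rw [← hI₀] at hle
    set q : Fin n := ⟨k.1 + 1, by omega⟩ with hq
    have hpq : q ≠ I₀ b := by
      intro h
      have : q.val = (I₀ b).val := congrArg Fin.val h
      have hqv : q.val = k.1 + 1 := rfl
      omega
    -- A torus element separating the weights: `i` at a missing entry of `I₀`, `-i` at the index `k
    -- + 1`, outside `I₀`, and `1` elsewhere, with determinant `i * (-i) = 1`. Its eigenvalue on
    -- `I₀` is `i`, but on a filling avoiding that entry it is `1` or `-i`.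
    set x : Fin n → ℂ :=
      Function.update (Function.update 1 (I₀ b) Complex.I) q (-Complex.I) with hx
    have hx1 : x (I₀ b) = Complex.I := by
      rw [hx, Function.update_of_ne hpq.symm, Function.update_self]
    have hx2 : x q = -Complex.I := by rw [hx, Function.update_self]
    have hx3 : ∀ i, i ≠ I₀ b → i ≠ q → x i = 1 := by
      intro i h1 h2
      rw [hx, Function.update_of_ne h2, Function.update_of_ne h1]
      rfl
    have hmem : Matrix.diagonal x ∈ Matrix.specialUnitaryGroup (Fin n) ℂ := by
      refine diagonal_mem_SU (fun i => ?_) ?_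
      · by_cases h1 : i = I₀ b
        · rw [h1, hx1, Complex.norm_I]
        · by_cases h2 : i = q
          · rw [h2, hx2, norm_neg, Complex.norm_I]
          · rw [hx3 i h1 h2, norm_one]
      · rw [Finset.prod_eq_mul (I₀ b) q hpq.symm (fun i _ h => hx3 i h.1 h.2) (by simp) (by simp),
          hx1, hx2, mul_neg, Complex.I_mul_I, neg_neg]
    have h1 := hut ⟨_, hmem⟩ x rfl
    have h2 := congrArg (fun w : HWSpace n (Pi.single k 1) => w.1 I) h1
    dsimp only at h2
    rw [coe_hwRepC, tensorRep_diagonal (x := x) rfl] at h2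
    have h3 : ∏ b, x (I b) = weight (Pi.single k 1) x := mul_right_cancel₀ hI h2
    have h4 : weight (Pi.single k 1) x = Complex.I := by
      rw [← prod_eq_weight_of_ne_zero (I := I₀) x
        (by rw [highestWeightVector_rowFilling]; exact one_ne_zero),
        Finset.prod_eq_single b, hx1]
      · intro b' _ hb'
        refine hx3 _ (fun h => hb' (rowFilling_single_injective k h)) fun h => ?_
        have h5 := rowFilling_single_le b'
        rw [← hI₀, h] at h5
        have hqv : q.val = k.1 + 1 := rfl
        omega
      · simp
    rw [h4] at h3
    by_cases hqI : ∃ b', I b' = q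
    · obtain ⟨b', hb'⟩ := hqI
      rw [Finset.prod_eq_single b', hb', hx2] at h3
      · have := congrArg Complex.im h3
        norm_num at this
      · intro b'' _ h
        exact hx3 _ (hno b'') fun h' => h (hinj (h'.trans hb'.symm))
      · simp
    · push Not at hqI
      rw [Finset.prod_eq_one fun b' _ => hx3 _ (hno b') (hqI b')] at h3
      have := congrArg Complex.im h3
      norm_num at this
  choose σ hσ using hran
  have hσi : Function.Injective σ := by
    intro b b' h
    apply rowFilling_single_injective k
    rw [← hI₀, ← hσ, ← hσ, h]
  let τ : Equiv.Perm (Box n (Pi.single k 1)) :=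
    Equiv.ofBijective σ (Finite.injective_iff_bijective.1 hσi)
  have h1 : I = I₀ ∘ τ.symm := by
    funext b
    rw [Function.comp_apply, ← hσ]
    exact congrArg I (τ.apply_symm_apply b).symm
  apply hI
  rw [h1]
  exact hwSpace_single_comp_perm u _ _ hu0

/-- A subspace invariant under `SU(n)` is invariant under `SL(n, ℂ)`. -/
theorem IsHolomorphicExtension.invariant (hn : 1 ≤ n) {V : Type*} [NormedAddCommGroup V]
    [InnerProductSpace ℂ V] [FiniteDimensional ℂ V] {π : Representation ℂ (SU n) V}
    {σ : Representation ℂ (SL n) V} (h : IsHolomorphicExtension π σ) {K : Submodule ℂ V}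
    (hK : ∀ g, ∀ v ∈ K, π g v ∈ K) (x : SL n) {v : V} (hv : v ∈ K) : σ x v ∈ K := by
  rw [← K.orthogonal_orthogonal]
  intro u hu
  refine IsHolomorphic.ext hn (isHolomorphic_inner h.1 v u) (isHolomorphic_const 0) (fun g => ?_) x
  rw [h.2]
  exact Submodule.inner_left_of_mem_orthogonal (hK g v hv) hu

theorem eq_top_of_hwVec_mem {a : Fin (n - 1) → ℕ} {K : Submodule ℂ (HWSpace n a)}
    (hK : ∀ x, ∀ v ∈ K, hwRepC n a x v ∈ K) (h : hwVec n a ∈ K) : K = ⊤ := by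
  rw [eq_top_iff]
  rintro ⟨v, hv⟩ -
  have h1 : (highestWeightSubrep n a).toSubmodule ≤ K.map (Submodule.subtype _) := by
    refine Submodule.span_le.2 ?_
    rintro _ ⟨x, rfl⟩
    exact ⟨hwRepC n a x (hwVec n a), hK x _ h, rfl⟩
  obtain ⟨w, hw, hwv⟩ := h1 hv
  have : w = ⟨v, hv⟩ := Subtype.ext hwv
  exact this ▸ hw

/-- A unitary representation generated by a vector that spans its weight space is irreducible. -/
theorem isIrreducible_of_weight_vector {G V : Type*} [Group G] [TopologicalSpace G]
    [NormedAddCommGroup V] [InnerProductSpace ℂ V] [FiniteDimensional ℂ V]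
    {π : Representation ℂ G V} (hπ : IsContUnitary π) {e : V} (he : e ≠ 0) (T : Set G) (χ : G → ℂ)
    (heT : ∀ g ∈ T, π g e = χ g • e)
    (hT : ∀ w, (∀ g ∈ T, π g w = χ g • w) → ∃ c : ℂ, w = c • e)
    (hgen : ∀ K : Submodule ℂ V, (∀ g, ∀ v ∈ K, π g v ∈ K) → e ∈ K → K = ⊤) :
    π.IsIrreducible := by
  rw [irreducible_iff]
  refine ⟨⟨_, 0, he⟩, fun K hK => ?_⟩
  have hKo : ∀ g, ∀ v ∈ Kᗮ, π g v ∈ Kᗮ := by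
    intro g v hv u hu'
    rw [← hπ.inner_inv]
    exact hv _ (hK _ u hu')
  -- The component of `e` in `K` satisfies the same eigenvalue equations, since its defect lies in
  -- both `K` and `Kᗮ`. So it is a multiple of `e`, and `e` lies in one of the two subspaces.
  obtain ⟨w, hw, w', hw', hww⟩ := K.exists_add_mem_mem_orthogonal e
  obtain ⟨c, hc⟩ := hT w fun g hg => by
    have h1 := heT g hg
    rw [hww, map_add, smul_add] at h1
    have h2 : π g w - χ g • w = χ g • w' - π g w' := by
      rw [sub_eq_sub_iff_add_eq_add, h1, add_comm]
    have h3 : π g w - χ g • w ∈ K := K.sub_mem (hK g w hw) (K.smul_mem _ hw)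
    have h4 : π g w - χ g • w ∈ Kᗮ := by
      rw [h2]
      exact Kᗮ.sub_mem (Kᗮ.smul_mem _ hw') (hKo g w' hw')
    exact sub_eq_zero.1 (Submodule.disjoint_def.1 K.orthogonal_disjoint _ h3 h4)
  by_cases hc0 : c = 0
  · left
    rw [hc0, zero_smul] at hc
    rw [hc, zero_add] at hww
    rw [← Submodule.orthogonal_eq_top_iff]
    exact hgen _ hKo (by rw [hww]; exact hw')
  · right
    refine hgen K hK ?_
    have h1 : e = c⁻¹ • w := by rw [hc, inv_smul_smul₀ hc0]
    rw [h1]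
    exact K.smul_mem _ hw

theorem hwRep_single_isIrreducible (hn : 1 ≤ n) (k : Fin (n - 1)) :
    (hwRep n (Pi.single k 1)).IsIrreducible := by
  have hC := isHolomorphicExtension_hwRepC (a := Pi.single (M := fun _ => ℕ) k 1)
  refine isIrreducible_of_weight_vector (V := HWSpace n (Pi.single k 1)) isContUnitary_hwRep
    hwVec_ne_zero {g | ∃ x, g.1 = Matrix.diagonal x}
    (fun g => weight (Pi.single k 1) fun i => g.1 i i) ?_ (fun w hw => ?_) (fun K hK he => ?_)
  · rintro g ⟨x, hx⟩
    have h1 : x = fun i => g.1 i i := by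
      rw [hx]
      simp
    rw [← h1]
    exact hwRepC_hwVec (D := toSL n g) hx
  · refine mem_span_hwVec fun g x hx => ?_
    have h1 : x = fun i => g.1 i i := by
      rw [hx]
      simp
    have h2 := hw g ⟨x, hx⟩
    rw [← h1] at h2
    exact h2
  · exact eq_top_of_hwVec_mem (fun x v hv => hC.invariant hn hK x hv) he

/-- This is where irreducibility of the fundamental representations enters: it guarantees that each
of them really is represented in the generating set. -/
theorem exists_mem_generators (hn : 1 ≤ n) (k : Fin (n - 1)) : ∃ p ∈ generators n,
    UnitarilyEquivalent (W := HWSpace n (Pi.single k 1)) p.irrep.rep (hwRep n (Pi.single k 1)) := by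
  obtain ⟨p, hp⟩ := exists_unitaryDual_equiv (H := HWSpace n (Pi.single k 1))
    isContUnitary_hwRep (hwRep_single_isIrreducible hn k)
  exact ⟨p, ⟨k, hp⟩, hp⟩

end Fundamental

end BeurlingFourier

end

noncomputable section

set_option linter.unusedSectionVars false

open MeasureTheory Matrix
open scoped TensorProduct

namespace BeurlingFourier

/-! ### Matrix entries generate the trigonometric polynomials on `SU(n)` -/

section Entries

variable {n : ℕ}

/-- The matrix entries as functions on `SU(n)`. -/
def entryFun (i j : Fin n) : C(SU n, ℂ) where
  toFun g := g.1 i j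
  continuous_toFun := continuous_subtype_val.matrix_elem _ _

@[simp] theorem entryFun_apply (i j : Fin n) (g : SU n) : entryFun i j g = g.1 i j := rfl

variable (n) in
/-- The algebra of polynomials in the matrix entries. -/
def polyAlg : Subalgebra ℂ C(SU n, ℂ) :=
  Algebra.adjoin ℂ (Set.range fun ij : Fin n × Fin n => entryFun ij.1 ij.2)

theorem entryFun_mem_polyAlg (i j : Fin n) : entryFun i j ∈ polyAlg n :=
  Algebra.subset_adjoin ⟨(i, j), rfl⟩

variable (n) in
/-- The matrix of the entry functions. -/
def entryMatrix : Matrix (Fin n) (Fin n) (polyAlg n) :=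
  Matrix.of fun i j => ⟨entryFun i j, entryFun_mem_polyAlg i j⟩

/-- Evaluation at a point of `SU(n)`. -/
def polyEval (g : SU n) : polyAlg n →+* ℂ :=
  ((ContinuousMap.evalAlgHom ℂ ℂ g : C(SU n, ℂ) →ₐ[ℂ] ℂ).toRingHom).comp
    (polyAlg n).val.toRingHom

theorem mapMatrix_polyEval (g : SU n) : (polyEval g).mapMatrix (entryMatrix n) = g.1 := by
  ext i j
  rfl

/-- For `g` in `SU(n)` the conjugate transpose is the inverse, hence the adjugate, whose entries are
polynomials in the entries of `g`. -/
theorem star_entryFun_mem_polyAlg (i j : Fin n) : star (entryFun i j) ∈ polyAlg n := by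
  have h : star (entryFun i j) = ((entryMatrix n).adjugate j i : C(SU n, ℂ)) := by
    ext g
    have h2 : g.1.adjugate = star g.1 := by
      have h3 : g.1.adjugate * g.1 = 1 := by rw [Matrix.adjugate_mul, SU_det, one_smul]
      calc g.1.adjugate = g.1.adjugate * (g.1 * star g.1) := by rw [SU_mul_star, mul_one]
        _ = star g.1 := by rw [← mul_assoc, h3, one_mul]
    have h4 : polyEval g ((entryMatrix n).adjugate j i) = g.1.adjugate j i := by
      rw [← mapMatrix_polyEval, ← RingHom.map_adjugate]
      rfl
    change star (g.1 i j) = polyEval g ((entryMatrix n).adjugate j i)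
    rw [h4, h2, Matrix.star_apply]
  rw [h]
  exact ((entryMatrix n).adjugate j i).2

theorem star_mem_polyAlg {f : C(SU n, ℂ)} (hf : f ∈ polyAlg n) : star f ∈ polyAlg n := by
  induction hf using Algebra.adjoin_induction with
  | mem f hf =>
    obtain ⟨ij, rfl⟩ := hf
    exact star_entryFun_mem_polyAlg _ _
  | algebraMap c =>
    rw [← algebraMap_star_comm]
    exact Subalgebra.algebraMap_mem _ _
  | add f g _ _ hf hg => rw [star_add]; exact add_mem hf hg
  | mul f g _ _ hf hg => rw [star_mul]; exact mul_mem hg hf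

/-- Stone–Weierstrass: the algebra is closed under conjugation, and matrix entries separate points.
-/
theorem dense_polyAlg : Dense (polyAlg n : Set C(SU n, ℂ)) := by
  let A : StarSubalgebra ℂ C(SU n, ℂ) := { polyAlg n with star_mem' := star_mem_polyAlg }
  have hA : A.topologicalClosure = ⊤ := by
    refine ContinuousMap.starSubalgebra_topologicalClosure_eq_top_of_separatesPoints A ?_
    intro g h hgh
    by_contra hno
    push Not at hno
    refine hgh (Subtype.ext ?_)
    ext i j
    exact hno _ ⟨entryFun i j, entryFun_mem_polyAlg i j, rfl⟩
  intro f
  have : f ∈ A.topologicalClosure := by rw [hA]; trivial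
  exact this

theorem exists_isHolomorphic_of_mem_polyAlg {f : C(SU n, ℂ)} (hf : f ∈ polyAlg n) :
    ∃ F : SL n → ℂ, IsHolomorphic F ∧ ∀ g, F (toSL n g) = f g := by
  induction hf using Algebra.adjoin_induction with
  | mem f hf =>
    obtain ⟨ij, rfl⟩ := hf
    exact ⟨_, isHolomorphic_entry ij.1 ij.2, fun g => rfl⟩
  | algebraMap c => exact ⟨_, isHolomorphic_const c, fun g => rfl⟩
  | add f g _ _ hf hg =>
    obtain ⟨F, hF, h⟩ := hf
    obtain ⟨F', hF', h'⟩ := hg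
    exact ⟨_, hF.add hF', fun g => by rw [h, h']; rfl⟩
  | mul f g _ _ hf hg =>
    obtain ⟨F, hF, h⟩ := hf
    obtain ⟨F', hF', h'⟩ := hg
    exact ⟨_, hF.mul hF', fun g => by rw [h, h']; rfl⟩

theorem coeffFun_hwRep_mem_polyAlg {a : Fin (n - 1) → ℕ} (v w : HWSpace n a) :
    coeffFun (isContUnitary_hwRep (a := a)) v w ∈ polyAlg n := by
  have h : coeffFun (isContUnitary_hwRep (a := a)) v w
      = ∑ I, ∑ J, (v.1 J * star (w.1 I)) • ∏ b, entryFun (I b) (J b) := by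
    ext g
    have h1 := inner_hwRepC (toSL n g) v w
    rw [ContinuousMap.coe_sum, Finset.sum_apply]
    simp only [ContinuousMap.coe_sum, Finset.sum_apply, ContinuousMap.coe_smul, Pi.smul_apply,
      ContinuousMap.coe_prod, Finset.prod_apply, entryFun_apply, smul_eq_mul]
    exact h1
  rw [h]
  exact sum_mem fun I _ => sum_mem fun J _ => Subalgebra.smul_mem _
    (prod_mem fun b _ => entryFun_mem_polyAlg _ _) _

theorem coeffSet_generators_subset : coeffSet (generators n) ⊆ polyAlg n := by
  rintro _ ⟨p, ⟨k, U, hU⟩, x, y, rfl⟩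
  have h : coeffFun p.irrep.isContUnitary x y
      = coeffFun (isContUnitary_hwRep (a := Pi.single k 1)) (U x) (U y) := by
    ext g
    exact ((congrArg (inner ℂ (U y)) (hU g x)).symm.trans (U.inner_map_map _ _)).symm
  rw [h]
  exact coeffFun_hwRep_mem_polyAlg _ _

theorem coeffFun_hwRep_mem_coeffSet (hn : 1 ≤ n) (k : Fin (n - 1))
    (v w : HWSpace n (Pi.single k 1)) :
    coeffFun (isContUnitary_hwRep (a := Pi.single k 1)) v w ∈ coeffSet (generators n) := by
  obtain ⟨p, hp, U, hU⟩ := exists_mem_generators hn k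
  refine ⟨p, hp, U.symm v, U.symm w, ?_⟩
  ext g
  have h1 : inner ℂ (U (U.symm w)) (U (p.irrep.rep g (U.symm v)))
      = inner ℂ (U.symm w) (p.irrep.rep g (U.symm v)) := U.inner_map_map _ _
  rw [hU, U.apply_symm_apply, U.apply_symm_apply] at h1
  exact h1

theorem hwVec_single_zero_apply {k : Fin (n - 1)} (hk : k.val = 0)
    (I : Box n (Pi.single k 1) → Fin n) :
    (hwVec n (Pi.single k 1)).1 I = if I = rowFilling n (Pi.single k 1) then 1 else 0 := by
  split_ifs with h
  · rw [h]
    exact highestWeightVector_rowFilling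
  · obtain ⟨b, hb⟩ := Function.ne_iff.1 h
    obtain ⟨j, c, r⟩ := b
    have hj : j = k := box_single_fst ⟨j, c, r⟩
    have hj0 : j.val = 0 := by rw [hj, hk]
    change highestWeightVector n (Pi.single k 1) I = 0
    rw [highestWeightVector_apply]
    refine Finset.prod_eq_zero (Finset.mem_univ ⟨j, c⟩)
      (Matrix.det_eq_zero_of_row_eq_zero r fun s => ?_)
    refine if_neg fun h => hb (Fin.ext ?_)
    have hr : (rowFilling n (Pi.single k 1) ⟨j, c, r⟩).val = r.val := rfl
    have hs := s.2
    have hr' := r.2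
    dsimp only at h hs hr'
    rw [hr, h]
    omega

/-- The diagram is a single box, the tensor space is `ℂⁿ` and the highest weight vector is its first
basis vector. -/
theorem inner_hwVec_single_zero (hn : 1 ≤ n) {k : Fin (n - 1)} (hk : k.val = 0) (x : SL n) :
    inner ℂ (hwVec n (Pi.single k 1)) (hwRepC n (Pi.single k 1) x (hwVec n (Pi.single k 1)))
      = x.1 ⟨0, hn⟩ ⟨0, hn⟩ := by
  rw [inner_hwRepC, Finset.sum_eq_single (rowFilling n (Pi.single k 1)),
    Finset.sum_eq_single (rowFilling n (Pi.single k 1))]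
  · have h0 : ∀ b, rowFilling n (Pi.single k 1) b = ⟨0, hn⟩ := by
      intro b
      have := rowFilling_single_le b
      exact Fin.ext (by rw [hk] at this; exact Nat.le_zero.1 this)
    have hcard : Fintype.card (Box n (Pi.single k 1)) = 1 := by
      simp [Fintype.card_sigma, Pi.single_apply, hk]
    simp only [hwVec_single_zero_apply hk, if_true, h0, Finset.prod_const, Finset.card_univ, hcard]
    simp
  · intro J _ hJ
    rw [hwVec_single_zero_apply hk J, if_neg hJ, zero_mul, zero_mul]
  · simp
  · intro I _ hI
    refine Finset.sum_eq_zero fun J _ => ?_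
    rw [hwVec_single_zero_apply hk I, if_neg hI, star_zero, mul_zero, zero_mul]
  · simp

theorem coeffFun_translate {G H : Type*} [Group G] [TopologicalSpace G] [NormedAddCommGroup H]
    [InnerProductSpace ℂ H] {π : Representation ℂ G H} (hπ : IsContUnitary π) (v w : H)
    (g g' u : G) :
    coeffFun hπ (π g' v) (π g w) u = inner ℂ w (π (g⁻¹ * u * g') v) := by
  rw [map_mul, map_mul, Module.End.mul_apply, Module.End.mul_apply, ← inner_conj_symm,
    hπ.inner_inv, inner_conj_symm]
  rfl

/-- Translating the `(0, 0)` entry on both sides by permutation matrices reaches the `(i, j)` entry,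
up to phases. So `π_1` alone generates all matrix entries. -/
theorem entryFun_mem_adjoin (hn : 1 ≤ n) (i j : Fin n) :
    entryFun i j ∈ Algebra.adjoin ℂ (coeffSet (generators n)) := by
  rcases Nat.lt_or_ge 1 n with h1 | h1
  · obtain ⟨k, hk⟩ : ∃ k : Fin (n - 1), k.val = 0 := ⟨⟨0, by omega⟩, rfl⟩
    obtain ⟨g, ε, hε, hg⟩ := exists_SU_perm hn (Equiv.swap ⟨0, hn⟩ i)
    obtain ⟨g', ε', hε', hg'⟩ := exists_SU_perm hn (Equiv.swap ⟨0, hn⟩ j)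
    have key : entryFun i j = (ε ⟨0, hn⟩ * star (ε' ⟨0, hn⟩)) •
        coeffFun (isContUnitary_hwRep (a := Pi.single k 1))
          (hwRep n (Pi.single k 1) g' (hwVec n (Pi.single k 1)))
          (hwRep n (Pi.single k 1) g (hwVec n (Pi.single k 1))) := by
      ext u
      have h2 := (coeffFun_translate (isContUnitary_hwRep (a := Pi.single (M := fun _ => ℕ) k 1))
        (hwVec n (Pi.single k 1)) (hwVec n (Pi.single k 1)) g g' u).trans
        (inner_hwVec_single_zero hn hk (toSL n (g⁻¹ * u * g')))
      rw [ContinuousMap.coe_smul, Pi.smul_apply, h2, coe_toSL, smul_eq_mul, entryFun_apply]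
      have h3 : (g⁻¹ * u * g').1 ⟨0, hn⟩ ⟨0, hn⟩
          = star (ε ⟨0, hn⟩) * u.1 i j * ε' ⟨0, hn⟩ := by
        change (star g.1 * u.1 * g'.1) _ _ = _
        rw [Matrix.mul_apply, Finset.sum_eq_single j]
        · rw [Matrix.mul_apply, Finset.sum_eq_single i]
          · rw [Matrix.star_apply, hg, hg', Equiv.swap_apply_left, Equiv.swap_apply_left,
              if_pos rfl, if_pos rfl]
          · intro l _ hl
            rw [Matrix.star_apply, hg, Equiv.swap_apply_left, if_neg hl, star_zero, zero_mul]
          · simp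
        · intro l _ hl
          rw [hg', Equiv.swap_apply_left, if_neg hl, mul_zero]
        · simp
      have h4 : ε ⟨0, hn⟩ * star (ε ⟨0, hn⟩) = 1 := by
        rw [Complex.star_def, Complex.mul_conj', hε]
        simp
      have h5 : ε' ⟨0, hn⟩ * star (ε' ⟨0, hn⟩) = 1 := by
        rw [Complex.star_def, Complex.mul_conj', hε']
        simp
      rw [h3]
      linear_combination (-(u.1 i j) * ε' ⟨0, hn⟩ * star (ε' ⟨0, hn⟩)) * h4 - u.1 i j * h5
    rw [key]
    exact Subalgebra.smul_mem _ (Algebra.subset_adjoin (coeffFun_hwRep_mem_coeffSet hn k _ _)) _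
  -- For `n = 1` there are no fundamental representations, and the only entry is the determinant.
  · have h2 : entryFun i j = 1 := by
      ext g
      obtain rfl : n = 1 := by omega
      have h3 := SU_det g
      rw [Matrix.det_fin_one] at h3
      rw [Subsingleton.elim i 0, Subsingleton.elim j 0]
      exact h3
    rw [h2]
    exact one_mem _

theorem polyAlg_le_adjoin (hn : 1 ≤ n) :
    polyAlg n ≤ Algebra.adjoin ℂ (coeffSet (generators n)) := by
  refine Algebra.adjoin_le ?_
  rintro _ ⟨ij, rfl⟩
  exact entryFun_mem_adjoin hn _ _

theorem dense_adjoin_coeffSet (hn : 1 ≤ n) :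
    Dense (Algebra.adjoin ℂ (coeffSet (generators n)) : Set C(SU n, ℂ)) :=
  dense_polyAlg.mono (polyAlg_le_adjoin hn)

theorem polyAlg_subset_trigPoly (hn : 1 ≤ n) :
    (polyAlg n : Set C(SU n, ℂ)) ⊆ trigPoly (SU n) := fun _ hf =>
  adjoin_coeffSet_le_trigPoly _ (polyAlg_le_adjoin hn hf)

theorem dense_trigPoly (hn : 1 ≤ n) : Dense (trigPoly (SU n) : Set C(SU n, ℂ)) :=
  dense_polyAlg.mono (polyAlg_subset_trigPoly hn)

theorem coeffSpan_pow_le_polyAlg (k : ℕ) :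
    coeffSpan (generators n) ^ k ≤ Subalgebra.toSubmodule (polyAlg n) := by
  have h1 : coeffSpan (generators n) ≤ Subalgebra.toSubmodule (polyAlg n) :=
    Submodule.span_le.2 coeffSet_generators_subset
  intro f hf
  induction hf using Submodule.pow_induction_on_left' with
  | algebraMap c => exact Subalgebra.algebraMap_mem _ c
  | add f g i _ _ hf hg => exact add_mem hf hg
  | mem_mul m hm i f _ hf => exact (polyAlg n).mul_mem (h1 hm) hf

/-- Density makes every irreducible representation occur in a product of fundamental ones, so its
coefficients are polynomials in the entries and not merely limits of such. -/
theorem trigPoly_subset_polyAlg (hn : 1 ≤ n) :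
    (trigPoly (SU n) : Set C(SU n, ℂ)) ⊆ polyAlg n := by
  have : trigPoly (SU n) ≤ Subalgebra.toSubmodule (polyAlg n) := by
    rw [trigPoly_eq_span_coeffFun]
    refine Submodule.span_le.2 ?_
    rintro _ ⟨p, x, y, rfl⟩
    exact coeffSpan_pow_le_polyAlg _ (coeffFun_mem_pow_lengthFun (dense_adjoin_coeffSet hn) p x y)
  exact this

theorem exists_isHolomorphic_of_mem_trigPoly (hn : 1 ≤ n) {f : C(SU n, ℂ)}
    (hf : f ∈ trigPoly (SU n)) : ∃ F : SL n → ℂ, IsHolomorphic F ∧ ∀ g, F (toSL n g) = f g :=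
  exists_isHolomorphic_of_mem_polyAlg (trigPoly_subset_polyAlg hn hf)

end Entries

end BeurlingFourier

end

noncomputable section

set_option linter.unusedSectionVars false

open MeasureTheory Matrix
open scoped TensorProduct

namespace BeurlingFourier

/-! ### Holomorphic extensions and their growth -/

section Extension

variable {n : ℕ} {H : Type} [NormedAddCommGroup H] [InnerProductSpace ℂ H]
  [FiniteDimensional ℂ H] {π : Representation ℂ (SU n) H} {σ : Representation ℂ (SL n) H}

/-- Unitary representations of `SU(n)` extend holomorphically to `SL(n, ℂ)`. -/
theorem exists_isHolomorphicExtension (hn : 1 ≤ n) (hπ : IsContUnitary π) :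
    ∃ σ, IsHolomorphicExtension π σ := by
  let b := stdOrthonormalBasis ℂ H
  have hF : ∀ i j, ∃ F : SL n → ℂ, IsHolomorphic F ∧
      ∀ g, F (toSL n g) = inner ℂ (b i) (π g (b j)) := fun i j =>
    exists_isHolomorphic_of_mem_trigPoly hn (coeffFun_mem_trigPoly hπ (b j) (b i))
  choose F hhol hF using hF
  have hM : ∀ g, Matrix.of (fun i j => F i j (toSL n g))
      = LinearMap.toMatrix b.toBasis b.toBasis (π g) := by
    intro g
    ext i j
    rw [Matrix.of_apply, hF, LinearMap.toMatrix_apply, b.coe_toBasis, b.coe_toBasis_repr_apply,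
      b.repr_apply_apply]
  have hmul0 : ∀ g h i j, F i j (toSL n g * toSL n h)
      = ∑ k, F i k (toSL n g) * F k j (toSL n h) := by
    intro g h i j
    have h1 := congrFun₂ (hM (g * h)) i j
    rw [map_mul, map_mul, LinearMap.toMatrix_mul, ← hM, ← hM, Matrix.mul_apply] at h1
    exact h1
  -- Multiplicativity is extended from `SU(n)` to `SL(n, ℂ)` one variable at a time, by uniqueness
  -- of holomorphic extensions.
  have hmul1 : ∀ x h i j, F i j (x * toSL n h) = ∑ k, F i k x * F k j (toSL n h) :=
    fun x h i j => IsHolomorphic.ext hn ((hhol i j).comp_mul_right _)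
      (isHolomorphic_sum _ fun k => (hhol i k).mul (isHolomorphic_const _))
      (fun g => hmul0 g h i j) x
  have hmul : ∀ x y i j, F i j (x * y) = ∑ k, F i k x * F k j y :=
    fun x y i j => IsHolomorphic.ext hn ((hhol i j).comp_mul_left _)
      (isHolomorphic_sum _ fun k => (isHolomorphic_const _).mul (hhol k j))
      (fun g => hmul1 x g i j) y
  let σ : Representation ℂ (SL n) H :=
    { toFun := fun x => Matrix.toLin b.toBasis b.toBasis (Matrix.of fun i j => F i j x)
      map_one' := by
        have h1 := hM 1
        rw [map_one] at h1
        rw [h1, Matrix.toLin_toMatrix, map_one]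
      map_mul' := fun x y => by
        rw [Module.End.mul_eq_comp, ← Matrix.toLin_mul]
        congr 1
        ext i j
        rw [Matrix.of_apply, hmul, Matrix.mul_apply]
        rfl }
  have hσ : ∀ x, σ x = Matrix.toLin b.toBasis b.toBasis (Matrix.of fun i j => F i j x) :=
    fun x => rfl
  refine ⟨σ, isHolomorphic_of_inner b fun i j => ?_, fun g => ?_⟩
  · have h1 : (fun x => inner ℂ (b i) (σ x (b j))) = F i j := by
      funext x
      have h2 := Matrix.toLin_self b.toBasis b.toBasis (Matrix.of fun i j => F i j x) j
      rw [b.coe_toBasis] at h2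
      rw [hσ, h2, inner_sum, Finset.sum_eq_single i]
      · rw [inner_smul_right, inner_self_eq_norm_sq_to_K, b.orthonormal.1 i]
        simp
      · intro k _ hk
        rw [inner_smul_right, b.orthonormal.2 hk.symm, mul_zero]
      · simp
    rw [h1]
    exact hhol i j
  · rw [hσ, hM, Matrix.toLin_toMatrix]

/-- The holomorphic extension maps positive diagonal matrices to self-adjoint operators. -/
theorem IsHolomorphicExtension.inner_expSL (h : IsHolomorphicExtension π σ) (hπ : IsContUnitary π)
    (a : Fin n → ℝ) (hs : ∑ i, a i = 0) (v w : H) :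
    inner ℂ (σ (expSL a hs 1) v) w = inner ℂ v (σ (expSL a hs 1) w) := by
  have hd : ∀ v w, Differentiable ℂ fun z => inner ℂ v (σ (expSL a hs z) w) := fun v w =>
    (isHolomorphic_inner h.1 w v).differentiable_comp_expSL a hs
  -- Conjugating both the variable and the value gives an entire function again. On the imaginary
  -- axis it agrees with the other coefficient, because `conj z = -z` there and unitarity moves
  -- `g⁻¹` across the inner product.
  have hd' : Differentiable ℂ fun z =>
      (starRingEnd ℂ) (inner ℂ w (σ (expSL a hs ((starRingEnd ℂ) z)) v)) := fun z =>
    (Complex.conj_conj z) ▸ (hd w v (starRingEnd ℂ z)).conj_conj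
  have key := congrFun (eq_of_eq_imaginary (hd v w) hd' fun t => ?_) 1
  · rw [map_one, inner_conj_symm] at key
    exact key.symm
  · obtain ⟨g, hg⟩ := exists_toSL_eq_expSL a hs t
    have h1 : expSL a hs ((starRingEnd ℂ) (t * Complex.I)) = toSL n g⁻¹ := by
      rw [map_inv, eq_inv_iff_mul_eq_one, hg, ← expSL_add]
      apply Subtype.ext
      rw [coe_expSL]
      simp
    rw [h1, h.2, ← hg, h.2, inner_conj_symm, ← inner_conj_symm, hπ.inner_inv, inner_conj_symm]

/-- For a self-adjoint operator the norm of a `2 ^ m`-th power is the `2 ^ m`-th power of the norm.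
This exactness is what later removes multiplicative constants. -/
theorem IsHolomorphicExtension.norm_pow_expSL (h : IsHolomorphicExtension π σ)
    (hπ : IsContUnitary π) (a : Fin n → ℝ) (hs : ∑ i, a i = 0) (m : ℕ) :
    ‖LinearMap.toContinuousLinearMap (σ (expSL a hs 1 ^ 2 ^ m))‖
      = ‖LinearMap.toContinuousLinearMap (σ (expSL a hs 1))‖ ^ 2 ^ m := by
  have : CompleteSpace H := FiniteDimensional.complete ℂ H
  have h1 : IsSelfAdjoint (LinearMap.toContinuousLinearMap (σ (expSL a hs 1))) :=
    ContinuousLinearMap.isSelfAdjoint_iff_isSymmetric.2 fun v w => h.inner_expSL hπ a hs v w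
  rw [← h1.norm_pow_two_pow]
  congr 1
  rw [map_pow]
  exact map_pow (Module.End.toContinuousLinearMap H) (σ (expSL a hs 1)) (2 ^ m)

theorem norm_mul_extension (h : IsHolomorphicExtension π σ) (hπ : IsContUnitary π) (U W : SU n)
    (A : SL n) : ‖LinearMap.toContinuousLinearMap (σ (toSL n U * A * toSL n W))‖
      = ‖LinearMap.toContinuousLinearMap (σ A)‖ :=
  norm_mul_isometry (fun g v => by rw [h.2, hπ.1]) U W A

theorem hwRepC_norm_expSL_pow (a : Fin (n - 1) → ℕ) (c : Fin n → ℝ) (hs : ∑ i, c i = 0) (m : ℕ) :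
    ‖LinearMap.toContinuousLinearMap (hwRepC n a (expSL c hs 1 ^ 2 ^ m))‖
      = ‖LinearMap.toContinuousLinearMap (hwRepC n a (expSL c hs 1))‖ ^ 2 ^ m :=
  IsHolomorphicExtension.norm_pow_expSL (H := HWSpace n a) isHolomorphicExtension_hwRepC
    isContUnitary_hwRep c hs m

theorem norm_toContinuousLinearMap_nonneg {V : Type*} [NormedAddCommGroup V]
    [InnerProductSpace ℂ V] [FiniteDimensional ℂ V] (T : V →ₗ[ℂ] V) :
    0 ≤ ‖LinearMap.toContinuousLinearMap T‖ := norm_nonneg _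

theorem norm_inner_map_le {V : Type*} [NormedAddCommGroup V] [InnerProductSpace ℂ V]
    [FiniteDimensional ℂ V] (T : V →ₗ[ℂ] V) {b : ℝ} (hT : ‖LinearMap.toContinuousLinearMap T‖ ≤ b)
    (v w : V) : ‖inner ℂ w (T v)‖ ≤ ‖w‖ * ‖v‖ * b := by
  have h2 := (LinearMap.toContinuousLinearMap T).le_of_opNorm_le hT v
  calc ‖inner ℂ w (T v)‖ ≤ ‖w‖ * ‖T v‖ := norm_inner_le_norm _ _
    _ ≤ ‖w‖ * (b * ‖v‖) := mul_le_mul_of_nonneg_left h2 (norm_nonneg _)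
    _ = _ := by ring

theorem exists_growth_coeffFun (p : UnitaryIrrep (SU n)) {V : Type*} [NormedAddCommGroup V]
    [InnerProductSpace ℂ V] [FiniteDimensional ℂ V] {π : Representation ℂ (SU n) V}
    {σ : Representation ℂ (SL n) V} (h : IsHolomorphicExtension π σ)
    (hp : UnitarilyEquivalent p.rep π) (x y : EuclideanSpace ℂ (Fin p.dim)) :
    ∃ F : SL n → ℂ, IsHolomorphic F ∧
      (∀ g, F (toSL n g) = coeffFun p.isContUnitary x y g) ∧ ∃ C : ℝ, 0 ≤ C ∧
      ∀ (A : SL n) (b : ℝ), ‖LinearMap.toContinuousLinearMap (σ A)‖ ≤ b → ‖F A‖ ≤ C * b := by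
  obtain ⟨U, hU⟩ := hp
  refine ⟨fun A => inner ℂ (U y) (σ A (U x)), isHolomorphic_inner h.1 _ _, fun g => ?_,
    ‖U y‖ * ‖U x‖, by positivity, fun A b hA => norm_inner_map_le _ hA (U x) (U y)⟩
  dsimp only
  rw [h.2, ← hU, U.inner_map_map]
  rfl

/-- Elements of the `k`-th power of the span of the coefficients of the `π_j` have holomorphic
extensions of growth `max_j ‖π_j‖ ^ k`. -/
theorem exists_growth {f : C(SU n, ℂ)} {k : ℕ} (hf : f ∈ coeffSpan (generators n) ^ k) :
    ∃ F : SL n → ℂ, IsHolomorphic F ∧ (∀ g, F (toSL n g) = f g) ∧ ∃ C : ℝ, 0 ≤ C ∧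
      ∀ (A : SL n) (b : ℝ), 0 ≤ b →
        (∀ j, ‖LinearMap.toContinuousLinearMap (hwRepC n (Pi.single j 1) A)‖ ≤ b) →
        ‖F A‖ ≤ C * b ^ k := by
  have h1 : ∀ f ∈ coeffSpan (generators n),
      ∃ F : SL n → ℂ, IsHolomorphic F ∧ (∀ g, F (toSL n g) = f g) ∧ ∃ C : ℝ, 0 ≤ C ∧
      ∀ (A : SL n) (b : ℝ), 0 ≤ b →
        (∀ j, ‖LinearMap.toContinuousLinearMap (hwRepC n (Pi.single j 1) A)‖ ≤ b) →
        ‖F A‖ ≤ C * b := by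
    intro f hf
    induction hf using Submodule.span_induction with
    | mem f hf =>
      obtain ⟨p, ⟨j, U, hU⟩, x, y, rfl⟩ := hf
      obtain ⟨F, hF, hFf, C, hC, hFC⟩ := exists_growth_coeffFun (V := HWSpace n (Pi.single j 1))
        p.irrep isHolomorphicExtension_hwRepC ⟨U, hU⟩ x y
      exact ⟨F, hF, hFf, C, hC, fun A b _ hA => hFC A b (hA j)⟩
    | zero => exact ⟨_, isHolomorphic_const 0, fun g => rfl, 0, le_rfl, by simp⟩
    | add f g _ _ hf hg =>
      obtain ⟨F, hF, hFf, C, hC, hFC⟩ := hf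
      obtain ⟨F', hF', hFf', C', hC', hFC'⟩ := hg
      refine ⟨_, hF.add hF', fun g => by rw [hFf, hFf']; rfl, C + C', add_nonneg hC hC',
        fun A b hb hA => (norm_add_le _ _).trans ?_⟩
      rw [add_mul]
      exact add_le_add (hFC A b hb hA) (hFC' A b hb hA)
    | smul c f _ hf =>
      obtain ⟨F, hF, hFf, C, hC, hFC⟩ := hf
      refine ⟨_, (isHolomorphic_const c).mul hF, fun g => by rw [hFf]; rfl, ‖c‖ * C, by positivity,
        fun A b hb hA => ?_⟩
      rw [norm_mul, mul_assoc]
      exact mul_le_mul_of_nonneg_left (hFC A b hb hA) (norm_nonneg _)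
  induction hf using Submodule.pow_induction_on_left' with
  | algebraMap c =>
    exact ⟨_, isHolomorphic_const c, fun g => rfl, ‖c‖, norm_nonneg _, by simp⟩
  | add f g i _ _ hf hg =>
    obtain ⟨F, hF, hFf, C, hC, hFC⟩ := hf
    obtain ⟨F', hF', hFf', C', hC', hFC'⟩ := hg
    refine ⟨_, hF.add hF', fun g => by rw [hFf, hFf']; rfl, C + C', add_nonneg hC hC',
      fun A b hb hA => (norm_add_le _ _).trans ?_⟩
    rw [add_mul]
    exact add_le_add (hFC A b hb hA) (hFC' A b hb hA)
  | mem_mul m hm i f _ hf =>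
    obtain ⟨F, hF, hFf, C, hC, hFC⟩ := h1 m hm
    obtain ⟨F', hF', hFf', C', hC', hFC'⟩ := hf
    refine ⟨_, hF.mul hF', fun g => by rw [hFf, hFf']; rfl, C * C', mul_nonneg hC hC',
      fun A b hb hA => ?_⟩
    rw [norm_mul, pow_succ']
    calc _ ≤ (C * b) * (C' * b ^ i) := mul_le_mul (hFC A b hb hA) (hFC' A b hb hA)
          (norm_nonneg _) (by positivity)
      _ = _ := by ring

theorem le_of_pow_two_pow_le {x y C : ℝ} (hy : 0 ≤ y)
    (h : ∀ m : ℕ, x ^ 2 ^ m ≤ C * y ^ 2 ^ m) : x ≤ y := by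
  by_contra hxy
  push Not at hxy
  rcases hy.eq_or_lt with rfl | hy
  · have := h 0
    simp at this
    linarith
  have h1 : 1 < x / y := (one_lt_div hy).2 hxy
  have h2 : Filter.Tendsto (fun m : ℕ => (x / y) ^ 2 ^ m) Filter.atTop Filter.atTop :=
    (tendsto_pow_atTop_atTop_of_one_lt h1).comp
      (tendsto_pow_atTop_atTop_of_one_lt one_lt_two)
  obtain ⟨m, hm⟩ := (h2.eventually_gt_atTop C).exists
  rw [div_pow, lt_div_iff₀ (by positivity)] at hm
  exact absurd (h m) (not_le.2 hm)

theorem norm_le_of_norm_inner_le {ι : Type*} [Fintype ι] (b : OrthonormalBasis ι ℂ H)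
    (T : H →L[ℂ] H) {C : ι → ι → ℝ} (h : ∀ i j, ‖inner ℂ (b i) (T (b j))‖ ≤ C i j) :
    ‖T‖ ≤ ∑ j, ∑ i, C i j := by
  have hC : ∀ i j, 0 ≤ C i j := fun i j => (norm_nonneg _).trans (h i j)
  refine T.opNorm_le_bound (Finset.sum_nonneg fun j _ => Finset.sum_nonneg fun i _ => hC i j)
    fun v => ?_
  conv_lhs => rw [← b.sum_repr' v, map_sum]
  rw [Finset.sum_mul]
  refine (norm_sum_le _ _).trans (Finset.sum_le_sum fun j _ => ?_)
  rw [map_smul, norm_smul, mul_comm]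
  have h1 : ‖T (b j)‖ ≤ ∑ i, C i j := by
    conv_lhs => rw [← b.sum_repr' (T (b j))]
    refine (norm_sum_le _ _).trans (Finset.sum_le_sum fun i _ => ?_)
    rw [norm_smul, b.orthonormal.1 i, mul_one]
    exact h i j
  refine mul_le_mul h1 ?_ (norm_nonneg _) (Finset.sum_nonneg fun i _ => hC i j)
  refine (norm_inner_le_norm _ _).trans ?_
  rw [b.orthonormal.1 j, one_mul]

/-- Expressing coefficients of `p` by the generators gives the bound only up to a constant. On the
positive diagonal part of `A` the bound applies to every power `2 ^ m`, where both sides are exact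
powers, and taking roots eliminates the constant. -/
theorem norm_extension_le (hn : 1 ≤ n) (p : UnitaryDual (SU n))
    {σ : Representation ℂ (SL n) (EuclideanSpace ℂ (Fin p.irrep.dim))}
    (h : IsHolomorphicExtension p.irrep.rep σ) {A : SL n} {β : ℝ} (hβ : 0 ≤ β)
    (hA : ∀ j, ‖LinearMap.toContinuousLinearMap (hwRepC n (Pi.single j 1) A)‖ ≤ β) :
    ‖LinearMap.toContinuousLinearMap (σ A)‖ ≤ β ^ lengthFun (generators n) p := by
  obtain ⟨U, V, a, hs, -, rfl⟩ := exists_cartan hn A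
  rw [norm_mul_extension h p.irrep.isContUnitary]
  have hA' : ∀ j, ‖LinearMap.toContinuousLinearMap
      (hwRepC n (Pi.single j 1) (expSL a hs 1))‖ ≤ β := by
    intro j
    have h1 := hA j
    rwa [norm_hwRepC_mul] at h1
  let b := EuclideanSpace.basisFun (Fin p.irrep.dim) ℂ
  have hg : ∀ i j, ∃ C : ℝ, 0 ≤ C ∧ ∀ (A : SL n) (c : ℝ), 0 ≤ c →
        (∀ j, ‖LinearMap.toContinuousLinearMap (hwRepC n (Pi.single j 1) A)‖ ≤ c) →
        ‖inner ℂ (b i) (σ A (b j))‖ ≤ C * c ^ lengthFun (generators n) p := by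
    intro i j
    obtain ⟨F, hF, hFf, C, hC, hFC⟩ := exists_growth
      (coeffFun_mem_pow_lengthFun (dense_adjoin_coeffSet hn) p (b j) (b i))
    refine ⟨C, hC, fun A c hc hA => ?_⟩
    rw [IsHolomorphic.ext hn (isHolomorphic_inner h.1 (b j) (b i)) hF (fun g => ?_) A]
    · exact hFC A c hc hA
    · rw [hFf, h.2]
      rfl
  choose C hC hCb using hg
  refine le_of_pow_two_pow_le (C := ∑ j, ∑ i, C i j) (by positivity) fun m => ?_
  rw [← h.norm_pow_expSL p.irrep.isContUnitary]
  refine (norm_le_of_norm_inner_le b _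
    (C := fun i j => C i j * (β ^ lengthFun (generators n) p) ^ 2 ^ m) fun i j => ?_).trans (le_of_eq ?_)
  · have h2 := hCb i j (expSL a hs 1 ^ 2 ^ m) (β ^ 2 ^ m) (by positivity) fun k => by
      have h3 := norm_toContinuousLinearMap_nonneg (V := HWSpace n (Pi.single k 1))
        (hwRepC n (Pi.single k 1) (expSL a hs 1))
      exact (hwRepC_norm_expSL_pow _ _ _ _).trans_le (pow_le_pow_left₀ h3 (hA' k) _)
    rw [pow_right_comm] at h2
    exact h2
  · simp only [Finset.sum_mul]

end Extension

end BeurlingFourier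

end

noncomputable section

set_option linter.unusedSectionVars false

open MeasureTheory Matrix
open scoped TensorProduct

namespace BeurlingFourier

/-! ### The set of matrices bounded in the fundamental representations -/

section SpectralSet

variable {n : ℕ} {β : ℝ}

theorem norm_hwRepC_single_diagonal {D : SL n} {x : Fin n → ℂ} (hD : D.1 = Matrix.diagonal x)
    (hx : Antitone fun i => ‖x i‖) (k : Fin (n - 1)) :
    ‖LinearMap.toContinuousLinearMap (hwRepC n (Pi.single k 1) D)‖
      = ‖∏ i with i.val ≤ k.val, x i‖ := by
  rw [norm_hwRepC_diagonal hD hx, Finset.prod_eq_single k]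
  · rw [Pi.single_eq_same, pow_one]
  · intro j _ hj
    rw [Pi.single_eq_of_ne hj, pow_zero]
  · simp

/-- Together with `norm_le_of_mem_spectralSet`, this describes the spectral set by norms in the
fundamental representations: on the ordered diagonal part these norms are the partial products. -/
theorem mem_spectralSet_of_norm_le (hn : 1 ≤ n) {A : SL n}
    (h : ∀ k, ‖LinearMap.toContinuousLinearMap (hwRepC n (Pi.single k 1) A)‖ ≤ β) :
    A ∈ spectralSet n β := by
  obtain ⟨U, V, a, hs, ha, rfl⟩ := exists_cartan hn A
  have hx : Antitone fun i => ‖Complex.exp (1 * (a i : ℂ))‖ := by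
    intro i j hij
    simp only [one_mul, Complex.norm_exp_ofReal]
    exact Real.exp_le_exp.2 (ha hij)
  refine ⟨U, V, expSL a hs 1, _, coe_expSL a hs 1, hx, fun k => ?_, rfl⟩
  rw [← norm_hwRepC_single_diagonal (coe_expSL a hs 1) hx, ← norm_hwRepC_mul U V]
  exact h k

theorem norm_le_of_mem_spectralSet {A : SL n} (hA : A ∈ spectralSet n β) (k : Fin (n - 1)) :
    ‖LinearMap.toContinuousLinearMap (hwRepC n (Pi.single k 1) A)‖ ≤ β := by
  obtain ⟨U, V, D, x, hD, hx, hk, rfl⟩ := hA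
  rw [norm_hwRepC_mul, norm_hwRepC_single_diagonal hD hx]
  exact hk k

/-- Since the total product is one, the inverse of the product of the last `k + 1` entries is the
product of the first `n - 1 - k`; this is the duality between `Λ^{k+1}` and `Λ^{n-1-k}`. -/
theorem prod_rev_inv_eq {x : Fin n → ℂ} (hx : ∏ i, x i = 1) (k : Fin (n - 1)) :
    ∏ i with i.val ≤ k.val, (x (Fin.rev i))⁻¹ = ∏ i with i.val ≤ (Fin.rev k).val, x i := by
  have h1 : ∏ i with i.val ≤ k.val, (x (Fin.rev i))⁻¹
      = (∏ i with ¬ (i.val ≤ (Fin.rev k).val), x i)⁻¹ := by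
    rw [Finset.prod_inv_distrib]
    congr 1
    refine Finset.prod_bij (fun i _ => Fin.rev i) ?_ ?_ ?_ ?_
    · intro i hi
      simp only [Finset.mem_filter, Finset.mem_univ, true_and, Fin.val_rev] at hi ⊢
      omega
    · intro i _ j _ h
      exact Fin.rev_injective h
    · intro i hi
      refine ⟨Fin.rev i, ?_, Fin.rev_rev i⟩
      simp only [Finset.mem_filter, Finset.mem_univ, true_and, Fin.val_rev] at hi ⊢
      omega
    · intro i _
      rfl
  rw [h1, inv_eq_iff_eq_inv]
  refine eq_inv_of_mul_eq_one_right ?_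
  rw [Finset.prod_filter_mul_prod_filter_not, hx]

/-- Inverting reverses the order of the moduli; conjugation by the order-reversing permutation
matrix restores it, and the partial products are merely permuted. -/
theorem inv_mem_spectralSet (hn : 1 ≤ n) {A : SL n} (hA : A ∈ spectralSet n β) :
    A⁻¹ ∈ spectralSet n β := by
  obtain ⟨U, V, D, x, hD, hx, hk, rfl⟩ := hA
  have hx1 : ∏ i, x i = 1 := by
    have := D.2
    rwa [hD, Matrix.det_diagonal] at this
  have hx0 : ∀ i, x i ≠ 0 := fun i => by
    have h : ∏ i, x i ≠ 0 := by rw [hx1]; exact one_ne_zero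
    exact Finset.prod_ne_zero_iff.1 h i (Finset.mem_univ i)
  obtain ⟨g, ε, -, hg⟩ := exists_SU_perm hn Fin.revPerm
  have hD'det : (Matrix.diagonal fun i => (x (Fin.rev i))⁻¹).det = 1 := by
    rw [Matrix.det_diagonal, Finset.prod_inv_distrib, inv_eq_one, ← hx1]
    exact Equiv.prod_comp Fin.revPerm x
  obtain ⟨D', hD'⟩ : ∃ D' : SL n, D'.1 = Matrix.diagonal fun i => (x (Fin.rev i))⁻¹ :=
    ⟨⟨_, hD'det⟩, rfl⟩
  have hcomm : D * toSL n g * D' = toSL n g := by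
    apply Subtype.ext
    rw [Matrix.SpecialLinearGroup.coe_mul, Matrix.SpecialLinearGroup.coe_mul, hD, hD']
    ext i j
    rw [Matrix.mul_diagonal, Matrix.diagonal_mul, coe_toSL, hg]
    split_ifs with h
    · rw [h, Fin.revPerm_apply, mul_right_comm, mul_inv_cancel₀ (hx0 _), one_mul]
    · simp
  have hinv : D⁻¹ = toSL n g * D' * toSL n g⁻¹ := by
    rw [inv_eq_iff_mul_eq_one, ← mul_assoc, ← mul_assoc, hcomm, map_inv, mul_inv_cancel]
  refine ⟨V⁻¹ * g, g⁻¹ * U⁻¹, D', _, hD', fun i j hij => ?_, fun k => ?_, ?_⟩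
  · simp only [norm_inv]
    exact inv_anti₀ (norm_pos_iff.2 (hx0 _)) (hx (Fin.rev_le_rev.2 hij))
  · rw [prod_rev_inv_eq hx1]
    exact hk _
  · rw [_root_.mul_inv_rev, _root_.mul_inv_rev, hinv]
    simp only [map_mul, map_inv, mul_assoc]

end SpectralSet

theorem IsHolomorphic.continuous {n : ℕ} {E : Type*} [NormedAddCommGroup E] [NormedSpace ℂ E]
    {f : SL n → E} (hf : IsHolomorphic f) : Continuous f := by
  have hc : Continuous fun (x : SL n) i j => x.1 i j :=
    continuous_pi fun i => continuous_pi fun j => continuous_subtype_val.matrix_elem i j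
  refine continuous_iff_continuousAt.2 fun x => ?_
  obtain ⟨U, F, hU, hx, hF, h⟩ := hf x
  have h1 : ContinuousAt (fun x : SL n => F fun i j => x.1 i j) x :=
    ContinuousAt.comp (f := fun (x : SL n) i j => x.1 i j)
      (hF.continuousOn.continuousAt (hU.mem_nhds hx)) hc.continuousAt
  refine h1.congr ?_
  filter_upwards [hc.continuousAt.preimage_mem_nhds (hU.mem_nhds hx)] with y hy
  exact h y hy

/-- Duality of operator norm and trace norm, read off by computing the trace in a singular basis of
`T`. -/
theorem norm_trace_comp_le {V : Type*} [NormedAddCommGroup V] [InnerProductSpace ℂ V]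
    [FiniteDimensional ℂ V] (B T : V →ₗ[ℂ] V) :
    ‖LinearMap.trace ℂ V (B ∘ₗ T)‖ ≤ ‖LinearMap.toContinuousLinearMap B‖ * traceNorm T := by
  obtain ⟨u, -, hu⟩ := exists_singularBasis T
  rw [LinearMap.trace_eq_sum_inner _ u, hu, Finset.mul_sum]
  refine (norm_sum_le _ _).trans (Finset.sum_le_sum fun i _ => ?_)
  refine (norm_inner_le_norm _ _).trans ?_
  rw [u.orthonormal.1 i, one_mul]
  exact (LinearMap.toContinuousLinearMap B).le_opNorm (T (u i))

/-! ### The characters defined by matrices -/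

section Character

variable {n : ℕ}

/-- The holomorphic extension of an irreducible representation. -/
def extRep (hn : 1 ≤ n) (p : UnitaryDual (SU n)) :
    Representation ℂ (SL n) (EuclideanSpace ℂ (Fin p.irrep.dim)) :=
  (exists_isHolomorphicExtension hn p.irrep.isContUnitary).choose

theorem isHolomorphicExtension_extRep (hn : 1 ≤ n) (p : UnitaryDual (SU n)) :
    IsHolomorphicExtension p.irrep.rep (extRep hn p) :=
  (exists_isHolomorphicExtension hn p.irrep.isContUnitary).choose_spec

/-- The term `d_p Tr(p_ℂ(A⁻¹) f̂(p))` of the Fourier series of `f` at `A`. -/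
def seriesTerm (hn : 1 ≤ n) (A : SL n) (f : C(SU n, ℂ)) (p : UnitaryDual (SU n)) : ℂ :=
  p.irrep.dim * LinearMap.trace ℂ _ (extRep hn p A⁻¹ ∘ₗ (fourierCoeff f p.irrep).toLinearMap)

theorem seriesTerm_add (hn : 1 ≤ n) (A : SL n) (f g : C(SU n, ℂ)) (p : UnitaryDual (SU n)) :
    seriesTerm hn A (f + g) p = seriesTerm hn A f p + seriesTerm hn A g p := by
  rw [seriesTerm, fourierCoeff_add, ContinuousLinearMap.toLinearMap_add, LinearMap.comp_add,
    map_add, mul_add]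
  rfl

theorem seriesTerm_smul (hn : 1 ≤ n) (A : SL n) (c : ℂ) (f : C(SU n, ℂ))
    (p : UnitaryDual (SU n)) : seriesTerm hn A (c • f) p = c * seriesTerm hn A f p := by
  rw [seriesTerm, fourierCoeff_smul, ContinuousLinearMap.toLinearMap_smul, LinearMap.comp_smul,
    map_smul, smul_eq_mul, mul_left_comm]
  rfl

theorem isHolomorphic_seriesTerm (hn : 1 ≤ n) (f : C(SU n, ℂ)) (p : UnitaryDual (SU n)) :
    IsHolomorphic fun A => seriesTerm hn A f p := by
  have h : (fun A => seriesTerm hn A f p) = fun A => (p.irrep.dim : ℂ) * ∑ i,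
      inner ℂ (EuclideanSpace.basisFun (Fin p.irrep.dim) ℂ i)
        (extRep hn p A⁻¹ (fourierCoeff f p.irrep (EuclideanSpace.basisFun _ ℂ i))) := by
    funext A
    rw [seriesTerm, LinearMap.trace_eq_sum_inner _ (EuclideanSpace.basisFun (Fin p.irrep.dim) ℂ)]
    rfl
  rw [h]
  exact (isHolomorphic_const _).mul (isHolomorphic_sum _ fun i =>
    (isHolomorphic_inner (isHolomorphicExtension_extRep hn p).1 _ _).comp_inv)

theorem seriesTerm_antiCoeff_ne (hn : 1 ≤ n) (A : SL n) {p q : UnitaryDual (SU n)} (h : p ≠ q)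
    (x y : EuclideanSpace ℂ (Fin p.irrep.dim)) :
    seriesTerm hn A (antiCoeff p.irrep.isContUnitary x y) q = 0 := by
  rw [seriesTerm, fourierCoeff_antiCoeff_ne h, ContinuousLinearMap.toLinearMap_zero,
    LinearMap.comp_zero, map_zero, mul_zero]

theorem seriesTerm_antiCoeff_self (hn : 1 ≤ n) (A : SL n) (p : UnitaryDual (SU n))
    (x y : EuclideanSpace ℂ (Fin p.irrep.dim)) :
    seriesTerm hn A (antiCoeff p.irrep.isContUnitary x y) p = inner ℂ x (extRep hn p A⁻¹ y) := by
  have hd : (p.irrep.dim : ℂ) ≠ 0 := dim_ne_zero p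
  rw [seriesTerm, LinearMap.trace_eq_sum_inner _ (EuclideanSpace.basisFun (Fin p.irrep.dim) ℂ),
    ← (EuclideanSpace.basisFun (Fin p.irrep.dim) ℂ).sum_inner_mul_inner x (extRep hn p A⁻¹ y),
    Finset.mul_sum]
  refine Finset.sum_congr rfl fun i _ => ?_
  rw [LinearMap.comp_apply, ContinuousLinearMap.coe_coe, fourierCoeff_antiCoeff_self, map_smul,
    inner_smul_right]
  field_simp

variable {β : ℝ} (hβ : 1 ≤ β)

theorem norm_extRep_inv_le (hn : 1 ≤ n) {A : SL n} (hA : A ∈ spectralSet n β)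
    (p : UnitaryDual (SU n)) : ‖LinearMap.toContinuousLinearMap (extRep hn p A⁻¹)‖
      ≤ (expWeight (generators n) β hβ p : ℝ) :=
  norm_extension_le hn p (isHolomorphicExtension_extRep hn p) (zero_le_one.trans hβ)
    (norm_le_of_mem_spectralSet (inv_mem_spectralSet hn hA))

/-- The majorant does not depend on `A`, so it yields at once convergence, contractivity and, by
uniform convergence, continuity in `A`. -/
theorem norm_seriesTerm_le (hn : 1 ≤ n) {A : SL n} (hA : A ∈ spectralSet n β) (f : C(SU n, ℂ))
    (p : UnitaryDual (SU n)) :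
    ‖seriesTerm hn A f p‖ ≤ bfTerm (expWeight (generators n) β hβ) f p := by
  rw [seriesTerm, bfTerm, norm_mul, Complex.norm_natCast, mul_assoc]
  refine mul_le_mul_of_nonneg_left ((norm_trace_comp_le _ _).trans ?_) (Nat.cast_nonneg _)
  exact mul_le_mul_of_nonneg_right (norm_extRep_inv_le hβ hn hA p) (traceNorm_nonneg _)

theorem summable_seriesTerm (hn : 1 ≤ n) {A : SL n} (hA : A ∈ spectralSet n β)
    (f : beurlingFourier (expWeight (generators n) β hβ)) : Summable (seriesTerm hn A f) :=
  Summable.of_norm_bounded f.2 (norm_seriesTerm_le hβ hn hA f)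

/-- The linear functional `f ↦ ∑_p d_p Tr(p_ℂ(A⁻¹) f̂(p))`. -/
def character (hn : 1 ≤ n) (A : spectralSet n β) :
    beurlingFourier (expWeight (generators n) β hβ) →ₗ[ℂ] ℂ where
  toFun f := ∑' p, seriesTerm hn A.1 f p
  map_add' f g := by
    rw [← (summable_seriesTerm hβ hn A.2 f).tsum_add (summable_seriesTerm hβ hn A.2 g)]
    exact tsum_congr fun p => seriesTerm_add hn A.1 f.1 g.1 p
  map_smul' c f := by
    rw [RingHom.id_apply, smul_eq_mul, ← tsum_mul_left]
    exact tsum_congr fun p => seriesTerm_smul hn A.1 c f.1 p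

theorem character_apply (hn : 1 ≤ n) (A : spectralSet n β)
    (f : beurlingFourier (expWeight (generators n) β hβ)) :
    character hβ hn A f = ∑' p, seriesTerm hn A.1 f p := rfl

theorem norm_character_le (hn : 1 ≤ n) (A : spectralSet n β)
    (f : beurlingFourier (expWeight (generators n) β hβ)) :
    ‖character hβ hn A f‖ ≤ bfNorm _ f :=
  tsum_of_norm_bounded (Summable.hasSum f.2) (norm_seriesTerm_le hβ hn A.2 f)

theorem continuous_character (hn : 1 ≤ n)
    (f : beurlingFourier (expWeight (generators n) β hβ)) :
    Continuous fun A : spectralSet n β => character hβ hn A f := by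
  simp only [character_apply]
  exact continuous_tsum
    (fun p => (isHolomorphic_seriesTerm hn f.1 p).continuous.comp continuous_subtype_val)
    f.2 fun p A => norm_seriesTerm_le hβ hn A.2 f.1 p

/-- On trigonometric polynomials, `character A` is evaluation of the holomorphic extension. -/
theorem character_eq (hn : 1 ≤ n) (A : spectralSet n β)
    (f : beurlingFourier (expWeight (generators n) β hβ)) (hf : f.1 ∈ trigPoly (SU n))
    {F : SL n → ℂ} (hF : IsHolomorphic F) (hFf : ∀ g, F (toSL n g) = f.1 g) :
    character hβ hn A f = F A := by
  suffices h : ∀ f ∈ trigPoly (SU n), ∃ F : SL n → ℂ, IsHolomorphic F ∧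
      (∀ g, F (toSL n g) = f g) ∧ ∀ hf : f ∈ beurlingFourier (expWeight (generators n) β hβ),
        character hβ hn A ⟨f, hf⟩ = F A by
    obtain ⟨F', hF', hFf', h'⟩ := h f.1 hf
    rw [h' f.2, hF'.ext hn hF (fun g => by rw [hFf, hFf'])]
  intro f hf
  induction hf using Submodule.span_induction with
  | mem f hf =>
    obtain ⟨p, x, y, rfl⟩ := hf
    refine ⟨fun A => inner ℂ x (extRep hn p A⁻¹ y),
      (isHolomorphic_inner (isHolomorphicExtension_extRep hn p).1 _ _).comp_inv, fun g => ?_,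
      fun hf => ?_⟩
    · dsimp only
      rw [← map_inv, (isHolomorphicExtension_extRep hn p).2, ← inner_conj_symm,
        p.irrep.isContUnitary.inner_inv, inner_conj_symm]
      rfl
    · rw [character_apply, tsum_eq_single p, seriesTerm_antiCoeff_self]
      intro q hq
      exact seriesTerm_antiCoeff_ne hn A.1 hq.symm x y
  | zero => exact ⟨_, isHolomorphic_const 0, fun g => rfl, fun hf => map_zero _⟩
  | add f g hf' hg' hf hg =>
    obtain ⟨F, hF, hFf, h⟩ := hf
    obtain ⟨F', hF', hFf', h'⟩ := hg
    refine ⟨_, hF.add hF', fun g => by rw [hFf, hFf']; rfl, fun hf => ?_⟩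
    rw [← h (trigPoly_le_beurlingFourier hf'), ← h' (trigPoly_le_beurlingFourier hg'), ← map_add]
    rfl
  | smul c f hf' hf =>
    obtain ⟨F, hF, hFf, h⟩ := hf
    refine ⟨_, (isHolomorphic_const c).mul hF, fun g => by rw [hFf]; rfl, fun hf => ?_⟩
    rw [← h (trigPoly_le_beurlingFourier hf'), ← smul_eq_mul, ← map_smul]
    rfl

theorem character_one (hn : 1 ≤ n) (A : spectralSet n β)
    (h : (1 : C(SU n, ℂ)) ∈ beurlingFourier (expWeight (generators n) β hβ)) :
    character hβ hn A ⟨1, h⟩ = 1 :=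
  character_eq hβ hn A _ one_mem_trigPoly (isHolomorphic_const 1) fun _ => rfl

theorem character_mul (hn : 1 ≤ n) (A : spectralSet n β)
    (f g : beurlingFourier (expWeight (generators n) β hβ))
    (h : (f * g : C(SU n, ℂ)) ∈ beurlingFourier (expWeight (generators n) β hβ)) :
    character hβ hn A ⟨f * g, h⟩ = character hβ hn A f * character hβ hn A g := by
  refine map_mul_of_map_mul_trigPoly (dense_trigPoly hn) (one_le_expWeight _ β hβ)
    (isSubmultWeight_expWeight (dense_adjoin_coeffSet hn) β hβ) (character hβ hn A) (C := 1)
    (fun f => by rw [one_mul]; exact norm_character_le hβ hn A f) (fun f g h hf hg => ?_) f g h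
  obtain ⟨F, hF, hFf⟩ := exists_isHolomorphic_of_mem_trigPoly hn hf
  obtain ⟨F', hF', hFg⟩ := exists_isHolomorphic_of_mem_trigPoly hn hg
  rw [character_eq hβ hn A f hf hF hFf, character_eq hβ hn A g hg hF' hFg]
  exact character_eq hβ hn A _ (trigPoly_mul_mem hf hg) (hF.mul hF') fun u => by
    rw [hFf, hFg]; rfl

/-- The point of the spectrum defined by `A`. -/
def toSpec (hn : 1 ≤ n) (A : spectralSet n β) : Spec (expWeight (generators n) β hβ) :=
  ⟨character hβ hn A, fun h => by
      have h1 := character_one hβ hn A (trigPoly_le_beurlingFourier one_mem_trigPoly)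
      rw [h] at h1
      exact zero_ne_one h1,
    character_mul hβ hn A, 1, fun f => by rw [one_mul]; exact norm_character_le hβ hn A f⟩

theorem polyAlg_subset_beurlingFourier (hn : 1 ≤ n) {f : C(SU n, ℂ)} (hf : f ∈ polyAlg n) :
    f ∈ beurlingFourier (expWeight (generators n) β hβ) :=
  trigPoly_le_beurlingFourier (polyAlg_subset_trigPoly hn hf)

theorem character_entryFun (hn : 1 ≤ n) (A : spectralSet n β) (i j : Fin n) :
    character hβ hn A ⟨entryFun i j,
      polyAlg_subset_beurlingFourier hβ hn (entryFun_mem_polyAlg i j)⟩ = A.1.1 i j :=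
  character_eq hβ hn A _ (polyAlg_subset_trigPoly hn (entryFun_mem_polyAlg i j))
    (isHolomorphic_entry i j) fun _ => rfl

end Character

end BeurlingFourier

end

noncomputable section

set_option linter.unusedSectionVars false

open MeasureTheory Matrix
open scoped TensorProduct

namespace BeurlingFourier

/-! ### The Gelfand spectrum -/

section Spectrum

variable {n : ℕ} {β : ℝ} {hβ : 1 ≤ β}

theorem mul_mem_beurlingFourier_SU (hn : 1 ≤ n)
    (f g : beurlingFourier (expWeight (generators n) β hβ)) :
    (f * g : C(SU n, ℂ)) ∈ beurlingFourier (expWeight (generators n) β hβ) :=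
  mul_mem_beurlingFourier (dense_trigPoly hn) (one_le_expWeight _ β hβ)
    (isSubmultWeight_expWeight (dense_adjoin_coeffSet hn) β hβ) f.2 g.2

/-- Points of the spectrum are contractive. -/
theorem Spec.norm_le (hn : 1 ≤ n) (φ : Spec (expWeight (generators n) β hβ))
    (f : beurlingFourier (expWeight (generators n) β hβ)) : ‖φ.1 f‖ ≤ bfNorm _ f := by
  obtain ⟨C, hC⟩ := φ.2.2.2
  -- The bound with constant `C` is applied to iterated squares of `f`; taking `2 ^ m`-th roots then
  -- removes `C`.
  have h : ∀ (m : ℕ) (f : beurlingFourier (expWeight (generators n) β hβ)),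
      ‖φ.1 f‖ ^ 2 ^ m ≤ |C| * bfNorm _ f ^ 2 ^ m := by
    intro m
    induction m with
    | zero =>
      intro f
      rw [pow_zero, pow_one, pow_one]
      exact (hC f).trans (mul_le_mul_of_nonneg_right (le_abs_self C) (bfNorm_nonneg f))
    | succ m ih =>
      intro f
      have h1 := ih ⟨f * f, mul_mem_beurlingFourier_SU hn f f⟩
      rw [φ.2.2.1, norm_mul, ← sq, ← pow_mul, ← pow_succ'] at h1
      refine h1.trans (mul_le_mul_of_nonneg_left ?_ (abs_nonneg C))
      rw [pow_succ', pow_mul]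
      refine pow_le_pow_left₀ (bfNorm_nonneg _) ?_ _
      rw [sq]
      exact bfNorm_mul_le (dense_trigPoly hn) (one_le_expWeight _ β hβ)
        (isSubmultWeight_expWeight (dense_adjoin_coeffSet hn) β hβ) f f _
  exact le_of_pow_two_pow_le (bfNorm_nonneg f) fun m => h m f

theorem Spec.map_one (φ : Spec (expWeight (generators n) β hβ)) :
    φ.1 ⟨1, trigPoly_le_beurlingFourier one_mem_trigPoly⟩ = 1 := by
  obtain ⟨f, hf⟩ : ∃ f, φ.1 f ≠ 0 := by
    by_contra hno
    push Not at hno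
    exact φ.2.1 (LinearMap.ext hno)
  have h1 : (f * (1 : C(SU n, ℂ)) : C(SU n, ℂ)) = f := mul_one _
  have h2 := φ.2.2.1 f ⟨1, trigPoly_le_beurlingFourier one_mem_trigPoly⟩ (by rw [h1]; exact f.2)
  have h3 : (⟨f * (1 : C(SU n, ℂ)), by rw [h1]; exact f.2⟩ :
    beurlingFourier (expWeight (generators n) β hβ)) = f := Subtype.ext h1
  rw [h3] at h2
  exact mul_left_cancel₀ hf (h2.symm.trans (mul_one _).symm)

/-- The restriction of a point of the spectrum to the polynomials in the matrix entries. -/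
def Spec.polyHom (hn : 1 ≤ n) (φ : Spec (expWeight (generators n) β hβ)) : polyAlg n →ₐ[ℂ] ℂ :=
  AlgHom.ofLinearMap
    { toFun := fun f => φ.1 ⟨f.1, polyAlg_subset_beurlingFourier hβ hn f.2⟩
      map_add' := fun f g => map_add φ.1 ⟨f.1, polyAlg_subset_beurlingFourier hβ hn f.2⟩
        ⟨g.1, polyAlg_subset_beurlingFourier hβ hn g.2⟩
      map_smul' := fun c f => map_smul φ.1 c ⟨f.1, polyAlg_subset_beurlingFourier hβ hn f.2⟩ }
    φ.map_one (fun f g => φ.2.2.1 ⟨f.1, polyAlg_subset_beurlingFourier hβ hn f.2⟩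
      ⟨g.1, polyAlg_subset_beurlingFourier hβ hn g.2⟩ _)

/-- This identity of functions on `SU(n)` makes the image of the entry matrix under any character an
element of `SL(n, ℂ)`. -/
theorem det_entryMatrix : (entryMatrix n).det = 1 := by
  refine Subtype.ext ?_
  ext g
  have h2 : polyEval g (entryMatrix n).det = 1 := by
    rw [RingHom.map_det, mapMatrix_polyEval, SU_det]
  exact h2

/-- The matrix of a point of the spectrum. -/
def Spec.toSL (hn : 1 ≤ n) (φ : Spec (expWeight (generators n) β hβ)) : SL n :=
  ⟨(φ.polyHom hn).mapMatrix (entryMatrix n), by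
    rw [← AlgHom.map_det, det_entryMatrix, _root_.map_one]⟩

/-- Both sides are compatible with the algebra operations in `f` and agree on the matrix entries by
definition of `φ.toSL`; uniqueness of the extension makes the choice of `F` irrelevant. -/
theorem Spec.polyHom_eq (hn : 1 ≤ n) (φ : Spec (expWeight (generators n) β hβ))
    {f : C(SU n, ℂ)} (hf : f ∈ polyAlg n) {F : SL n → ℂ} (hF : IsHolomorphic F)
    (hFf : ∀ g, F (BeurlingFourier.toSL n g) = f g) : φ.polyHom hn ⟨f, hf⟩ = F (φ.toSL hn) := by
  suffices h : ∃ F : SL n → ℂ, IsHolomorphic F ∧ (∀ g, F (BeurlingFourier.toSL n g) = f g) ∧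
      φ.polyHom hn ⟨f, hf⟩ = F (φ.toSL hn) by
    obtain ⟨F', hF', hFf', h'⟩ := h
    rw [h', hF'.ext hn hF (fun g => by rw [hFf, hFf'])]
  clear hF hFf F
  induction hf using Algebra.adjoin_induction with
  | mem f hf =>
    obtain ⟨ij, rfl⟩ := hf
    exact ⟨_, isHolomorphic_entry ij.1 ij.2, fun g => rfl, rfl⟩
  | algebraMap c => exact ⟨_, isHolomorphic_const c, fun g => rfl, (φ.polyHom hn).commutes c⟩
  | add f g hf' hg' hf hg =>
    obtain ⟨F, hF, h, h1⟩ := hf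
    obtain ⟨F', hF', h', h1'⟩ := hg
    exact ⟨_, hF.add hF', fun g => by rw [h, h']; rfl,
      (_root_.map_add (φ.polyHom hn).toLinearMap ⟨f, hf'⟩ ⟨g, hg'⟩).trans (congrArg₂ (· + ·) h1 h1')⟩
  | mul f g hf' hg' hf hg =>
    obtain ⟨F, hF, h, h1⟩ := hf
    obtain ⟨F', hF', h', h1'⟩ := hg
    exact ⟨_, hF.mul hF', fun g => by rw [h, h']; rfl,
      (_root_.map_mul (φ.polyHom hn) ⟨f, hf'⟩ ⟨g, hg'⟩).trans (congrArg₂ (· * ·) h1 h1')⟩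

theorem Spec.apply_eq (hn : 1 ≤ n) (φ : Spec (expWeight (generators n) β hβ))
    (f : beurlingFourier (expWeight (generators n) β hβ)) (hf : f.1 ∈ trigPoly (SU n))
    {F : SL n → ℂ} (hF : IsHolomorphic F) (hFf : ∀ g, F (BeurlingFourier.toSL n g) = f.1 g) :
    φ.1 f = F (φ.toSL hn) :=
  φ.polyHom_eq hn (trigPoly_subset_polyAlg hn hf) hF hFf

/-- Contractivity of `φ` is tested on conjugated coefficients of `p`, whose algebra norm is at most
`w(p) ‖x‖ ‖y‖`. Their holomorphic extensions involve `σ A⁻¹`, whence the inverse. -/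
theorem Spec.norm_extension_inv_le (hn : 1 ≤ n) (φ : Spec (expWeight (generators n) β hβ))
    (p : UnitaryDual (SU n)) {V : Type*} [NormedAddCommGroup V]
    [InnerProductSpace ℂ V] [FiniteDimensional ℂ V] {π : Representation ℂ (SU n) V}
    {σ : Representation ℂ (SL n) V} (h : IsHolomorphicExtension π σ)
    (hp : UnitarilyEquivalent p.irrep.rep π) :
    ‖LinearMap.toContinuousLinearMap (σ (φ.toSL hn)⁻¹)‖
      ≤ (expWeight (generators n) β hβ p : ℝ) := by
  obtain ⟨U, hU⟩ := hp
  set w : ℝ := (expWeight (generators n) β hβ p : ℝ) with hw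
  have hw0 : 0 ≤ w := le_of_lt (expWeight (generators n) β hβ p).2
  have key : ∀ x y, ‖inner ℂ (U x) (σ (φ.toSL hn)⁻¹ (U y))‖ ≤ w * (‖x‖ * ‖y‖) := by
    intro x y
    have h1 := φ.apply_eq hn ⟨antiCoeff p.irrep.isContUnitary x y,
      trigPoly_le_beurlingFourier (antiCoeff_irrep_mem p x y)⟩ (antiCoeff_irrep_mem p x y)
      (F := fun A => inner ℂ (U x) (σ A⁻¹ (U y))) (isHolomorphic_inner h.1 _ _).comp_inv
      (fun g => by
        rw [← _root_.map_inv, h.2, ← hU, U.inner_map_map, ← inner_conj_symm,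
          p.irrep.isContUnitary.inner_inv, inner_conj_symm]
        rfl)
    rw [← h1]
    exact (φ.norm_le hn _).trans (bfNorm_le (by positivity) (bfENorm_antiCoeff_le p x y))
  refine ContinuousLinearMap.opNorm_le_bound _ hw0 fun v => ?_
  rw [LinearMap.coe_toContinuousLinearMap']
  -- Pairing the image of `v` with itself converts the bound on coefficients into a bound on the
  -- operator norm.
  set u := σ (φ.toSL hn)⁻¹ v with hu
  rcases eq_or_ne u 0 with h0 | h0
  · rw [h0, norm_zero]
    positivity
  have h1 := key (U.symm u) (U.symm v)
  rw [U.apply_symm_apply, U.apply_symm_apply, ← hu, U.symm.norm_map, U.symm.norm_map,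
    inner_self_eq_norm_sq_to_K, norm_pow] at h1
  have h2 : ‖u‖ * ‖u‖ ≤ (w * ‖v‖) * ‖u‖ := by
    calc ‖u‖ * ‖u‖ = ‖((‖u‖ : ℝ) : ℂ)‖ ^ 2 := by rw [Complex.norm_real, norm_norm, sq]
      _ ≤ w * (‖u‖ * ‖v‖) := h1
      _ = _ := by ring
  exact le_of_mul_le_mul_right h2 (norm_pos_iff.2 h0)

theorem expWeight_generators_le {p : UnitaryDual (SU n)} (hp : p ∈ generators n) :
    (expWeight (generators n) β hβ p : ℝ) ≤ β := by
  have h1 : lengthFun (generators n) p ≤ 1 :=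
    lengthFun_le fun x y => by
      rw [Submodule.pow_one]
      exact coeffFun_mem_coeffSpan hp x y
  calc β ^ lengthFun (generators n) p ≤ β ^ 1 := pow_le_pow_right₀ hβ h1
    _ = β := pow_one β

theorem Spec.toSL_mem_spectralSet (hn : 1 ≤ n) (φ : Spec (expWeight (generators n) β hβ)) :
    φ.toSL hn ∈ spectralSet n β := by
  rw [← inv_inv (φ.toSL hn)]
  refine inv_mem_spectralSet hn (mem_spectralSet_of_norm_le hn fun k => ?_)
  obtain ⟨p, hp, he⟩ := exists_mem_generators hn k
  exact (φ.norm_extension_inv_le (V := HWSpace n (Pi.single k 1)) hn p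
    isHolomorphicExtension_hwRepC he).trans (expWeight_generators_le hp)

/-- On trigonometric polynomials both functionals evaluate the holomorphic extension at the same
matrix. Both are contractive, so the difference is bounded with constant `2` and vanishes by
density. -/
theorem Spec.toSpec_toSL (hn : 1 ≤ n) (φ : Spec (expWeight (generators n) β hβ)) :
    toSpec hβ hn ⟨φ.toSL hn, φ.toSL_mem_spectralSet hn⟩ = φ := by
  refine Subtype.ext (sub_eq_zero.1 ?_)
  refine eq_zero_of_vanish_trigPoly _ (C := 2) (fun f => ?_) fun f hf => ?_
  · rw [LinearMap.sub_apply, two_mul]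
    exact (norm_sub_le _ _).trans (add_le_add (norm_character_le hβ hn _ f) (φ.norm_le hn f))
  · obtain ⟨F, hF, hFf⟩ := exists_isHolomorphic_of_mem_trigPoly hn hf
    rw [LinearMap.sub_apply, φ.apply_eq hn f hf hF hFf]
    exact sub_eq_zero.2 (character_eq hβ hn _ f hf hF hFf)

variable (hβ) in
/-- The Gelfand spectrum of `A(SU(n), w^S_β)` is homeomorphic to `spectralSet n β`. -/
def specHomeomorph (hn : 1 ≤ n) :
    spectralSet n β ≃ₜ Spec (expWeight (generators n) β hβ) where
  toFun := toSpec hβ hn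
  invFun φ := ⟨φ.toSL hn, φ.toSL_mem_spectralSet hn⟩
  left_inv A := by
    refine Subtype.ext (Subtype.ext ?_)
    ext i j
    exact character_entryFun hβ hn A i j
  right_inv φ := φ.toSpec_toSL hn
  continuous_toFun := continuous_induced_rng.2
    (continuous_pi fun f => continuous_character hβ hn f)
  -- The entries of the matrix of `φ` are the values of `φ` on the entry functions, so pointwise
  -- convergence suffices.
  continuous_invFun := by
    refine Continuous.subtype_mk (continuous_induced_rng.2
      (continuous_pi fun i => continuous_pi fun j => ?_)) _
    have h : Continuous fun (φ : Spec (expWeight (generators n) β hβ))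
        (f : beurlingFourier (expWeight (generators n) β hβ)) => φ.1 f :=
      continuous_induced_dom
    exact (continuous_apply (⟨entryFun i j, polyAlg_subset_beurlingFourier hβ hn
      (entryFun_mem_polyAlg i j)⟩ : beurlingFourier (expWeight (generators n) β hβ))).comp h

theorem specHomeomorph_coeff (hn : 1 ≤ n) (A : spectralSet n β) (π : UnitaryIrrep (SU n))
    {σ : Representation ℂ (SL n) (EuclideanSpace ℂ (Fin π.dim))}
    (h : IsHolomorphicExtension π.rep σ) (v w : EuclideanSpace ℂ (Fin π.dim)) :
    ∃ h : π.coeff v w ∈ beurlingFourier (expWeight (generators n) β hβ),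
      (specHomeomorph hβ hn A).1 ⟨π.coeff v w, h⟩ = inner ℂ w (σ A v) := by
  have hc : π.coeff v w ∈ trigPoly (SU n) := coeffFun_mem_trigPoly π.isContUnitary v w
  refine ⟨trigPoly_le_beurlingFourier hc, ?_⟩
  exact character_eq hβ hn A _ hc (isHolomorphic_inner h.1 v w) fun g => by rw [h.2]; rfl

end Spectrum

end BeurlingFourier

end

theorem mainTheorem12 (n : ℕ) (hn : 1 ≤ n) :
    -- the representations in question, and their unique holomorphic extensions
    (∀ a : Fin (n - 1) → ℕ, IsHolomorphicExtension (V := HWSpace n a) (hwRep n a) (hwRepC n a) ∧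
      ∀ σ, IsHolomorphicExtension (V := HWSpace n a) (hwRep n a) σ → σ = hwRepC n a) ∧
    -- the operator norm of the holomorphic extension of `π_a` at `diag(x₁, …, x_n)`
    (∀ (D : SL n) (x : Fin n → ℂ), D.1 = Matrix.diagonal x → ∀ a : Fin (n - 1) → ℕ,
      ‖LinearMap.toContinuousLinearMap (hwRepC n a D)‖
        = ∏ k, ‖LinearMap.toContinuousLinearMap (hwRepC n (Pi.single k 1) D)‖ ^ a k ∧
      (Antitone (fun i => ‖x i‖) →
        ‖LinearMap.toContinuousLinearMap (hwRepC n a D)‖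
          = ∏ k : Fin (n - 1), ‖∏ i with i.val ≤ k.val, x i‖ ^ a k)) ∧
    -- the spectrum of `A(SU(n), w^S_β)`
    (∀ π : UnitaryIrrep (SU n), ∃! σ, IsHolomorphicExtension π.rep σ) ∧
    ∀ (β : ℝ) (hβ : 1 ≤ β),
      (∀ f g : beurlingFourier (expWeight (generators n) β hβ),
        (f * g : C(SU n, ℂ)) ∈ beurlingFourier (expWeight (generators n) β hβ)) ∧
      ∃ Θ : ↥(spectralSet n β) ≃ₜ Spec (expWeight (generators n) β hβ),
        ∀ (A : spectralSet n β) (π : UnitaryIrrep (SU n))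
          (σ : Representation ℂ (SL n) (EuclideanSpace ℂ (Fin π.dim))),
          IsHolomorphicExtension π.rep σ → ∀ v w,
            ∃ h : π.coeff v w ∈ beurlingFourier (expWeight (generators n) β hβ),
              (Θ A).1 ⟨π.coeff v w, h⟩ = inner ℂ w (σ A v) := by
  refine ⟨fun a => ⟨isHolomorphicExtension_hwRepC, fun σ hσ =>
    IsHolomorphicExtension.unique (V := HWSpace n a) hn hσ isHolomorphicExtension_hwRepC⟩,
    fun D x hD a => ⟨norm_hwRepC_diagonal_eq_prod hn hD, norm_hwRepC_diagonal hD⟩, fun π => ?_,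
    fun β hβ => ⟨mul_mem_beurlingFourier_SU hn, specHomeomorph hβ hn, fun A π σ hσ v w =>
      specHomeomorph_coeff hn A π hσ v w⟩⟩
  obtain ⟨σ, hσ⟩ := exists_isHolomorphicExtension hn π.isContUnitary
  exact ⟨σ, hσ, fun τ hτ => hτ.unique hn hσ⟩
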